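/- Let $\mathbb S=\mathbb R/\mathbb Z$. For real $r\ge 0$ let $H^r(\mathbb S)$ be the Sobolev space of real functions with norm $\|f\|_{H^r}^2=\sum_{n\in\mathbb Z}(1+n^2)^r|\hat f(n)|^2$ (for $r>1/2$ its elements are identified with their continuous representatives), and let $H^r_0(\mathbb S)=\{f\in H^r(\mathbb S): f(0)=0\}$ for $r>1/2$. Let $s\ge 2$ be real, let $(u_0,\rho_0)\in H^s_0(\mathbb S)\times H^{s-1}(\mathbb S)$, and put $$c=\tfrac14\int_{\mathbb S}\bigl(u_{0x}^2-\rho_0^2\bigr)\,dx .$$ Suppose that $c\in\{1,0,-1\}$. For $0<T\le\infty$, a solution on $[0,T)$ is a pair $$(u,\rho)\in C\bigl([0,T);H^s_0(\mathbb S)\times H^{s-1}(\mathbb S)\bigr)\cap C^1\bigl([0,T);H^{s-1}_0(\mathbb S)\times H^{s-2}(\mathbb S)\bigr)$$ with $u(0,\cdot)=u_0$, $\rho(0,\cdot)=\rho_0$ that satisfies, in the sense of distributions on $\mathbb S$ at each time $t\in[0,T)$, the two-component Hunter–Saxton system with $\kappa=-1$, $$m_t+um_x+2u_xm-\rho\rho_x=0,\qquad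 \rho_t+(u\rho)_x=0,\qquad m=-u_{xx},$$ where $um_x+2u_xm$ is understood as $-(uu_x)_{xx}+\tfrac12(u_x^2)_x$. With $\inf\emptyset=\infty$ define $$T^*=\begin{cases} \dfrac{\pi}{2}+\min\Bigl\{\arctan\Bigl[\min_{\mathbb S}\dfrac{u_{0x}-\rho_0}{2}\Bigr],\ \arctan\Bigl[\min_{\mathbb S}\dfrac{u_{0x}+\rho_0}{2}\Bigr]\Bigr\}, & c=1,\\[3mm] \min\Bigl\{\inf_{\{u_{0x}<\rho_0\}}\dfrac{-2}{u_{0x}-\rho_0},\ \inf_{\{u_{0x}+\rho_0<0\}}\dfrac{-2}{u_{0x}+\rho_0}\Bigr\}, & c=0,\\[3mm] \min\Bigl\{\inf_{\{\rho_0-u_{0x}>2\}}\operatorname{arccoth}\dfrac{\rho_0-u_{0x}}{2},\ \inf_{\{u_{0x}+\rho_0<-2\}}\operatorname{arccoth}\dfrac{-u_{0x}-\rho_0}{2}\Bigr\}, & c=-1, \end{cases}$$ and, for $t\ge 0$ and $x\in\mathbb R$, $$\Phi(t,x)=\begin{cases} \int_0^x\Bigl[\bigl(\cos t+\tfrac{u_{0x}(y)}2\sin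 t\bigr)^2-\tfrac{\rho_0(y)^2}4\sin^2t\Bigr]dy, & c=1,\\[2mm] \int_0^x\Bigl[\bigl(1+\tfrac{u_{0x}(y)}2\,t\bigr)^2-\tfrac{\rho_0(y)^2}4\,t^2\Bigr]dy, & c=0,\\[2mm] \int_0^x\Bigl[\bigl(\cosh t+\tfrac{u_{0x}(y)}2\sinh t\bigr)^2-\tfrac{\rho_0(y)^2}4\sinh^2t\Bigr]dy, & c=-1. \end{cases}$$ Then: 1. $0<T^*\le\infty$, and there is a solution on $[0,T^*)$. Any two solutions on the same interval $[0,T)$ coincide, and if there is a solution on $[0,T)$, then $T\le T^*$. Thus $T^*$ is the maximal existence time. 2. If $(u,\rho)$ is a solution on $[0,T)$, then the Lagrangian flow map equation $\varphi_t(t,x)=u(t,\varphi(t,x))$, $\varphi(0,x)=x$, with $\varphi(t,0)=0$, has a solution $\varphi$ on $[0,T)$ (lifted to $\mathbb R$), and every such $\varphi$ is given by $\varphi(t,x)=\Phi(t,x)$ for all $t\in[0,T)$ and $x\in\mathbb R$. 3. $T^*$ is the first time at which $\Phi(t,\cdot)$ ceases to be a $C^1$ diffeomorphism of $\mathbb S$: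 for $0\le t<T^*$ the map $\Phi(t,\cdot)$ is (the lift of) an orientation-preserving $C^1$ diffeomorphism of $\mathbb S$, in particular it is injective, and if $T^*<\infty$, then $\Phi_x(T^*,x)=0$ for some $x$. If moreover $\Phi_x(T^*,x)=0$ for some $x$ with $\rho_0(x)\ne0$, then there is $\varepsilon>0$ such that $\Phi(t,\cdot)$ is not injective for any $t\in(T^*,T^*+\varepsilon)$. 4. If $c=-1$, then there is a solution on $[0,\infty)$ if and only if $|\rho_0(x)|\le u_{0x}(x)+2$ for all $x\in\mathbb S$. If $c=1$, or if $c=0$ and $(u_0,\rho_0)\ne(0,0)$, then $T^*<\infty$, and there is no solution on $[0,\infty)$. -/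

import Mathlib

open Set Filter Topology MeasureTheory

noncomputable section

namespace HunterSaxton

/-!
Functions on the circle `ℝ / ℤ` are represented by `1`-periodic functions `ℝ → ℝ`.
-/

/-- The `n`-th Fourier coefficient `∫₀¹ f(x) exp(-2πinx) dx` of a real function of period `1`. -/
def fourierC (f : ℝ → ℝ) (n : ℤ) : ℂ :=
  fourierCoeffOn (zero_lt_one : (0 : ℝ) < 1) (fun x => (f x : ℂ)) n

/-- `f` belongs to `H^r(ℝ/ℤ)`, for real `r ≥ 0`: it is square integrable over a period and
`∑ (1 + n²)^r |f̂(n)|² < ∞`. If `r > 1/2`, the class of `f` has exactly one continuous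
representative, and `f` is required to be that representative. -/
structure MemH (r : ℝ) (f : ℝ → ℝ) : Prop where
  periodic : Function.Periodic f 1
  memLp : MemLp f 2 (volume.restrict (Ioc 0 1))
  summable : Summable fun n : ℤ => (1 + (n : ℝ) ^ 2) ^ r * ‖fourierC f n‖ ^ 2
  continuous : 1 / 2 < r → Continuous f

/-- `f ∈ H^r_0(ℝ/ℤ)`: `f` is in `H^r` and vanishes at `0`
(used only for `r > 1/2`, where `f` is continuous). -/
def MemH0 (r : ℝ) (f : ℝ → ℝ) : Prop := MemH r f ∧ f 0 = 0

/-- The norm of `H^r(ℝ/ℤ)` (meaningful on functions that satisfy `MemH r`). -/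
def normH (r : ℝ) (f : ℝ → ℝ) : ℝ :=
  Real.sqrt (∑' n : ℤ, (1 + (n : ℝ) ^ 2) ^ r * ‖fourierC f n‖ ^ 2)

/-- The time interval `[0, T)`, where `T` may be `∞`. -/
def timeInterval (T : EReal) : Set ℝ := {t | 0 ≤ t ∧ (t : EReal) < T}

/-- `w ∈ C([0,T); H^r)`. -/
def ContH (r : ℝ) (T : EReal) (w : ℝ → ℝ → ℝ) : Prop :=
  (∀ t ∈ timeInterval T, MemH r (w t)) ∧
  ∀ t ∈ timeInterval T,
    Tendsto (fun τ => normH r (fun x => w τ x - w t x)) (𝓝[timeInterval T] t) (𝓝 0)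

/-- On `[0,T)`, the curve `t ↦ w t` is differentiable in the norm of `H^r`, with derivative `w'`
(one-sided at `t = 0`). -/
def HasDerivH (r : ℝ) (T : EReal) (w w' : ℝ → ℝ → ℝ) : Prop :=
  ∀ t ∈ timeInterval T,
    Tendsto (fun τ => normH r (fun x => (w τ x - w t x) / (τ - t) - w' t x))
      (𝓝[timeInterval T \ {t}] t) (𝓝 0)

/-- Test functions on the circle. -/
def IsTest (ψ : ℝ → ℝ) : Prop := ContDiff ℝ (⊤ : ℕ∞) ψ ∧ Function.Periodic ψ 1

/-- The equation `m_t + u m_x + 2 u_x m + κ ρ ρ_x = 0`, `m = -u_xx`, at a fixed time, in the sense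
of distributions on the circle, where `v` is the time derivative of `u`. As
`u m_x + 2 u_x m = -(u u_x)_xx + (u_x² / 2)_x`, it reads
`-(v + u u_x)_xx + ((u_x² + κ ρ²) / 2)_x = 0`. -/
def WeakMomentumEq (κ : ℝ) (u v ρ : ℝ → ℝ) : Prop :=
  ∀ ψ, IsTest ψ →
    ∫ x in (0 : ℝ)..1,
      (-(v x + u x * deriv u x) * deriv (deriv ψ) x
        - (1 / 2) * ((deriv u x) ^ 2 + κ * (ρ x) ^ 2) * deriv ψ x) = 0

/-- The equation `ρ_t + (u ρ)_x = 0` at a fixed time, in the sense of distributions on the circle,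
where `σ` is the time derivative of `ρ`. -/
def WeakContinuityEq (u ρ σ : ℝ → ℝ) : Prop :=
  ∀ ψ, IsTest ψ → ∫ x in (0 : ℝ)..1, (σ x * ψ x - u x * ρ x * deriv ψ x) = 0

/-- `(u, ρ) ∈ C([0,T); H^s_0 × H^{s-1}) ∩ C¹([0,T); H^{s-1}_0 × H^{s-2})` is a solution on `[0,T)`,
`0 < T ≤ ∞`, of the two-component Hunter–Saxton system with coupling constant `κ` and initial data
`(u₀, ρ₀)`. -/
structure IsSolution (κ s : ℝ) (T : EReal) (u₀ ρ₀ : ℝ → ℝ) (u ρ : ℝ → ℝ → ℝ) : Prop where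
  pos : 0 < T
  cont_u : ContH s T u
  zero_u : ∀ t ∈ timeInterval T, u t 0 = 0
  cont_rho : ContH (s - 1) T ρ
  exists_deriv : ∃ v σ : ℝ → ℝ → ℝ,
    ContH (s - 1) T v ∧ (∀ t ∈ timeInterval T, v t 0 = 0) ∧ HasDerivH (s - 1) T u v ∧
    ContH (s - 2) T σ ∧ HasDerivH (s - 2) T ρ σ ∧
    ∀ t ∈ timeInterval T,
      WeakMomentumEq κ (u t) (v t) (ρ t) ∧ WeakContinuityEq (u t) (ρ t) (σ t)
  init_u : u 0 = u₀
  init_rho : ρ 0 = ρ₀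

/-- `φ` is (the lift to `ℝ` of) the Lagrangian flow map of `u` on `[0,T)`:
`φ_t(t,x) = u(t,φ(t,x))`, `φ(0,x) = x`, `φ(t,0) = 0`. -/
structure IsFlow (T : EReal) (u φ : ℝ → ℝ → ℝ) : Prop where
  ode : ∀ t ∈ timeInterval T, ∀ x,
    HasDerivWithinAt (fun τ => φ τ x) (u t (φ t x)) (timeInterval T) t
  init : ∀ x, φ 0 x = x
  zero : ∀ t ∈ timeInterval T, φ t 0 = 0

/-- `f` is the lift to `ℝ` of an orientation-preserving `C¹` diffeomorphism of the circle. -/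
structure IsCircleDiffeo (f : ℝ → ℝ) : Prop where
  contDiff : ContDiff ℝ 1 f
  map_add_one : ∀ x, f (x + 1) = f x + 1
  deriv_pos : ∀ x, 0 < deriv f x

/-- The constant `c = (1/4) ∫ (u_{0x}² - ρ₀²) dx`. -/
def energy (u₀ ρ₀ : ℝ → ℝ) : ℝ :=
  (1 / 4) * ∫ x in (0 : ℝ)..1, ((deriv u₀ x) ^ 2 - (ρ₀ x) ^ 2)

/-- The explicit flow map in the cases `c = 1`, `c = 0`, `c = -1` (the last branch); it makes sense
for all `t`. -/
def explicitFlow (c : ℝ) (u₀ ρ₀ : ℝ → ℝ) (t x : ℝ) : ℝ :=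
  if c = 1 then
    ∫ y in (0 : ℝ)..x,
      ((Real.cos t + deriv u₀ y / 2 * Real.sin t) ^ 2 - (ρ₀ y) ^ 2 / 4 * (Real.sin t) ^ 2)
  else if c = 0 then
    ∫ y in (0 : ℝ)..x, ((1 + deriv u₀ y / 2 * t) ^ 2 - (ρ₀ y) ^ 2 / 4 * t ^ 2)
  else
    ∫ y in (0 : ℝ)..x,
      ((Real.cosh t + deriv u₀ y / 2 * Real.sinh t) ^ 2 - (ρ₀ y) ^ 2 / 4 * (Real.sinh t) ^ 2)

/-- The inverse hyperbolic cotangent on `(1, ∞)`. -/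
def arccoth (y : ℝ) : ℝ := Real.artanh y⁻¹

/-- The critical time `T* ∈ (0,∞]` in the cases `c = 1`, `c = 0`, `c = -1` (the last branch).
The infimum over an empty set of points is `∞`. -/
def criticalTime (c : ℝ) (u₀ ρ₀ : ℝ → ℝ) : EReal :=
  if c = 1 then
    ((Real.pi / 2 + min (Real.arctan (⨅ x : ℝ, (deriv u₀ x - ρ₀ x) / 2))
      (Real.arctan (⨅ x : ℝ, (deriv u₀ x + ρ₀ x) / 2)) : ℝ) : EReal)
  else if c = 0 then
    min (⨅ (x : ℝ) (_ : deriv u₀ x < ρ₀ x), ((-2 / (deriv u₀ x - ρ₀ x) : ℝ) : EReal))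
      (⨅ (x : ℝ) (_ : deriv u₀ x + ρ₀ x < 0), ((-2 / (deriv u₀ x + ρ₀ x) : ℝ) : EReal))
  else
    min (⨅ (x : ℝ) (_ : 2 < ρ₀ x - deriv u₀ x), (arccoth ((ρ₀ x - deriv u₀ x) / 2) : EReal))
      (⨅ (x : ℝ) (_ : deriv u₀ x + ρ₀ x < -2), (arccoth ((-deriv u₀ x - ρ₀ x) / 2) : EReal))

end HunterSaxton

end

/-! The system becomes explicitly solvable in Lagrangian variables. Let `φ` be the flow of `u` and
`J = φ_x`. The continuity equation says `(ρ∘φ) J = ρ₀`. The momentum equation, integrated once in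
space, says that `(u_t + u u_x)_x = (u_x² - ρ²)/2 - 2c`; the constant is the one compatible with
periodicity when `∫ (u_x² - ρ²) = 4c`. Since `φ_t = u∘φ`, the two combine to `2 J J_tt = J_t² - ρ₀²
- 4c J²`, which is solved by the product of the two factors `C + ((u₀' ∓ ρ₀)/2) S`. Here `C` and `S`
are the fundamental solutions of `y'' = -c y`, so each factor solves a linear equation at each
point.

Existence. `J` is a combination of `1`, `u₀'` and `(u₀'² - ρ₀²)/4` with coefficients that depend on
time only. The means of these functions are `1`, `0` and `c`, so `J` has mean `C² + c S² = 1`. As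
long as `J > 0`, its primitive is therefore a circle diffeomorphism, and `u = φ_t∘φ⁻¹`, `ρ =
(ρ₀/J)∘φ⁻¹` are defined. The identity `Data.jac'_sq_sub` turns these formulas into the two equations
(`Data.isSolution`).

The analytic weight lies in the claim that these curves are continuous and differentiable in the
right Sobolev spaces of real order. It rests on products (`exists_mul_gap`, `TendH.mul`), inverses
of positive functions (`TendH.inv`) and composition with varying diffeomorphisms (`TendH.comp`).
Composition is treated through the Gagliardo double integral for orders in `(0,1)`, by change of
variables in `L²` for order `0`, and by the chain rule above that. Time derivatives are obtained on
Fourier coefficients, where a change of variables puts the diffeomorphism into the smooth character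
(`fourierC_comp`), and are lifted to norms by `hasDerivH_of_fourierC`.

Uniqueness. For `s ≥ 2` the weak equations hold almost everywhere (`strong_of_weak`), and a Grönwall
estimate for `‖u_x - w_x‖² + ‖ρ - η‖²` in `L²` closes (`abs_integral_le`, `IsSolution.unique`).

Maximality. `T*` is the first zero of a factor of `J`, since the first zero of `C + m S` increases
with `m` and the minimal slope is attained (`exists_firstZero`). A solution living beyond `T*` would
have bounded `u_x = (J_t/J)∘φ⁻¹` on `[0,T*)`, and then `J` could not reach zero
(`Data.jac_ne_zero`). Where `J` vanishes but `ρ₀` does not, `J_t² = ρ₀² ≠ 0`, so `J` changes sign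
and injectivity is lost. -/

noncomputable section

namespace HunterSaxton

/-! ### Sobolev spaces in terms of Fourier coefficients: linear structure and convergence -/

/-- The squared `H^r` norm. -/
def normSq (r : ℝ) (f : ℝ → ℝ) : ℝ :=
  ∑' n : ℤ, (1 + (n : ℝ) ^ 2) ^ r * ‖fourierC f n‖ ^ 2

/-- The character `exp (-2πinx)`. -/
def char (n : ℤ) (x : ℝ) : ℂ := Complex.exp (((-(2 * Real.pi * n * x) : ℝ) : ℂ) * Complex.I)

lemma weight_pos (r : ℝ) (n : ℤ) : 0 < (1 + (n : ℝ) ^ 2) ^ r := by positivity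

lemma weight_mono {q r : ℝ} (h : q ≤ r) (n : ℤ) :
    (1 + (n : ℝ) ^ 2) ^ q ≤ (1 + (n : ℝ) ^ 2) ^ r :=
  Real.rpow_le_rpow_of_exponent_le (by nlinarith [sq_nonneg (n : ℝ)]) h

lemma normSq_nonneg (r : ℝ) (f : ℝ → ℝ) : 0 ≤ normSq r f :=
  tsum_nonneg fun n => by positivity

lemma normH_sq (r : ℝ) (f : ℝ → ℝ) : normH r f ^ 2 = normSq r f :=
  Real.sq_sqrt (normSq_nonneg r f)

lemma tendsto_normH_iff {ι : Type*} {l : Filter ι} {r : ℝ} {F : ι → ℝ → ℝ} :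
    Tendsto (fun i => normH r (F i)) l (𝓝 0) ↔ Tendsto (fun i => normSq r (F i)) l (𝓝 0) := by
  constructor
  · intro h
    have := h.pow 2
    simpa [normH_sq] using this
  · intro h
    have := (Real.continuous_sqrt.tendsto 0).comp h
    simpa [Function.comp_def, normH, normSq] using this

@[fun_prop]
lemma continuous_char (n : ℤ) : Continuous (char n) := by unfold char; fun_prop

lemma norm_char (n : ℤ) (x : ℝ) : ‖char n x‖ = 1 := by
  unfold char; exact Complex.norm_exp_ofReal_mul_I _

lemma char_re_im (n : ℤ) (x : ℝ) :
    char n x = (Real.cos (2 * Real.pi * n * x) : ℂ) - (Real.sin (2 * Real.pi * n * x) : ℂ) * Complex.I := by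
  unfold char
  rw [Complex.exp_mul_I, ← Complex.ofReal_cos, ← Complex.ofReal_sin, Real.cos_neg, Real.sin_neg]
  push_cast; ring

lemma fourierC_eq_integral (f : ℝ → ℝ) (n : ℤ) :
    fourierC f n = ∫ x in (0 : ℝ)..1, char n x * (f x : ℂ) := by
  unfold fourierC
  rw [fourierCoeffOn_eq_integral]
  simp only [sub_zero, ne_eq, one_ne_zero, not_false_eq_true, div_self, one_smul, smul_eq_mul]
  refine intervalIntegral.integral_congr fun x _ => ?_
  rw [fourier_coe_apply]
  unfold char
  congr 2
  push_cast
  ring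

lemma MemLp.intervalIntegrable_unit {f : ℝ → ℝ} (h : MemLp f 2 (volume.restrict (Ioc 0 1))) :
    IntervalIntegrable f volume 0 1 := by
  rw [intervalIntegrable_iff_integrableOn_Ioc_of_le zero_le_one]
  exact h.integrable (by norm_num)

lemma intervalIntegrable_char_mul {f : ℝ → ℝ} {a b : ℝ} (n : ℤ) (h : IntervalIntegrable f volume a b) :
    IntervalIntegrable (fun x => char n x * (f x : ℂ)) volume a b := by
  have h2 : IntervalIntegrable (fun x => (f x : ℂ)) volume a b := by
    constructor
    · exact h.1.ofReal
    · exact h.2.ofReal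
  exact h2.continuousOn_mul (continuous_char n).continuousOn

lemma fourierC_add {f g : ℝ → ℝ} (hf : IntervalIntegrable f volume 0 1)
    (hg : IntervalIntegrable g volume 0 1) (n : ℤ) :
    fourierC (fun x => f x + g x) n = fourierC f n + fourierC g n := by
  simp only [fourierC_eq_integral]
  rw [← intervalIntegral.integral_add (intervalIntegrable_char_mul n hf)
    (intervalIntegrable_char_mul n hg)]
  congr 1; ext x; push_cast; ring

lemma fourierC_sub {f g : ℝ → ℝ} (hf : IntervalIntegrable f volume 0 1)
    (hg : IntervalIntegrable g volume 0 1) (n : ℤ) :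
    fourierC (fun x => f x - g x) n = fourierC f n - fourierC g n := by
  simp only [fourierC_eq_integral]
  rw [← intervalIntegral.integral_sub (intervalIntegrable_char_mul n hf)
    (intervalIntegrable_char_mul n hg)]
  congr 1; ext x; push_cast; ring

lemma fourierC_const_mul (c : ℝ) (f : ℝ → ℝ) (n : ℤ) :
    fourierC (fun x => c * f x) n = c * fourierC f n := by
  simp only [fourierC_eq_integral]
  rw [← intervalIntegral.integral_const_mul]
  congr 1; ext x; push_cast; ring

lemma fourierC_congr_ae {f g : ℝ → ℝ} (h : f =ᵐ[volume] g) (n : ℤ) : fourierC f n = fourierC g n := by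
  simp only [fourierC_eq_integral]
  refine intervalIntegral.integral_congr_ae ?_
  filter_upwards [h] with x hx _
  rw [hx]

lemma hasSum_sq_fourierC {f : ℝ → ℝ} (h : MemLp f 2 (volume.restrict (Ioc 0 1))) :
    HasSum (fun n => ‖fourierC f n‖ ^ 2) (∫ x in (0 : ℝ)..1, (f x) ^ 2) := by
  have := hasSum_sq_fourierCoeffOn (zero_lt_one : (0 : ℝ) < 1) (f := fun x => (f x : ℂ)) h.ofReal
  simpa [fourierC] using this

lemma normSq_zero_eq {f : ℝ → ℝ} (h : MemLp f 2 (volume.restrict (Ioc 0 1))) :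
    normSq 0 f = ∫ x in (0 : ℝ)..1, (f x) ^ 2 := by
  rw [← (hasSum_sq_fourierC h).tsum_eq]; simp [normSq]

lemma memH_zero_of {f : ℝ → ℝ} (hp : Function.Periodic f 1)
    (h : MemLp f 2 (volume.restrict (Ioc 0 1))) : MemH 0 f where
  periodic := hp
  memLp := h
  summable := by simpa using (hasSum_sq_fourierC h).summable
  continuous := fun h => by norm_num at h

lemma memLp_of_continuous {f : ℝ → ℝ} (h : Continuous f) : MemLp f 2 (volume.restrict (Ioc 0 1)) := by
  obtain ⟨C, hC⟩ := isCompact_Icc.exists_bound_of_continuousOn (h.continuousOn (s := Icc (0 : ℝ) 1))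
  refine MemLp.of_bound h.aestronglyMeasurable C ?_
  rw [ae_restrict_iff' measurableSet_Ioc]
  exact ae_of_all _ fun x hx => hC x ⟨hx.1.le, hx.2⟩

namespace MemH
variable {r : ℝ} {f g : ℝ → ℝ}

lemma intervalIntegrable (h : MemH r f) : IntervalIntegrable f volume 0 1 :=
  MemLp.intervalIntegrable_unit h.memLp

lemma intervalIntegrable' (h : MemH r f) (a b : ℝ) : IntervalIntegrable f volume a b := by
  have := h.intervalIntegrable
  refine h.periodic.intervalIntegrable (t := 0) one_ne_zero ?_ a b
  simpa using this

lemma add (hf : MemH r f) (hg : MemH r g) : MemH r (fun x => f x + g x) where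
  periodic := hf.periodic.add hg.periodic
  memLp := hf.memLp.add hg.memLp
  summable := by
    refine Summable.of_nonneg_of_le (fun n => by positivity) (fun n => ?_)
      ((hf.summable.mul_left 2).add (hg.summable.mul_left 2))
    rw [fourierC_add hf.intervalIntegrable hg.intervalIntegrable]
    have h1 : ‖fourierC f n + fourierC g n‖ ^ 2 ≤ 2 * ‖fourierC f n‖ ^ 2 + 2 * ‖fourierC g n‖ ^ 2 := by
      nlinarith [norm_add_le (fourierC f n) (fourierC g n), sq_nonneg (‖fourierC f n‖ - ‖fourierC g n‖),
        norm_nonneg (fourierC f n + fourierC g n)]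
    nlinarith [weight_pos r n]
  continuous := fun h => (hf.continuous h).add (hg.continuous h)

lemma const_mul (c : ℝ) (hf : MemH r f) : MemH r (fun x => c * f x) where
  periodic := fun x => by simp only [hf.periodic x]
  memLp := hf.memLp.const_mul c
  summable := by
    refine (hf.summable.mul_left (c ^ 2)).congr fun n => ?_
    rw [fourierC_const_mul, norm_mul, mul_pow, Complex.norm_real, Real.norm_eq_abs, sq_abs]; ring
  continuous := fun h => continuous_const.mul (hf.continuous h)

lemma neg (hf : MemH r f) : MemH r (fun x => -f x) := by simpa using hf.const_mul (-1)

lemma sub (hf : MemH r f) (hg : MemH r g) : MemH r (fun x => f x - g x) := by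
  simpa [sub_eq_add_neg] using hf.add hg.neg

lemma mono {q : ℝ} (hf : MemH r f) (h : q ≤ r) : MemH q f where
  periodic := hf.periodic
  memLp := hf.memLp
  summable := Summable.of_nonneg_of_le (fun n => by positivity)
    (fun n => mul_le_mul_of_nonneg_right (weight_mono h n) (by positivity)) hf.summable
  continuous := fun h' => hf.continuous (h'.trans_le h)

end MemH

/-- The factor `2` from `(a + b)² ≤ 2a² + 2b²` replaces Minkowski's inequality. This is enough
because squared norms are only ever shown to be bounded or to tend to zero. -/
lemma normSq_add_le {r : ℝ} {f g : ℝ → ℝ} (hf : MemH r f) (hg : MemH r g) :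
    normSq r (fun x => f x + g x) ≤ 2 * normSq r f + 2 * normSq r g := by
  unfold normSq
  rw [← tsum_mul_left, ← tsum_mul_left, ← (hf.summable.mul_left 2).tsum_add (hg.summable.mul_left 2)]
  refine (hf.add hg).summable.tsum_le_tsum (fun n => ?_) ((hf.summable.mul_left 2).add (hg.summable.mul_left 2))
  rw [fourierC_add hf.intervalIntegrable hg.intervalIntegrable]
  have h1 : ‖fourierC f n + fourierC g n‖ ^ 2 ≤ 2 * ‖fourierC f n‖ ^ 2 + 2 * ‖fourierC g n‖ ^ 2 := by
    nlinarith [norm_add_le (fourierC f n) (fourierC g n), sq_nonneg (‖fourierC f n‖ - ‖fourierC g n‖),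
      norm_nonneg (fourierC f n + fourierC g n)]
  nlinarith [weight_pos r n]

lemma normSq_const_mul (r c : ℝ) (f : ℝ → ℝ) :
    normSq r (fun x => c * f x) = c ^ 2 * normSq r f := by
  unfold normSq
  rw [← tsum_mul_left]
  congr 1; ext n
  rw [fourierC_const_mul, norm_mul, mul_pow, Complex.norm_real, Real.norm_eq_abs, sq_abs]; ring

lemma normSq_mono {q r : ℝ} {f : ℝ → ℝ} (hf : MemH r f) (h : q ≤ r) : normSq q f ≤ normSq r f :=
  (hf.mono h).summable.tsum_le_tsum
    (fun n => mul_le_mul_of_nonneg_right (weight_mono h n) (by positivity)) hf.summable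

/-- Convergence in `H^r` along a filter. -/
structure TendH (r : ℝ) {ι : Type*} (l : Filter ι) (F : ι → ℝ → ℝ) (f : ℝ → ℝ) : Prop where
  mem : ∀ᶠ i in l, MemH r (F i)
  lim_mem : MemH r f
  tendsto : Tendsto (fun i => normSq r (fun x => F i x - f x)) l (𝓝 0)

/-- Continuity in time is rephrased as convergence along a filter, so that every closure property of
`TendH` (products, inverses, compositions, primitives) passes to curves. -/
lemma contH_iff {r : ℝ} {T : EReal} {w : ℝ → ℝ → ℝ} :
    ContH r T w ↔ ∀ t ∈ timeInterval T, TendH r (𝓝[timeInterval T] t) w (w t) := by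
  constructor
  · rintro ⟨h1, h2⟩ t ht
    refine ⟨?_, h1 t ht, tendsto_normH_iff.1 (h2 t ht)⟩
    filter_upwards [self_mem_nhdsWithin] with τ hτ using h1 τ hτ
  · intro h
    exact ⟨fun t ht => (h t ht).lim_mem, fun t ht => tendsto_normH_iff.2 (h t ht).tendsto⟩

namespace TendH
variable {r q : ℝ} {ι : Type*} {l : Filter ι} {F G : ι → ℝ → ℝ} {f g : ℝ → ℝ}

lemma congr (h : TendH r l F f) (hFG : ∀ᶠ i in l, F i = G i) : TendH r l G f where
  mem := by filter_upwards [h.mem, hFG] with i hi e using e ▸ hi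
  lim_mem := h.lim_mem
  tendsto := by
    refine h.tendsto.congr' ?_
    filter_upwards [hFG] with i e
    rw [e]

lemma mono (h : TendH r l F f) (hq : q ≤ r) : TendH q l F f where
  mem := by filter_upwards [h.mem] with i hi using hi.mono hq
  lim_mem := h.lim_mem.mono hq
  tendsto := by
    refine squeeze_zero' (Eventually.of_forall fun i => normSq_nonneg _ _) ?_ h.tendsto
    filter_upwards [h.mem] with i hi using normSq_mono (hi.sub h.lim_mem) hq

lemma const (hf : MemH r f) (l : Filter ι) : TendH r l (fun _ => f) f where
  mem := Eventually.of_forall fun _ => hf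
  lim_mem := hf
  tendsto := by
    have : normSq r (fun x => f x - f x) = 0 := by
      have := normSq_const_mul r 0 f
      simpa using this
    simp only [this]; exact tendsto_const_nhds

lemma add (hF : TendH r l F f) (hG : TendH r l G g) :
    TendH r l (fun i x => F i x + G i x) (fun x => f x + g x) where
  mem := by filter_upwards [hF.mem, hG.mem] with i h1 h2 using h1.add h2
  lim_mem := hF.lim_mem.add hG.lim_mem
  tendsto := by
    have h0 : Tendsto (fun i => 2 * normSq r (fun x => F i x - f x) + 2 * normSq r (fun x => G i x - g x))
        l (𝓝 0) := by simpa using (hF.tendsto.const_mul 2).add (hG.tendsto.const_mul 2)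
    refine squeeze_zero' (Eventually.of_forall fun i => normSq_nonneg _ _) ?_ h0
    filter_upwards [hF.mem, hG.mem] with i h1 h2
    refine le_trans (le_of_eq ?_) (normSq_add_le (h1.sub hF.lim_mem) (h2.sub hG.lim_mem))
    congr 1; ext x; ring

lemma const_mul (c : ℝ) (hF : TendH r l F f) : TendH r l (fun i x => c * F i x) (fun x => c * f x) where
  mem := by filter_upwards [hF.mem] with i h1 using h1.const_mul c
  lim_mem := hF.lim_mem.const_mul c
  tendsto := by
    have h0 : Tendsto (fun i => c ^ 2 * normSq r (fun x => F i x - f x)) l (𝓝 0) := by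
      simpa using hF.tendsto.const_mul (c ^ 2)
    refine h0.congr fun i => ?_
    rw [← normSq_const_mul]; congr 1; ext x; ring

lemma sub (hF : TendH r l F f) (hG : TendH r l G g) :
    TendH r l (fun i x => F i x - G i x) (fun x => f x - g x) := by
  simpa [sub_eq_add_neg] using hF.add (hG.const_mul (-1))

lemma of_normSq (hF : ∀ᶠ i in l, MemH r (F i)) (hf : MemH r f)
    {b : ι → ℝ} (hb : Tendsto b l (𝓝 0)) (h : ∀ᶠ i in l, normSq r (fun x => F i x - f x) ≤ b i) :
    TendH r l F f :=
  ⟨hF, hf, squeeze_zero' (Eventually.of_forall fun _ => normSq_nonneg _ _) h hb⟩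

/-- A convergent scalar times a fixed function. -/
lemma smul_const {c : ι → ℝ} {c₀ : ℝ} (hc : Tendsto c l (𝓝 c₀)) (hf : MemH r f) :
    TendH r l (fun i x => c i * f x) (fun x => c₀ * f x) := by
  have h0 : Tendsto (fun i => (c i - c₀) ^ 2 * normSq r f) l (𝓝 0) := by
    have := ((hc.sub_const c₀).pow 2).mul_const (normSq r f)
    simpa using this
  refine of_normSq (Eventually.of_forall fun _ => hf.const_mul _) (hf.const_mul _) h0
    (Eventually.of_forall fun i => ?_)
  rw [← normSq_const_mul]
  refine le_of_eq ?_
  congr 1; ext x; ring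

end TendH

lemma fourierC_one (n : ℤ) : fourierC (fun _ => 1) n = if n = 0 then 1 else 0 := by
  have h := @fourierCoeff_fourier 1 ⟨one_pos⟩ 0
  have h2 : fourierC (fun _ => 1) n = fourierCoeff (T := 1) (fourier 0) n := by
    rw [fourierCoeff_eq_intervalIntegral _ n 0, fourierC_eq_integral]
    simp only [div_one, one_smul, zero_add, fourier_zero, smul_eq_mul, mul_one, Complex.ofReal_one]
    refine intervalIntegral.integral_congr fun x _ => ?_
    rw [fourier_coe_apply]
    unfold char
    congr 1
    push_cast
    ring
  rw [h2, h]
  simp [Pi.single_apply]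

lemma memH_const (r c : ℝ) : MemH r (fun _ => c) where
  periodic := fun x => rfl
  memLp := memLp_of_continuous continuous_const
  summable := by
    refine summable_of_ne_finset_zero (s := {0}) fun n hn => ?_
    have := fourierC_const_mul c (fun _ => 1) n
    simp only [mul_one] at this
    rw [this, fourierC_one, if_neg (by simpa using hn)]
    simp
  continuous := fun _ => continuous_const

lemma TendH.scalar {ι : Type*} {l : Filter ι} (r : ℝ) {c : ι → ℝ} {c₀ : ℝ} (hc : Tendsto c l (𝓝 c₀)) :
    TendH r l (fun i _ => c i) (fun _ => c₀) := by
  simpa using TendH.smul_const hc (memH_const r 1)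

/-! ### Absolutely continuous functions as primitives -/

/-- `f` is a primitive of the locally integrable function `g`. -/
structure IsPrim (f g : ℝ → ℝ) : Prop where
  int : ∀ a b, IntervalIntegrable g volume a b
  eq : ∀ x, f x = f 0 + ∫ y in (0 : ℝ)..x, g y

namespace IsPrim
variable {f g f' g' : ℝ → ℝ}

lemma sub_eq (h : IsPrim f g) (a b : ℝ) : f b - f a = ∫ y in a..b, g y := by
  rw [h.eq b, h.eq a, add_sub_add_left_eq_sub]
  exact intervalIntegral.integral_interval_sub_left (h.int 0 b) (h.int 0 a)

lemma continuous (h : IsPrim f g) : Continuous f := by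
  have : f = fun x => f 0 + ∫ y in (0 : ℝ)..x, g y := funext h.eq
  rw [this]
  exact continuous_const.add (intervalIntegral.continuous_primitive h.int 0)

lemma ac (h : IsPrim f g) (a b : ℝ) : AbsolutelyContinuousOnInterval f a b := by
  have h1 := (h.int a b).absolutelyContinuousOnInterval_intervalIntegral (c := a) (by simp)
  have h2 : AbsolutelyContinuousOnInterval (fun _ : ℝ => f a) a b :=
    (LipschitzWith.const (f a)).lipschitzOnWith.absolutelyContinuousOnInterval
  have h3 := h2.add h1
  have e : ((fun _ : ℝ => f a) + fun x => ∫ y in a..x, g y) = f := by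
    ext x
    have := h.sub_eq a x
    simp only [Pi.add_apply]; linarith
  rwa [e] at h3

lemma ae_hasDerivAt (h : IsPrim f g) : ∀ᵐ x, HasDerivAt f (g x) x := by
  have hl : LocallyIntegrable g volume := by
    intro x
    have := (h.int (x - 1) (x + 1))
    rw [intervalIntegrable_iff_integrableOn_Ioo_of_le (by linarith)] at this
    exact ⟨Ioo (x - 1) (x + 1), Ioo_mem_nhds (by linarith) (by linarith), this⟩
  filter_upwards [LocallyIntegrable.ae_hasDerivAt_integral hl] with x hx
  have := (hx 0).const_add (f 0)
  exact this.congr_of_eventuallyEq (Eventually.of_forall h.eq)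

/-- The fundamental theorem of calculus for absolutely continuous functions. Product and quotient
rules for derivatives that exist only almost everywhere follow from it. -/
lemma of_ac (h : ∀ a b, AbsolutelyContinuousOnInterval f a b) (hd : ∀ᵐ x, HasDerivAt f (g x) x) :
    IsPrim f g := by
  have he : deriv f =ᵐ[volume] g := by filter_upwards [hd] with x hx using hx.deriv
  constructor
  · intro a b
    exact (h a b).intervalIntegrable_deriv.congr_ae (ae_restrict_of_ae he)
  · intro x
    have := (h 0 x).integral_deriv_eq_sub
    rw [intervalIntegral.integral_congr_ae (g := g)] at this
    · linarith
    · filter_upwards [he] with y hy _ using hy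

lemma congr_ae (h : IsPrim f g) (hg : g =ᵐ[volume] g') : IsPrim f g' := by
  refine of_ac h.ac ?_
  filter_upwards [h.ae_hasDerivAt, hg] with x h1 h2
  rwa [← h2]

lemma ae_unique (h : IsPrim f g) (h' : IsPrim f g') : g =ᵐ[volume] g' := by
  filter_upwards [h.ae_hasDerivAt, h'.ae_hasDerivAt] with x h1 h2 using h1.unique h2

lemma ae_deriv (h : IsPrim f g) : deriv f =ᵐ[volume] g := by
  filter_upwards [h.ae_hasDerivAt] with x hx using hx.deriv

lemma deriv (h : IsPrim f g) : IsPrim f (deriv f) := h.congr_ae h.ae_deriv.symm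

lemma hasDerivAt (h : IsPrim f g) (hg : Continuous g) (x : ℝ) : HasDerivAt f (g x) x := by
  have := (hg.integral_hasStrictDerivAt 0 x).hasDerivAt.const_add (f 0)
  exact this.congr_of_eventuallyEq (Eventually.of_forall h.eq)

lemma deriv_eq (h : IsPrim f g) (hg : Continuous g) : _root_.deriv f = g :=
  funext fun x => (h.hasDerivAt hg x).deriv

lemma of_hasDerivAt (h : ∀ x, HasDerivAt f (g x) x) (hg : Continuous g) : IsPrim f g where
  int := fun a b => hg.intervalIntegrable a b
  eq := fun x => by
    rw [intervalIntegral.integral_eq_sub_of_hasDerivAt (fun y _ => h y) (hg.intervalIntegrable _ _)]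
    ring

lemma add (h : IsPrim f f') (h' : IsPrim g g') : IsPrim (fun x => f x + g x) (fun x => f' x + g' x) where
  int := fun a b => (h.int a b).add (h'.int a b)
  eq := fun x => by
    rw [intervalIntegral.integral_add (h.int _ _) (h'.int _ _), h.eq x, h'.eq x]; ring

lemma const_mul (c : ℝ) (h : IsPrim f f') : IsPrim (fun x => c * f x) (fun x => c * f' x) where
  int := fun a b => (h.int a b).const_mul c
  eq := fun x => by rw [intervalIntegral.integral_const_mul, h.eq x]; ring

lemma sub (h : IsPrim f f') (h' : IsPrim g g') : IsPrim (fun x => f x - g x) (fun x => f' x - g' x) := by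
  simpa [sub_eq_add_neg] using h.add (h'.const_mul (-1))

lemma mul (h : IsPrim f f') (h' : IsPrim g g') :
    IsPrim (fun x => f x * g x) (fun x => f' x * g x + f x * g' x) := by
  refine of_ac (fun a b => (h.ac a b).fun_mul (h'.ac a b)) ?_
  filter_upwards [h.ae_hasDerivAt, h'.ae_hasDerivAt] with x h1 h2 using h1.mul h2

lemma inv (h : IsPrim f f') (h0 : ∀ x, 0 < f x) :
    IsPrim (fun x => (f x)⁻¹) (fun x => -f' x / f x ^ 2) := by
  refine of_ac (fun a b => ?_) ?_
  -- On the compact interval `f` is bounded below by its minimum `f z > 0`, so inversion is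
  -- Lipschitz on the range with constant `(f z)⁻²`, and absolute continuity is inherited.
  · obtain ⟨z, hz, hmin⟩ := isCompact_uIcc.exists_isMinOn (nonempty_uIcc (a := a) (b := b))
      h.continuous.continuousOn
    have hac := h.ac a b
    have hm := h0 z
    unfold AbsolutelyContinuousOnInterval at hac ⊢
    refine squeeze_zero' (Eventually.of_forall fun E => Finset.sum_nonneg fun i _ => dist_nonneg) ?_
      (by simpa using hac.const_mul ((f z)⁻¹ ^ 2))
    filter_upwards [mem_inf_of_right (mem_principal_self _)] with E hE
    rw [Finset.mul_sum]
    refine Finset.sum_le_sum fun i hi => ?_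
    have hE1 := hE.1 i hi
    have key : ∀ p ∈ uIcc a b, f z ≤ f p := fun p hp => hmin hp
    have hx := key _ hE1.1
    have hy := key _ hE1.2
    set X := f (E.2 i).1
    set Y := f (E.2 i).2
    have hX : 0 < X := hm.trans_le hx
    have hY : 0 < Y := hm.trans_le hy
    have e : X⁻¹ - Y⁻¹ = (X⁻¹ * Y⁻¹) * (Y - X) := by field_simp
    rw [Real.dist_eq, Real.dist_eq, e, abs_mul, abs_of_pos (by positivity), abs_sub_comm Y X]
    refine mul_le_mul_of_nonneg_right ?_ (abs_nonneg _)
    rw [pow_two]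
    gcongr
  · filter_upwards [h.ae_hasDerivAt] with x hx using hx.inv (h0 x).ne'

lemma integral_deriv_eq_zero (h : IsPrim f g) (hp : Function.Periodic f 1) :
    ∫ x in (0 : ℝ)..1, g x = 0 := by
  rw [← h.sub_eq, ← zero_add (1 : ℝ), hp 0, sub_self]

lemma integral_mul_eq (h : IsPrim f f') (h' : IsPrim g g') (hf : Function.Periodic f 1)
    (hg : Function.Periodic g 1) :
    ∫ x in (0 : ℝ)..1, f' x * g x = -∫ x in (0 : ℝ)..1, f x * g' x := by
  have := (h.mul h').integral_deriv_eq_zero (hf.mul hg)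
  rw [intervalIntegral.integral_add] at this
  · linarith
  · exact (h.int 0 1).mul_continuousOn h'.continuous.continuousOn
  · exact (h'.int 0 1).continuousOn_mul h.continuous.continuousOn

end IsPrim

/-! ### Fourier coefficients: derivatives, reconstruction and uniqueness -/

lemma periodic_deriv {f : ℝ → ℝ} (hp : Function.Periodic f 1) : Function.Periodic (deriv f) 1 := by
  intro x
  rw [← deriv_comp_add_const]
  congr 1
  exact funext hp

lemma fourierC_eq_cos_sin {f : ℝ → ℝ} (hf : IntervalIntegrable f volume 0 1) (n : ℤ) :
    fourierC f n = ((∫ x in (0 : ℝ)..1, f x * Real.cos (2 * Real.pi * n * x) : ℝ) : ℂ)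
      - ((∫ x in (0 : ℝ)..1, f x * Real.sin (2 * Real.pi * n * x) : ℝ) : ℂ) * Complex.I := by
  rw [fourierC_eq_integral, ← intervalIntegral.integral_ofReal, ← intervalIntegral.integral_ofReal,
    ← intervalIntegral.integral_mul_const, ← intervalIntegral.integral_sub]
  · refine intervalIntegral.integral_congr fun x _ => ?_
    simp only [char_re_im]; push_cast; ring
  · have := hf.mul_continuousOn (g := fun x => Real.cos (2 * Real.pi * n * x)) (by fun_prop)
    exact ⟨this.1.ofReal, this.2.ofReal⟩
  · have := hf.mul_continuousOn (g := fun x => Real.sin (2 * Real.pi * n * x)) (by fun_prop)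
    exact IntervalIntegrable.mul_const ⟨this.1.ofReal, this.2.ofReal⟩ _

lemma periodic_cos (n : ℤ) : Function.Periodic (fun x => Real.cos (2 * Real.pi * n * x)) 1 := by
  intro x
  have : 2 * Real.pi * n * (x + 1) = 2 * Real.pi * n * x + n * (2 * Real.pi) := by ring
  simp only [this, Real.cos_add_int_mul_two_pi]

lemma periodic_sin (n : ℤ) : Function.Periodic (fun x => Real.sin (2 * Real.pi * n * x)) 1 := by
  intro x
  have : 2 * Real.pi * n * (x + 1) = 2 * Real.pi * n * x + n * (2 * Real.pi) := by ring
  simp only [this, Real.sin_add_int_mul_two_pi]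

lemma isPrim_cos (a : ℝ) : IsPrim (fun x => Real.cos (a * x)) (fun x => -(a * Real.sin (a * x))) := by
  refine IsPrim.of_hasDerivAt (fun x => ?_) (by fun_prop)
  have := (Real.hasDerivAt_cos (a * x)).comp x ((hasDerivAt_id x).const_mul a)
  convert! this using 1; ring

lemma isPrim_sin (a : ℝ) : IsPrim (fun x => Real.sin (a * x)) (fun x => a * Real.cos (a * x)) := by
  refine IsPrim.of_hasDerivAt (fun x => ?_) (by fun_prop)
  have := (Real.hasDerivAt_sin (a * x)).comp x ((hasDerivAt_id x).const_mul a)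
  convert! this using 1; ring

/-- Integration by parts, carried out on the real cosine and sine parts because `IsPrim` concerns
real functions. -/
lemma IsPrim.fourierC_eq {f g : ℝ → ℝ} (h : IsPrim f g) (hp : Function.Periodic f 1) (n : ℤ) :
    fourierC g n = (2 * Real.pi * n : ℝ) * Complex.I * fourierC f n := by
  rw [fourierC_eq_cos_sin (h.int 0 1), fourierC_eq_cos_sin (h.continuous.intervalIntegrable 0 1)]
  rw [h.integral_mul_eq (isPrim_cos _) hp (periodic_cos n),
    h.integral_mul_eq (isPrim_sin _) hp (periodic_sin n)]
  have e1 : ∫ x in (0 : ℝ)..1, f x * -(2 * Real.pi * n * Real.sin (2 * Real.pi * n * x))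
      = -(2 * Real.pi * n) * ∫ x in (0 : ℝ)..1, f x * Real.sin (2 * Real.pi * n * x) := by
    rw [← intervalIntegral.integral_const_mul]; congr 1; ext x; ring
  have e2 : ∫ x in (0 : ℝ)..1, f x * (2 * Real.pi * n * Real.cos (2 * Real.pi * n * x))
      = (2 * Real.pi * n) * ∫ x in (0 : ℝ)..1, f x * Real.cos (2 * Real.pi * n * x) := by
    rw [← intervalIntegral.integral_const_mul]; congr 1; ext x; ring
  rw [e1, e2]
  push_cast
  linear_combination (2 * Real.pi * n * (∫ x in (0 : ℝ)..1, f x * Real.sin (2 * Real.pi * n * x) : ℝ) : ℂ) * Complex.I_sq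

lemma char_eq_fourier (n : ℤ) (x : ℝ) : char n x = (fourier (-n) (x : AddCircle (1 : ℝ)) : ℂ) := by
  rw [fourier_coe_apply]
  unfold char
  congr 1
  push_cast
  ring

lemma conj_char (n : ℤ) (x : ℝ) : (starRingEnd ℂ) (char n x) = char (-n) x := by
  have : (2 * Real.pi * ((-n : ℤ) : ℝ) * x) = -(2 * Real.pi * n * x) := by push_cast; ring
  rw [char_re_im, char_re_im, this, Real.cos_neg, Real.sin_neg, map_sub, map_mul, Complex.conj_I,
    Complex.conj_ofReal, Complex.conj_ofReal]
  push_cast; ring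

/-- The Hermitian symmetry of `c` gives the conjugate of `K` the same coefficients as `K`, hence
also the average of the two, which is the real part. -/
lemma fourierC_re_of_addCircle (K : AddCircle (1 : ℝ) → ℂ) (c : ℤ → ℂ)
    (hK : IntervalIntegrable (fun x : ℝ => K x) volume 0 1)
    (hc : ∀ n, haveI : Fact ((0 : ℝ) < 1) := ⟨one_pos⟩; fourierCoeff K n = c n)
    (hs : ∀ n, c (-n) = (starRingEnd ℂ) (c n)) (n : ℤ) :
    fourierC (fun x => (K x).re) n = c n := by
  have : Fact ((0 : ℝ) < 1) := ⟨one_pos⟩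
  have h1 : ∀ m, ∫ x in (0 : ℝ)..1, char m x * K x = c m := by
    intro m
    rw [← hc m, fourierCoeff_eq_intervalIntegral _ m 0]
    simp only [div_one, one_smul, zero_add, smul_eq_mul, ← char_eq_fourier]
  have h2 : ∫ x in (0 : ℝ)..1, char n x * (starRingEnd ℂ) (K x) = c n := by
    have h3 := h1 (-n)
    rw [hs] at h3
    have h4 : ∫ x in (0 : ℝ)..1, char n x * (starRingEnd ℂ) (K x)
        = (starRingEnd ℂ) (∫ x in (0 : ℝ)..1, char (-n) x * K x) := by
      rw [← intervalIntegral.intervalIntegral_conj]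
      simp only [map_mul, conj_char, neg_neg]
    rw [h4, h3, Complex.conj_conj]
  have i1 : IntervalIntegrable (fun x : ℝ => char n x * K x) volume 0 1 :=
    hK.continuousOn_mul (continuous_char n).continuousOn
  have hK' : IntervalIntegrable (fun x : ℝ => (starRingEnd ℂ) (K x)) volume 0 1 := by
    rw [intervalIntegrable_iff] at hK ⊢
    exact (LinearIsometryEquiv.integrable_comp_iff Complex.conjLIE).2 hK
  have i2 : IntervalIntegrable (fun x : ℝ => char n x * (starRingEnd ℂ) (K x)) volume 0 1 :=
    hK'.continuousOn_mul (continuous_char n).continuousOn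
  rw [fourierC_eq_integral]
  have : ∀ x : ℝ, char n x * ((K x).re : ℂ)
      = (1 / 2 : ℂ) * (char n x * K x + char n x * (starRingEnd ℂ) (K x)) := by
    intro x
    rw [← mul_add, Complex.add_conj]; push_cast; ring
  simp only [this]
  rw [intervalIntegral.integral_const_mul, intervalIntegral.integral_add i1 i2, h1, h2]
  ring

/-- Riesz–Fischer. If the coefficients are absolutely summable, the uniformly convergent Fourier
series represents the same `L²` class, and it is chosen because it is continuous. -/
lemma exists_of_coeff (c : ℤ → ℂ) (hc : Summable fun n => ‖c n‖ ^ 2)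
    (hs : ∀ n, c (-n) = (starRingEnd ℂ) (c n)) :
    ∃ g : ℝ → ℝ, Function.Periodic g 1 ∧ MemLp g 2 (volume.restrict (Ioc 0 1)) ∧
      (∀ n, fourierC g n = c n) ∧ ((Summable fun n => ‖c n‖) → Continuous g) := by
  have : Fact ((0 : ℝ) < 1) := ⟨one_pos⟩
  have hmem : Memℓp c 2 := by
    refine memℓp_gen ?_
    simpa using hc
  set G : Lp ℂ 2 (@AddCircle.haarAddCircle 1 _) := fourierBasis.repr.symm ⟨c, hmem⟩ with hG
  have hGc : ∀ n, fourierCoeff G n = c n := by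
    intro n
    rw [← fourierBasis_repr, hG, LinearIsometryEquiv.apply_symm_apply]
  have key : ∀ K : AddCircle (1 : ℝ) → ℂ, MemLp K 2 AddCircle.haarAddCircle → 
      (∀ n, fourierCoeff K n = c n) →
      Function.Periodic (fun x : ℝ => (K x).re) 1 ∧
      MemLp (fun x : ℝ => (K x).re) 2 (volume.restrict (Ioc 0 1)) ∧
      (∀ n, fourierC (fun x : ℝ => (K x).re) n = c n) := by
    intro K hK hKc
    have hK2 : MemLp (fun x : ℝ => K x) 2 (volume.restrict (Ioc 0 1)) := by
      have := memLp_haarAddCircle_iff.1 hK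
      have h3 := this.comp_measurePreserving (AddCircle.measurePreserving_mk 1 0)
      simpa [Function.comp_def] using h3
    refine ⟨fun x => by simp, hK2.re, fourierC_re_of_addCircle K c ?_ hKc hs⟩
    rw [intervalIntegrable_iff_integrableOn_Ioc_of_le zero_le_one]
    exact hK2.integrable (by norm_num)
  by_cases hsum : Summable fun n => ‖c n‖
  · have hS : Summable fun n => c n • (fourier n : C(AddCircle (1 : ℝ), ℂ)) := by
      refine Summable.of_norm ?_
      simpa [norm_smul, fourier_norm] using hsum
    obtain ⟨K, hK⟩ := hS
    have hL : HasSum (fun n => c n • (fourierLp 2 n : Lp ℂ 2 (@AddCircle.haarAddCircle 1 _)))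
        (ContinuousMap.toLp (E := ℂ) 2 AddCircle.haarAddCircle ℂ K) := by
      have := (ContinuousMap.toLp (E := ℂ) 2 (@AddCircle.haarAddCircle 1 _) ℂ).hasSum hK
      simpa [fourierLp, Function.comp_def] using this
    have hL' := (fourierBasis (T := (1 : ℝ))).hasSum_repr_symm ⟨c, hmem⟩
    rw [coe_fourierBasis] at hL'
    have hE := hL.unique hL'
    have hKc : ∀ n, fourierCoeff K n = c n := by
      intro n
      rw [← fourierCoeff_toLp, hE]
      exact hGc n
    have hKm : MemLp K 2 (@AddCircle.haarAddCircle 1 _) := K.continuous.memLp_of_hasCompactSupport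
      (HasCompactSupport.of_compactSpace _)
    obtain ⟨h1, h2, h3⟩ := key K hKm hKc
    exact ⟨_, h1, h2, h3, fun _ => Complex.continuous_re.comp (K.continuous.comp (AddCircle.continuous_mk' 1))⟩
  · obtain ⟨h1, h2, h3⟩ := key G (Lp.memLp G) hGc
    exact ⟨_, h1, h2, h3, fun h => absurd h hsum⟩

lemma eq_zero_of_integral_sq {f : ℝ → ℝ} (hf : Continuous f) (hp : Function.Periodic f 1)
    (h : ∫ x in (0 : ℝ)..1, f x ^ 2 = 0) (x : ℝ) : f x = 0 := by
  obtain ⟨y, hy, hxy⟩ := hp.exists_mem_Ico₀ one_pos x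
  rw [hxy]
  by_contra hne
  have := intervalIntegral.integral_pos (a := 0) (b := 1) zero_lt_one
    ((hf.pow 2).continuousOn) (fun x _ => sq_nonneg (f x)) ⟨y, ⟨hy.1, hy.2.le⟩, (sq_pos_of_ne_zero hne : 0 < f y ^ 2)⟩
  simp only [Pi.pow_apply] at this
  linarith

lemma eq_of_fourierC_eq {f g : ℝ → ℝ} (hf : Continuous f) (hg : Continuous g)
    (hfp : Function.Periodic f 1) (hgp : Function.Periodic g 1)
    (h : ∀ n, fourierC f n = fourierC g n) : f = g := by
  have h2 := hasSum_sq_fourierC (memLp_of_continuous (hf.sub hg))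
  have h3 : ∀ n, fourierC (fun x => f x - g x) n = 0 := fun n => by
    rw [fourierC_sub (hf.intervalIntegrable _ _) (hg.intervalIntegrable _ _), h, sub_self]
  have h4 : (fun n => ‖fourierC (f - g) n‖ ^ 2) = fun _ => 0 := by
    ext n
    have : fourierC (f - g) n = 0 := h3 n
    simp [this]
  rw [h4] at h2
  have h5 := h2.unique hasSum_zero
  ext x
  have := eq_zero_of_integral_sq (hf.sub hg) (hfp.sub hgp) h5 x
  simp only [Pi.sub_apply] at this
  linarith

lemma ae_eq_of_fourierC_eq {f g : ℝ → ℝ} (hf : MemLp f 2 (volume.restrict (Ioc 0 1)))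
    (hg : MemLp g 2 (volume.restrict (Ioc 0 1))) (h : ∀ n, fourierC f n = fourierC g n) :
    f =ᵐ[volume.restrict (Ioc 0 1)] g := by
  have h2 := hasSum_sq_fourierC (hf.sub hg)
  have h3 : ∀ n, fourierC (fun x => f x - g x) n = 0 := fun n => by
    rw [fourierC_sub (MemLp.intervalIntegrable_unit hf) (MemLp.intervalIntegrable_unit hg), h, sub_self]
  have h4 : (fun n => ‖fourierC (f - g) n‖ ^ 2) = fun _ => 0 := by
    ext n
    have : fourierC (f - g) n = 0 := h3 n
    simp [this]
  rw [h4] at h2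
  have h5 := h2.unique hasSum_zero
  rw [intervalIntegral.integral_of_le zero_le_one] at h5
  rw [setIntegral_eq_zero_iff_of_nonneg_ae (ae_of_all _ fun x => by positivity)] at h5
  · filter_upwards [h5] with x hx
    have : (f x - g x) ^ 2 = 0 := hx
    have := pow_eq_zero_iff (two_ne_zero) |>.1 this
    linarith
  · exact (hf.sub hg).integrable_sq

lemma fourierC_neg {f : ℝ → ℝ} (n : ℤ) : fourierC f (-n) = (starRingEnd ℂ) (fourierC f n) := by
  rw [fourierC_eq_integral, fourierC_eq_integral, ← intervalIntegral.intervalIntegral_conj]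
  simp [conj_char]

lemma summable_weight {p : ℝ} (hp : p < -(1 / 2)) : Summable fun n : ℤ => (1 + (n : ℝ) ^ 2) ^ p := by
  have h := (Real.summable_one_div_int_add_rpow 0 (-(2 * p))).2 (by linarith)
  have h2 : Summable fun n : ℤ => (2 : ℝ) ^ 0 * (1 / |(n : ℝ) + 0| ^ (-(2 * p))) := h.mul_left _
  refine Summable.of_norm_bounded_eventually h ?_
  have : {(0 : ℤ)}ᶜ ∈ (cofinite : Filter ℤ) := (finite_singleton 0).compl_mem_cofinite
  filter_upwards [this] with n hn
  have hn0 : (0 : ℝ) < |(n : ℝ)| := by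
    simp only [mem_compl_iff, mem_singleton_iff] at hn
    positivity
  rw [Real.norm_of_nonneg (by positivity), add_zero, Real.rpow_neg hn0.le, one_div, inv_inv,
    Real.rpow_mul hn0.le]
  refine Real.rpow_le_rpow_of_nonpos (by positivity) ?_ (by linarith)
  simp [sq_abs]

/-- Weighted inequality `2‖c‖ ≤ w⁻¹ + w‖c‖²`, with `w⁻¹` summable because `p > 1/2`. This is the
Sobolev embedding on the side of coefficients. -/
lemma summable_norm_of_weight {p : ℝ} (hp : 1 / 2 < p) {c : ℤ → ℂ}
    (h : Summable fun n : ℤ => (1 + (n : ℝ) ^ 2) ^ p * ‖c n‖ ^ 2) : Summable fun n => ‖c n‖ := by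
  refine Summable.of_nonneg_of_le (fun n => norm_nonneg _) (fun n => ?_)
    ((summable_weight (p := -p) (by linarith)).add h)
  have hw := weight_pos p n
  rw [Real.rpow_neg (by positivity)]
  set w := (1 + (n : ℝ) ^ 2) ^ p
  have : ‖c n‖ ≤ 2 * ‖c n‖ := by linarith [norm_nonneg (c n)]
  have e : w⁻¹ + w * ‖c n‖ ^ 2 - 2 * ‖c n‖ = w⁻¹ * (1 - w * ‖c n‖) ^ 2 := by field_simp; ring
  have : 0 ≤ w⁻¹ * (1 - w * ‖c n‖) ^ 2 := by positivity
  linarith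

/-- Almost every `x` is good for all of its countably many integer translates, and one of them lies
in `(0,1]`. -/
lemma ae_eq_of_periodic {f g : ℝ → ℝ} (hf : Function.Periodic f 1) (hg : Function.Periodic g 1)
    (h : f =ᵐ[volume.restrict (Ioc 0 1)] g) : f =ᵐ[volume] g := by
  rw [Filter.EventuallyEq, ae_restrict_iff' measurableSet_Ioc] at h
  have h2 : ∀ k : ℤ, ∀ᵐ x : ℝ, x + k ∈ Ioc (0 : ℝ) 1 → f (x + k) = g (x + k) := fun k =>
    (measurePreserving_add_right volume (k : ℝ)).quasiMeasurePreserving.ae h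
  filter_upwards [ae_all_iff.2 h2] with x hx
  obtain ⟨k, hk, _⟩ := existsUnique_add_zsmul_mem_Ioc (zero_lt_one : (0 : ℝ) < 1) x 0
  have h3 := hx k (by simpa using hk)
  have e1 := hf.int_mul k x
  have e2 := hg.int_mul k x
  simp only [mul_one] at e1 e2
  rwa [e1, e2] at h3

lemma MemH.congr_ae {r : ℝ} {f g : ℝ → ℝ} (h : MemH r f) (hfg : f =ᵐ[volume] g)
    (hp : Function.Periodic g 1) (hc : 1 / 2 < r → Continuous g) : MemH r g where
  periodic := hp
  memLp := (memLp_congr_ae (ae_restrict_of_ae hfg)).1 h.memLp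
  summable := by simpa only [fourierC_congr_ae hfg] using h.summable
  continuous := hc

/-! ### Differentiation and integration between `H^{q+1}` and `H^q`, and the sup norm -/

lemma weight_succ (q : ℝ) (n : ℤ) :
    (1 + (n : ℝ) ^ 2) ^ (q + 1) = (1 + (n : ℝ) ^ 2) ^ q * (1 + (n : ℝ) ^ 2) :=
  Real.rpow_add_one (by positivity) q

lemma norm_sq_fourierC_prim {f g : ℝ → ℝ} (h : IsPrim f g) (hp : Function.Periodic f 1) (n : ℤ) :
    ‖fourierC g n‖ ^ 2 = 4 * Real.pi ^ 2 * (n : ℝ) ^ 2 * ‖fourierC f n‖ ^ 2 := by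
  rw [h.fourierC_eq hp, norm_mul, norm_mul, Complex.norm_I, Complex.norm_real, Real.norm_eq_abs,
    mul_pow, mul_pow, sq_abs]
  ring

/-- A function in `H^{q+1}` is a primitive of its derivative, which is in `H^q`. -/
theorem MemH.isPrim_deriv {q : ℝ} (hq : 0 ≤ q) {f : ℝ → ℝ} (hf : MemH (q + 1) f) :
    IsPrim f (deriv f) ∧ MemH q (deriv f) := by
  have hcf : Continuous f := hf.continuous (by linarith)
  -- The derivative is built backwards: `g` is the function with coefficients `2πin f̂(n)`, and `F`
  -- is its primitive. Then `f` and `F` have the same coefficients for `n ≠ 0`, so they differ by a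
  -- constant.
  set c : ℤ → ℂ := fun n => (2 * Real.pi * n : ℝ) * Complex.I * fourierC f n with hcdef
  have hcn : ∀ n, ‖c n‖ ^ 2 = 4 * Real.pi ^ 2 * (n : ℝ) ^ 2 * ‖fourierC f n‖ ^ 2 := by
    intro n
    rw [hcdef]; simp only
    rw [norm_mul, norm_mul, Complex.norm_I, Complex.norm_real, Real.norm_eq_abs,
      mul_pow, mul_pow, sq_abs]
    ring
  have hcw : Summable fun n : ℤ => (1 + (n : ℝ) ^ 2) ^ q * ‖c n‖ ^ 2 := by
    refine Summable.of_nonneg_of_le (fun n => by positivity) (fun n => ?_)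
      (hf.summable.mul_left (4 * Real.pi ^ 2))
    rw [hcn, weight_succ]
    have := weight_pos q n
    have h2 : 0 ≤ Real.pi ^ 2 * ((1 + (n : ℝ) ^ 2) ^ q * ‖fourierC f n‖ ^ 2) := by positivity
    nlinarith
  have hc2 : Summable fun n => ‖c n‖ ^ 2 := by
    refine Summable.of_nonneg_of_le (fun n => by positivity) (fun n => ?_) hcw
    have : 1 ≤ (1 + (n : ℝ) ^ 2) ^ q := Real.one_le_rpow (by nlinarith [sq_nonneg (n : ℝ)]) hq
    nlinarith [sq_nonneg ‖c n‖]
  obtain ⟨g, hgp, hgm, hgc, hgcont⟩ := exists_of_coeff c hc2 (fun n => by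
    simp only [hcdef]
    rw [fourierC_neg, map_mul, map_mul, Complex.conj_I, Complex.conj_ofReal]
    push_cast; ring)
  have hg : MemH q g := ⟨hgp, hgm, by simpa only [hgc] using hcw, fun h =>
    hgcont (summable_norm_of_weight h hcw)⟩
  set F : ℝ → ℝ := fun x => ∫ y in (0 : ℝ)..x, g y with hF
  have hFg : IsPrim F g := ⟨hg.intervalIntegrable', fun x => by simp [hF]⟩
  -- The zeroth prescribed coefficient is `0`, which makes the primitive `F` periodic.
  have hg0 : ∫ y in (0 : ℝ)..1, g y = 0 := by
    have h0 := hgc 0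
    rw [fourierC_eq_cos_sin hg.intervalIntegrable] at h0
    simpa [hcdef] using h0
  have hFp : Function.Periodic F 1 := by
    intro x
    have := hFg.sub_eq x (x + 1)
    rw [hgp.intervalIntegral_add_eq x 0, zero_add, hg0] at this
    linarith
  set m : ℝ := (fourierC f 0 - fourierC F 0).re with hm
  have hreal : ∀ φ : ℝ → ℝ, Continuous φ → ((fourierC φ 0).re : ℂ) = fourierC φ 0 := by
    intro φ hφ
    rw [fourierC_eq_cos_sin (hφ.intervalIntegrable _ _)]
    simp
  have hfF : f = fun x => F x + m := by
    refine eq_of_fourierC_eq hcf (hFg.continuous.add continuous_const) hf.periodic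
      (fun x => by simp only [hFp x]) fun n => ?_
    have e1 := fourierC_add (hFg.continuous.intervalIntegrable 0 1)
      ((continuous_const (y := m)).intervalIntegrable 0 1) n
    have e2 := fourierC_const_mul m (fun _ => 1) n
    simp only [mul_one] at e2
    rw [e1, e2, fourierC_one]
    by_cases hn : n = 0
    · subst hn
      rw [hm, Complex.sub_re, Complex.ofReal_sub, hreal f hcf, hreal F hFg.continuous]
      simp
    · have e3 := hFg.fourierC_eq hFp n
      rw [hgc] at e3
      simp only [hcdef] at e3
      have hne : ((2 * Real.pi * n : ℝ) : ℂ) * Complex.I ≠ 0 := by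
        refine mul_ne_zero ?_ Complex.I_ne_zero
        rw [Complex.ofReal_ne_zero]
        have : (n : ℝ) ≠ 0 := by exact_mod_cast hn
        have := Real.pi_pos.ne'
        positivity
      rw [if_neg hn, mul_zero, add_zero]
      exact mul_left_cancel₀ hne e3
  have hfg : IsPrim f g := by
    refine ⟨hFg.int, fun x => ?_⟩
    have := hFg.eq x
    rw [hfF]; simp only
    linarith
  refine ⟨hfg.deriv, hg.congr_ae hfg.ae_deriv.symm (periodic_deriv hf.periodic) fun h => ?_⟩
  rw [hfg.deriv_eq (hg.continuous h)]
  exact hg.continuous h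

/-- Jensen's inequality for `|g|` on a unit interval, obtained from `0 ≤ ∫ (|g| - a)²` with `a = ∫
|g|`, together with `(x + y)² ≤ 2x² + 2y²`. -/
lemma integral_sq_prim_le {f g : ℝ → ℝ} (h : IsPrim f g) (hg : MemLp g 2 (volume.restrict (Ioc 0 1)))
    {x : ℝ} (hx : x ∈ Icc (0 : ℝ) 1) : f x ^ 2 ≤ 2 * f 0 ^ 2 + 2 * ∫ y in (0 : ℝ)..1, g y ^ 2 := by
  have hi2 : IntegrableOn (fun y => g y ^ 2) (Ioc 0 1) volume := hg.integrable_sq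
  have hi1 : IntegrableOn g (Ioc 0 1) volume := hg.integrable (by norm_num)
  have hI : (∫ y in (0 : ℝ)..1, |g y|) ^ 2 ≤ ∫ y in (0 : ℝ)..1, g y ^ 2 := by
    set a := ∫ y in (0 : ℝ)..1, |g y| with ha
    have i1 : IntervalIntegrable (fun y => |g y|) volume 0 1 := by
      rw [intervalIntegrable_iff_integrableOn_Ioc_of_le zero_le_one]; exact hi1.abs
    have i2 : IntervalIntegrable (fun y => g y ^ 2) volume 0 1 := by
      rw [intervalIntegrable_iff_integrableOn_Ioc_of_le zero_le_one]; exact hi2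
    have h0 : 0 ≤ ∫ y in (0 : ℝ)..1, (g y ^ 2 - (2 * a) * |g y| + a ^ 2) :=
      intervalIntegral.integral_nonneg zero_le_one fun y _ => by
        nlinarith [sq_nonneg (|g y| - a), sq_abs (g y)]
    rw [intervalIntegral.integral_add (i2.sub (i1.const_mul _)) (by simp),
      intervalIntegral.integral_sub i2 (i1.const_mul _), intervalIntegral.integral_const_mul,
      intervalIntegral.integral_const, ← ha] at h0
    simp only [sub_zero, one_smul] at h0
    nlinarith
  have h1 : |∫ y in (0 : ℝ)..x, g y| ≤ ∫ y in (0 : ℝ)..1, |g y| := by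
    refine (intervalIntegral.abs_integral_le_integral_abs hx.1).trans ?_
    refine intervalIntegral.integral_mono_interval le_rfl hx.1 hx.2
      (ae_of_all _ fun y => abs_nonneg _) ?_
    rw [intervalIntegrable_iff_integrableOn_Ioc_of_le zero_le_one]; exact hi1.abs
  have h2 := h.eq x
  set J := ∫ y in (0 : ℝ)..x, g y
  have h3 : J ^ 2 ≤ (∫ y in (0 : ℝ)..1, |g y|) ^ 2 := by
    rw [← sq_abs J]; exact pow_le_pow_left₀ (abs_nonneg _) h1 2
  rw [h2]
  nlinarith [sq_nonneg (f 0 - J)]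

/-- For `n ≠ 0` the weight satisfies `1 + n² ≤ 2n² ≤ 4π²n²`, so those modes of `f` are dominated by
those of `g`. The mean of `f` is controlled through the value at `0` and the `L²` norm of `g`. -/
theorem MemH.of_prim {q : ℝ} (hq : 0 ≤ q) {f g : ℝ → ℝ} (h : IsPrim f g) (hp : Function.Periodic f 1)
    (hg : MemH q g) :
    MemH (q + 1) f ∧ normSq (q + 1) f ≤ 2 * f 0 ^ 2 + 3 * normSq q g := by
  have hm := memLp_of_continuous h.continuous
  have hpi : 1 ≤ 2 * Real.pi ^ 2 := by nlinarith [Real.pi_gt_three]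
  have hle : ∀ n : ℤ, (1 + (n : ℝ) ^ 2) ^ (q + 1) * ‖fourierC f n‖ ^ 2
      ≤ (if n = 0 then ‖fourierC f 0‖ ^ 2 else 0) + (1 + (n : ℝ) ^ 2) ^ q * ‖fourierC g n‖ ^ 2 := by
    intro n
    by_cases hn : n = 0
    · subst hn
      simp only [Int.cast_zero, ne_eq, OfNat.ofNat_ne_zero, not_false_eq_true, zero_pow, add_zero,
        Real.one_rpow, one_mul, ↓reduceIte]
      linarith [sq_nonneg ‖fourierC g 0‖]
    · rw [if_neg hn, zero_add, norm_sq_fourierC_prim h hp, weight_succ, mul_assoc]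
      refine mul_le_mul_of_nonneg_left ?_ (weight_pos q n).le
      refine mul_le_mul_of_nonneg_right ?_ (by positivity)
      have : (1 : ℝ) ≤ (n : ℝ) ^ 2 := by
        have : (1 : ℤ) ≤ n ^ 2 := by have := sq_pos_of_ne_zero hn; omega
        exact_mod_cast this
      nlinarith
  have hs0 : HasSum (fun n : ℤ => if n = 0 then ‖fourierC f 0‖ ^ 2 else 0) (‖fourierC f 0‖ ^ 2) :=
    hasSum_ite_eq 0 _
  have hs := hs0.summable.add hg.summable
  have hsum := Summable.of_nonneg_of_le (fun n => by positivity) hle hs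
  refine ⟨⟨hp, hm, hsum, fun _ => h.continuous⟩, ?_⟩
  have h1 : normSq (q + 1) f ≤ ‖fourierC f 0‖ ^ 2 + normSq q g := by
    have := hsum.tsum_le_tsum hle hs
    rwa [hs0.summable.tsum_add hg.summable, hs0.tsum_eq] at this
  have h2 : ‖fourierC f 0‖ ^ 2 ≤ ∫ x in (0 : ℝ)..1, f x ^ 2 :=
    le_hasSum (hasSum_sq_fourierC hm) 0 fun _ _ => by positivity
  have h3 : ∫ x in (0 : ℝ)..1, f x ^ 2 ≤ ∫ x in (0 : ℝ)..1, (2 * f 0 ^ 2 + 2 * normSq 0 g) := by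
    refine intervalIntegral.integral_mono_on zero_le_one
      ((h.continuous.pow 2).intervalIntegrable _ _) (by simp) fun x hx => ?_
    rw [normSq_zero_eq hg.memLp]
    exact integral_sq_prim_le h hg.memLp hx
  simp only [intervalIntegral.integral_const, sub_zero, one_smul] at h3
  have h4 := normSq_mono hg hq
  linarith

/-- Some value `f z` has square at most the mean square. Integrating the derivative from `z` over
one period reaches every other point. The bound found is `2 + 8π²`, which is below `100`. -/
lemma MemH.abs_le {f : ℝ → ℝ} (hf : MemH 1 f) (x : ℝ) : f x ^ 2 ≤ 100 * normSq 1 f := by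
  have h01 : (0 : ℝ) + 1 = 1 := zero_add 1
  obtain ⟨h1, h2⟩ := MemH.isPrim_deriv (q := 0) le_rfl (h01.symm ▸ hf)
  have hcf := h1.continuous
  obtain ⟨y, hy, hxy⟩ := hf.periodic.exists_mem_Ico₀ one_pos x
  rw [hxy]
  have hD : normSq 0 (deriv f) ≤ 4 * Real.pi ^ 2 * normSq 1 f := by
    unfold normSq
    rw [← tsum_mul_left]
    refine h2.summable.tsum_le_tsum (fun n => ?_) (hf.summable.mul_left _)
    rw [norm_sq_fourierC_prim h1 hf.periodic, Real.rpow_zero, one_mul, Real.rpow_one]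
    have : 0 ≤ Real.pi ^ 2 * ‖fourierC f n‖ ^ 2 := by positivity
    nlinarith
  have hpi : Real.pi ^ 2 ≤ 10 := by nlinarith [Real.pi_lt_d2, Real.pi_pos]
  -- the mean square controls some value
  have hE : ∃ z ∈ Icc (0 : ℝ) 1, f z ^ 2 ≤ normSq 0 f := by
    by_contra! hcon
    have := intervalIntegral.integral_lt_integral_of_continuousOn_of_le_of_exists_lt (a := 0) (b := 1)
      zero_lt_one (f := fun _ => normSq 0 f) (g := fun z => f z ^ 2) continuousOn_const
      (hcf.pow 2).continuousOn (fun z hz => (hcon z ⟨hz.1.le, hz.2⟩).le)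
      ⟨0, by simp, hcon 0 (by simp)⟩
    rw [← normSq_zero_eq hf.memLp] at this
    simp at this
  obtain ⟨z, hz, hfz⟩ := hE
  have hmono := normSq_mono hf (zero_le_one)
  set N := normSq 1 f
  have hN : 0 ≤ N := normSq_nonneg _ _
  -- shifted primitive
  have hsh : IsPrim (fun s => f (z + s)) (fun s => deriv f (z + s)) := by
    refine ⟨fun a b => ?_, fun s => ?_⟩
    · have := (h1.int (z + a) (z + b)).comp_add_left z
      simpa using this
    · rw [intervalIntegral.integral_comp_add_left (fun s => deriv f s) z]
      have := h1.sub_eq (z + 0) (z + s)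
      linarith
  have hmp : MemLp (fun s => deriv f (z + s)) 2 (volume.restrict (Ioc 0 1)) := by
    have h3 : MemLp (deriv f) 2 (volume.restrict (Ioc z (z + 1))) := by
      rw [memLp_two_iff_integrable_sq]
      · have h4 : IntervalIntegrable (fun s => deriv f s ^ 2) volume 0 1 := by
          rw [intervalIntegrable_iff_integrableOn_Ioc_of_le zero_le_one]
          exact h2.memLp.integrable_sq
        have h5 : Function.Periodic (fun s => deriv f s ^ 2) 1 := fun s => by
          simp only [h2.periodic s]
        have h6 := h5.intervalIntegrable (t := 0) one_ne_zero (by simpa using h4) z (z + 1)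
        rwa [intervalIntegrable_iff_integrableOn_Ioc_of_le (by linarith)] at h6
      · exact (h1.int z (z + 1)).1.aestronglyMeasurable
    have h4 : MeasurePreserving (fun s => z + s) (volume.restrict (Ioc 0 1))
        (volume.restrict (Ioc z (z + 1))) := by
      have := (measurePreserving_add_left volume z).restrict_preimage (measurableSet_Ioc (a := z) (b := z + 1))
      simpa using this
    exact h3.comp_measurePreserving h4
  have key : ∀ w ∈ Icc (0 : ℝ) 1, f (z + w) ^ 2 ≤ 100 * N := by
    intro w hw
    have := integral_sq_prim_le hsh hmp hw
    have e : ∫ s in (0 : ℝ)..1, deriv f (z + s) ^ 2 = normSq 0 (deriv f) := by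
      rw [normSq_zero_eq h2.memLp, intervalIntegral.integral_comp_add_left (fun s => deriv f s ^ 2) z]
      have h5 : Function.Periodic (fun s => deriv f s ^ 2) 1 := fun s => by
        simp only [h2.periodic s]
      have := h5.intervalIntegral_add_eq z 0
      simpa using this
    rw [e] at this
    simp only [add_zero] at this
    nlinarith
  -- Either `y` or `y + 1` lies in the period that starts at `z`.
  rcases le_total z y with h | h
  · have := key (y - z) ⟨by linarith, by linarith [hz.1, hy.2]⟩
    simpa using this
  · have := key (y + 1 - z) ⟨by linarith [hy.1, hz.2], by linarith⟩
    have e : z + (y + 1 - z) = y + 1 := by ring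
    rwa [e, hf.periodic y] at this

lemma IsPrim.normSq_le {q : ℝ} {f g : ℝ → ℝ} (h : IsPrim f g) (hf : MemH (q + 1) f) :
    normSq q g ≤ 4 * Real.pi ^ 2 * normSq (q + 1) f := by
  unfold normSq
  rw [← tsum_mul_left]
  have hle : ∀ n : ℤ, (1 + (n : ℝ) ^ 2) ^ q * ‖fourierC g n‖ ^ 2
      ≤ 4 * Real.pi ^ 2 * ((1 + (n : ℝ) ^ 2) ^ (q + 1) * ‖fourierC f n‖ ^ 2) := by
    intro n
    rw [norm_sq_fourierC_prim h hf.periodic, weight_succ]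
    have := weight_pos q n
    have h2 : 0 ≤ Real.pi ^ 2 * ((1 + (n : ℝ) ^ 2) ^ q * ‖fourierC f n‖ ^ 2) := by positivity
    nlinarith
  have hs := hf.summable.mul_left (4 * Real.pi ^ 2)
  exact (Summable.of_nonneg_of_le (fun n => by positivity) hle hs).tsum_le_tsum hle hs

namespace TendH
variable {ι : Type*} {l : Filter ι} {F G : ι → ℝ → ℝ} {f g : ℝ → ℝ}

lemma deriv {q : ℝ} (hq : 0 ≤ q) (h : TendH (q + 1) l F f) :
    TendH q l (fun i => _root_.deriv (F i)) (_root_.deriv f) := by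
  have hf := h.lim_mem.isPrim_deriv hq
  refine of_normSq (b := fun i => 4 * Real.pi ^ 2 * normSq (q + 1) (fun x => F i x - f x)) ?_ hf.2 ?_ ?_
  · filter_upwards [h.mem] with i hi using (hi.isPrim_deriv hq).2
  · simpa using h.tendsto.const_mul (4 * Real.pi ^ 2)
  · filter_upwards [h.mem] with i hi
    exact ((hi.isPrim_deriv hq).1.sub hf.1).normSq_le (hi.sub h.lim_mem)

/-- Convergence in `H^{q+1}` is detected by convergence of the derivatives in `H^q` and of the
values at one point. All later gains of one derivative use this form. -/
lemma of_prim {q : ℝ} (hq : 0 ≤ q) (hG : TendH q l G g) (hF : ∀ᶠ i in l, IsPrim (F i) (G i))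
    (hFp : ∀ᶠ i in l, Function.Periodic (F i) 1) (hf : IsPrim f g) (hfp : Function.Periodic f 1)
    (h0 : Tendsto (fun i => F i 0) l (𝓝 (f 0))) : TendH (q + 1) l F f := by
  refine of_normSq (b := fun i => 2 * (F i 0 - f 0) ^ 2 + 3 * normSq q (fun x => G i x - g x)) ?_
    (MemH.of_prim hq hf hfp hG.lim_mem).1 ?_ ?_
  · filter_upwards [hF, hFp, hG.mem] with i h1 h2 h3 using (MemH.of_prim hq h1 h2 h3).1
  · simpa using (((h0.sub_const (f 0)).pow 2).const_mul 2).add (hG.tendsto.const_mul 3)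
  · filter_upwards [hF, hFp, hG.mem] with i h1 h2 h3
    exact (MemH.of_prim hq (h1.sub hf) (h2.sub hfp) (h3.sub hG.lim_mem)).2

lemma tendstoUniformly (h : TendH 1 l F f) : TendstoUniformly F f l := by
  rw [Metric.tendstoUniformly_iff]
  intro ε hε
  have h2 : ∀ᶠ i in l, 100 * normSq 1 (fun x => F i x - f x) < ε ^ 2 := by
    have h3 : Tendsto (fun i => 100 * normSq 1 (fun x => F i x - f x)) l (𝓝 0) := by
      simpa using h.tendsto.const_mul 100
    exact h3.eventually_lt_const (by positivity)
  filter_upwards [h2, h.mem] with i hi hm x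
  have := (hm.sub h.lim_mem).abs_le x
  rw [dist_comm, Real.dist_eq]
  exact abs_lt_of_sq_lt_sq (this.trans_lt hi) hε.le

lemma tendsto_apply (h : TendH 1 l F f) (x : ℝ) : Tendsto (fun i => F i x) l (𝓝 (f x)) :=
  h.tendstoUniformly.tendsto_at x

end TendH

/-! ### Products in Sobolev spaces -/

lemma hasSum_fourier {g : ℝ → ℝ} (hg : Continuous g) (hp : Function.Periodic g 1)
    (hs : Summable fun n => ‖fourierC g n‖) (x : ℝ) :
    HasSum (fun k => fourierC g k * char (-k) x) (g x : ℂ) := by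
  have : Fact ((0 : ℝ) < 1) := ⟨one_pos⟩
  have hp' : Function.Periodic (fun x => (g x : ℂ)) 1 := fun x => by simp only [hp x]
  let K : C(AddCircle (1 : ℝ), ℂ) := ⟨hp'.lift, continuous_coinduced_dom.mpr (by
    change Continuous (fun x : ℝ => (g x : ℂ)); fun_prop)⟩
  have hK : ∀ y : ℝ, K y = g y := fun y => rfl
  have hc : ∀ n, fourierCoeff K n = fourierC g n := by
    intro n
    rw [fourierCoeff_eq_intervalIntegral _ n 0, fourierC_eq_integral]
    simp only [div_one, one_smul, zero_add, smul_eq_mul, hK, char_eq_fourier]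
  have h1 := has_pointwise_sum_fourier_series_of_summable (f := K) (by
    refine Summable.of_norm ?_
    simpa only [hc] using hs) (x : AddCircle (1 : ℝ))
  simp only [hc, hK, smul_eq_mul] at h1
  simpa only [char_eq_fourier, neg_neg] using h1

lemma char_mul (m n : ℤ) (x : ℝ) : char m x * char n x = char (m + n) x := by
  unfold char
  rw [← Complex.exp_add]
  congr 1
  push_cast; ring

/-- Only `g` is expanded in its Fourier series. The partial terms are dominated by `‖ĝ(k)‖ |f|`, so
mere integrability of `f` suffices. -/
lemma hasSum_fourierC_mul {f g : ℝ → ℝ} (hf : IntervalIntegrable f volume 0 1) (hg : Continuous g)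
    (hp : Function.Periodic g 1) (hs : Summable fun n => ‖fourierC g n‖) (n : ℤ) :
    HasSum (fun k => fourierC g k * fourierC f (n - k)) (fourierC (fun x => f x * g x) n) := by
  have hfm : AEStronglyMeasurable (fun x => (f x : ℂ)) (volume.restrict (uIoc 0 1)) := by
    rw [intervalIntegrable_iff] at hf
    exact Complex.continuous_ofReal.comp_aestronglyMeasurable hf.aestronglyMeasurable
  have := intervalIntegral.hasSum_integral_of_dominated_convergence (μ := volume) (a := 0) (b := 1)
    (F := fun (k : ℤ) x => fourierC g k * (char (n - k) x * (f x : ℂ)))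
    (f := fun x => char n x * ((f x * g x : ℝ) : ℂ))
    (fun k x => ‖fourierC g k‖ * |f x|)
    (fun k => (((continuous_char _).aestronglyMeasurable).mul hfm).const_mul _)
    (fun k => ae_of_all _ fun x _ => by
      rw [norm_mul, norm_mul, norm_char, one_mul, Complex.norm_real, Real.norm_eq_abs])
    (ae_of_all _ fun x _ => hs.mul_right _) (by
      simp only [tsum_mul_right]
      exact hf.abs.const_mul _) (ae_of_all _ fun x _ => by
      have h1 := ((hasSum_fourier hg hp hs x).mul_left (char n x * (f x : ℂ)))
      have e : ∀ k : ℤ, char n x * (f x : ℂ) * (fourierC g k * char (-k) x)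
          = fourierC g k * (char (n - k) x * (f x : ℂ)) := by
        intro k
        rw [sub_eq_add_neg, ← char_mul]; ring
      simp only [e] at h1
      convert! h1 using 1
      push_cast; ring)
  simp only [intervalIntegral.integral_const_mul, ← fourierC_eq_integral] at this
  exact this

lemma peetre (n k : ℤ) : 1 + (n : ℝ) ^ 2 ≤ 2 * ((1 + (k : ℝ) ^ 2) * (1 + ((n - k : ℤ) : ℝ) ^ 2)) := by
  push_cast
  nlinarith [sq_nonneg ((k : ℝ) * (n - k)), sq_nonneg ((n : ℝ) - 2 * k)]

/-- Young's inequality for a convolution of `ℓ²` with `ℓ¹`. By `peetre`, the `k`-th shifted copy of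
`f̂`, in the weighted `ℓ²` norm, costs `(1 + k²)^{a/2} |ĝ(k)|`. The triangle inequality in `ℓ²` sums
these costs. Cauchy–Schwarz bounds the sum by the `H^{a+3/4}` norm of `g`, because `(1 + k²)^{-3/4}`
is summable. The gap `3/4` could be any number above `1/2`; being below `1`, it leaves room for one
derivative. -/
theorem exists_mul_gap (a : ℝ) (ha : 0 ≤ a) : ∃ C : ℝ, 0 ≤ C ∧ ∀ f g : ℝ → ℝ, MemH a f → MemH (a + 3 / 4) g →
    (Summable fun n : ℤ => (1 + (n : ℝ) ^ 2) ^ a * ‖fourierC (fun x => f x * g x) n‖ ^ 2) ∧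
    normSq a (fun x => f x * g x) ≤ C * (normSq a f * normSq (a + 3 / 4) g) := by
  refine ⟨2 ^ a * ∑' n : ℤ, (1 + (n : ℝ) ^ 2) ^ (-(3 / 4) : ℝ), by positivity, fun f g hf hg => ?_⟩
  have hgc : Continuous g := hg.continuous (by linarith)
  set N := √(normSq a f) with hN
  -- `ℓ¹` bound of the weighted coefficients
  have hA := Real.summable_and_inner_le_Lp_mul_Lq_tsum_of_nonneg (ι := ℤ) (p := 2) (q := 2) (by constructor <;> norm_num)
    (f := fun n => (1 + (n : ℝ) ^ 2) ^ (-(3 / 8) : ℝ))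
    (g := fun n => (1 + (n : ℝ) ^ 2) ^ (a / 2 + 3 / 8) * ‖fourierC g n‖)
    (fun n => by positivity) (fun n => by positivity)
  have e1 : ∀ n : ℤ, ((1 + (n : ℝ) ^ 2) ^ (-(3 / 8) : ℝ)) ^ (2 : ℝ) = (1 + (n : ℝ) ^ 2) ^ (-(3 / 4) : ℝ) := by
    intro n; rw [← Real.rpow_mul (by positivity)]; norm_num
  have e2 : ∀ n : ℤ, ((1 + (n : ℝ) ^ 2) ^ (a / 2 + 3 / 8) * ‖fourierC g n‖) ^ (2 : ℝ)
      = (1 + (n : ℝ) ^ 2) ^ (a + 3 / 4) * ‖fourierC g n‖ ^ 2 := by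
    intro n
    rw [Real.mul_rpow (by positivity) (by positivity), ← Real.rpow_mul (by positivity), Real.rpow_two]
    congr 2; ring
  have e3 : ∀ n : ℤ, (1 + (n : ℝ) ^ 2) ^ (-(3 / 8) : ℝ) * ((1 + (n : ℝ) ^ 2) ^ (a / 2 + 3 / 8) * ‖fourierC g n‖)
      = (1 + (n : ℝ) ^ 2) ^ (a / 2) * ‖fourierC g n‖ := by
    intro n
    rw [← mul_assoc, ← Real.rpow_add (by positivity)]
    congr 2; ring
  simp only [e1, e2, e3] at hA
  obtain ⟨hAs, hAle⟩ := hA (summable_weight (by norm_num)) hg.summable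
  set A := ∑' n : ℤ, (1 + (n : ℝ) ^ 2) ^ (a / 2) * ‖fourierC g n‖ with hAdef
  have hA0 : 0 ≤ A := tsum_nonneg fun n => by positivity
  have hA2 : A ^ 2 ≤ (∑' n : ℤ, (1 + (n : ℝ) ^ 2) ^ (-(3 / 4) : ℝ)) * normSq (a + 3 / 4) g := by
    have h0 : 0 ≤ ∑' n : ℤ, (1 + (n : ℝ) ^ 2) ^ (-(3 / 4) : ℝ) := by positivity
    have hn0 : 0 ≤ ∑' n : ℤ, (1 + (n : ℝ) ^ 2) ^ (a + 3 / 4) * ‖fourierC g n‖ ^ 2 := normSq_nonneg _ _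
    have := pow_le_pow_left₀ hA0 hAle 2
    rwa [mul_pow, ← Real.sqrt_eq_rpow, ← Real.sqrt_eq_rpow, Real.sq_sqrt h0, Real.sq_sqrt hn0] at this
  -- the terms of the convolution as vectors of `ℓ²`
  set v : ℤ → ℤ → ℂ := fun k n => (((1 + (n : ℝ) ^ 2) ^ (a / 2) : ℝ) : ℂ) * (fourierC g k * fourierC f (n - k)) with hv
  have hvn : ∀ k n, ‖v k n‖ ^ 2 ≤ (2 ^ a * ((1 + (k : ℝ) ^ 2) ^ (a / 2) * ‖fourierC g k‖) ^ 2) *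
      ((1 + ((n - k : ℤ) : ℝ) ^ 2) ^ a * ‖fourierC f (n - k)‖ ^ 2) := by
    intro k n
    have h1 : (1 + (n : ℝ) ^ 2) ^ a ≤ 2 ^ a * ((1 + (k : ℝ) ^ 2) ^ a * (1 + ((n - k : ℤ) : ℝ) ^ 2) ^ a) := by
      rw [← Real.mul_rpow (by positivity) (by positivity), ← Real.mul_rpow (by positivity) (by positivity)]
      exact Real.rpow_le_rpow (by positivity) (peetre n k) ha
    have h2 : ∀ m : ℤ, ((1 + (m : ℝ) ^ 2) ^ (a / 2)) ^ 2 = (1 + (m : ℝ) ^ 2) ^ a := by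
      intro m
      rw [← Real.rpow_natCast, ← Real.rpow_mul (by positivity)]; norm_num
    rw [hv]; simp only
    rw [norm_mul, norm_mul, Complex.norm_real, Real.norm_of_nonneg (by positivity), mul_pow, mul_pow,
      mul_pow, h2, h2]
    calc _ ≤ (2 ^ a * ((1 + (k : ℝ) ^ 2) ^ a * (1 + ((n - k : ℤ) : ℝ) ^ 2) ^ a)) *
          (‖fourierC g k‖ ^ 2 * ‖fourierC f (n - k)‖ ^ 2) :=
          mul_le_mul_of_nonneg_right h1 (by positivity)
      _ = _ := by ring
  have hshift : ∀ k : ℤ, HasSum (fun n : ℤ => (1 + ((n - k : ℤ) : ℝ) ^ 2) ^ a * ‖fourierC f (n - k)‖ ^ 2)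
      (normSq a f) := by
    intro k
    exact (Equiv.subRight k).hasSum_iff.2 hf.summable.hasSum
  have hvs : ∀ k, Summable fun n => ‖v k n‖ ^ 2 := fun k =>
    Summable.of_nonneg_of_le (fun n => by positivity) (hvn k) ((hshift k).summable.mul_left _)
  have hvm : ∀ k, Memℓp (v k) 2 := fun k => memℓp_gen (by simpa using hvs k)
  let V : ℤ → lp (fun _ : ℤ => ℂ) 2 := fun k => ⟨v k, hvm k⟩
  have hVn : ∀ k, ‖V k‖ ≤ √(2 ^ a) * N * ((1 + (k : ℝ) ^ 2) ^ (a / 2) * ‖fourierC g k‖) := by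
    intro k
    refine lp.norm_le_of_tsum_le (by norm_num) (by positivity) ?_
    have h1 := (hvs k).tsum_le_tsum (hvn k) ((hshift k).summable.mul_left _)
    rw [tsum_mul_left, (hshift k).tsum_eq] at h1
    have h2 : (√(2 ^ a) * N * ((1 + (k : ℝ) ^ 2) ^ (a / 2) * ‖fourierC g k‖)) ^ 2
        = 2 ^ a * ((1 + (k : ℝ) ^ 2) ^ (a / 2) * ‖fourierC g k‖) ^ 2 * normSq a f := by
      rw [mul_pow, mul_pow, Real.sq_sqrt (by positivity), Real.sq_sqrt (normSq_nonneg a f)]; ring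
    simpa [h2] using h1
  have hVs : Summable fun k => ‖V k‖ :=
    Summable.of_nonneg_of_le (fun k => norm_nonneg _) hVn (hAs.mul_left _)
  obtain ⟨W, hW⟩ := Summable.of_norm hVs
  have hWn : ∀ n, W n = (((1 + (n : ℝ) ^ 2) ^ (a / 2) : ℝ) : ℂ) * fourierC (fun x => f x * g x) n := by
    intro n
    have h1 : HasSum (fun k => v k n) (W n) := by
      have := (lp.evalCLM ℝ (fun _ : ℤ => ℂ) 2 n).hasSum hW
      exact this
    exact h1.unique ((hasSum_fourierC_mul hf.intervalIntegrable hgc hg.periodic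
      (summable_norm_of_weight (by linarith) hg.summable) n).mul_left _)
  have hWn2 : ∀ n, ‖W n‖ ^ 2 = (1 + (n : ℝ) ^ 2) ^ a * ‖fourierC (fun x => f x * g x) n‖ ^ 2 := by
    intro n
    rw [hWn, norm_mul, Complex.norm_real, Real.norm_of_nonneg (by positivity), mul_pow,
      ← Real.rpow_natCast ((1 + (n : ℝ) ^ 2) ^ (a / 2)), ← Real.rpow_mul (by positivity)]
    norm_num
  have hWs := lp.hasSum_norm (p := 2) (by norm_num) W
  simp only [ENNReal.toReal_ofNat, Real.rpow_ofNat, hWn2] at hWs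
  refine ⟨hWs.summable, ?_⟩
  have hWle : ‖W‖ ≤ √(2 ^ a) * N * A := by
    rw [← hW.tsum_eq]
    refine (norm_tsum_le_tsum_norm hVs).trans ?_
    have := hVs.tsum_le_tsum hVn (hAs.mul_left _)
    rwa [tsum_mul_left] at this
  have : normSq a (fun x => f x * g x) = ‖W‖ ^ 2 := hWs.tsum_eq
  rw [this]
  calc ‖W‖ ^ 2 ≤ (√(2 ^ a) * N * A) ^ 2 := pow_le_pow_left₀ (norm_nonneg _) hWle 2
    _ = 2 ^ a * normSq a f * A ^ 2 := by
      rw [mul_pow, mul_pow, Real.sq_sqrt (by positivity), Real.sq_sqrt (normSq_nonneg a f)]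
    _ ≤ 2 ^ a * normSq a f * ((∑' n : ℤ, (1 + (n : ℝ) ^ 2) ^ (-(3 / 4) : ℝ)) * normSq (a + 3 / 4) g) :=
      mul_le_mul_of_nonneg_left hA2 (mul_nonneg (by positivity) (normSq_nonneg a f))
    _ = _ := by ring

lemma bounded_of_periodic {g : ℝ → ℝ} (hg : Continuous g) (hp : Function.Periodic g 1) :
    ∃ C, 0 ≤ C ∧ ∀ x, |g x| ≤ C := by
  obtain ⟨C, hC⟩ := isCompact_Icc.exists_bound_of_continuousOn (hg.continuousOn (s := Icc (0 : ℝ) 1))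
  refine ⟨C, (norm_nonneg _).trans (hC 0 (by simp)), fun x => ?_⟩
  obtain ⟨y, hy, hxy⟩ := hp.exists_mem_Ico₀ one_pos x
  rw [hxy]
  exact hC y ⟨hy.1, hy.2.le⟩

lemma memLp_mul_continuous {f g : ℝ → ℝ} (hf : MemLp f 2 (volume.restrict (Ioc 0 1))) (hg : Continuous g) :
    MemLp (fun x => f x * g x) 2 (volume.restrict (Ioc 0 1)) := by
  obtain ⟨C, hC⟩ := isCompact_Icc.exists_bound_of_continuousOn (hg.continuousOn (s := Icc (0 : ℝ) 1))
  refine MemLp.of_le_mul (c := C) hf (hf.aestronglyMeasurable.mul hg.aestronglyMeasurable) ?_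
  rw [ae_restrict_iff' measurableSet_Ioc]
  refine ae_of_all _ fun x hx => ?_
  rw [norm_mul, mul_comm]
  exact mul_le_mul_of_nonneg_right (hC x ⟨hx.1.le, hx.2⟩) (norm_nonneg _)

theorem MemH.mul_gap {a b : ℝ} (ha : 0 ≤ a) (hab : a + 3 / 4 ≤ b) {f g : ℝ → ℝ} (hf : MemH a f)
    (hg : MemH b g) : MemH a (fun x => f x * g x) where
  periodic := hf.periodic.mul hg.periodic
  memLp := memLp_mul_continuous hf.memLp (hg.continuous (by linarith))
  summable := ((exists_mul_gap a ha).choose_spec.2 f g hf (hg.mono hab)).1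
  continuous := fun h => (hf.continuous h).mul (hg.continuous (by linarith))

namespace TendH
variable {ι : Type*} {l : Filter ι} {F G : ι → ℝ → ℝ} {f g : ℝ → ℝ}

theorem mul_gap {a b : ℝ} (ha : 0 ≤ a) (hab : a + 3 / 4 ≤ b) (hF : TendH a l F f) (hG : TendH b l G g) :
    TendH a l (fun i x => F i x * G i x) (fun x => f x * g x) := by
  obtain ⟨C, hC0, hC⟩ := exists_mul_gap a ha
  -- The product difference splits as `(F - f)(G - g) + (F - f)g + f(G - g)`, and each summand has
  -- one factor of vanishing norm.
  have key : ∀ {F' G' : ι → ℝ → ℝ}, (∀ᶠ i in l, MemH a (F' i)) → (∀ᶠ i in l, MemH b (G' i)) →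
      Tendsto (fun i => normSq a (F' i) * normSq (a + 3 / 4) (G' i)) l (𝓝 0) →
      TendH a l (fun i x => F' i x * G' i x) (fun _ => 0) := by
    intro F' G' h1 h2 h3
    refine of_normSq ?_ (memH_const a 0) (b := fun i => C * (normSq a (F' i) * normSq (a + 3 / 4) (G' i))) ?_ ?_
    · filter_upwards [h1, h2] with i i1 i2 using i1.mul_gap ha hab i2
    · simpa using h3.const_mul C
    · filter_upwards [h1, h2] with i i1 i2
      simpa using (hC _ _ i1 (i2.mono hab)).2
  have hG' := hG.mono hab
  have t1 := key (F' := fun i x => F i x - f x) (G' := fun i x => G i x - g x)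
    (by filter_upwards [hF.mem] with i hi using hi.sub hF.lim_mem)
    (by filter_upwards [hG.mem] with i hi using hi.sub hG.lim_mem)
    (by simpa using hF.tendsto.mul hG'.tendsto)
  have t2 := key (F' := fun i x => F i x - f x) (G' := fun _ => g)
    (by filter_upwards [hF.mem] with i hi using hi.sub hF.lim_mem)
    (Eventually.of_forall fun _ => hG.lim_mem)
    (by simpa using hF.tendsto.mul_const _)
  have t3 := key (F' := fun _ => f) (G' := fun i x => G i x - g x)
    (Eventually.of_forall fun _ => hF.lim_mem)
    (by filter_upwards [hG.mem] with i hi using hi.sub hG.lim_mem)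
    (by simpa using hG'.tendsto.const_mul _)
  have t4 := ((t1.add t2).add t3).add (const (hF.lim_mem.mul_gap ha hab hG.lim_mem) l)
  simp only [zero_add] at t4
  refine t4.congr (Eventually.of_forall fun i => ?_)
  ext x; ring

/-- `H^r` is an algebra for `r ≥ 1`. -/
theorem mul {r : ℝ} (hr : 1 ≤ r) (hF : TendH r l F f) (hG : TendH r l G g) :
    TendH r l (fun i x => F i x * G i x) (fun x => f x * g x) := by
  obtain ⟨q, rfl⟩ : ∃ q, r = q + 1 := ⟨r - 1, by ring⟩
  have hq : 0 ≤ q := by linarith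
  -- In each term of the Leibniz rule one factor is in `H^{r-1}` and the other in `H^r`; the gap of
  -- `1` exceeds the required `3/4`.
  have h1 := (hF.deriv hq).mul_gap hq (by linarith) hG
  have h2 := (hG.deriv hq).mul_gap hq (by linarith) hF
  refine of_prim hq (h1.add h2) ?_ ?_ ?_ (hF.lim_mem.periodic.mul hG.lim_mem.periodic)
    (((hF.mono hr).tendsto_apply 0).mul ((hG.mono hr).tendsto_apply 0))
  · filter_upwards [hF.mem, hG.mem] with i i1 i2
    have := (i1.isPrim_deriv hq).1.mul (i2.isPrim_deriv hq).1
    simpa only [mul_comm (F i _) (_root_.deriv (G i) _)] using this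
  · filter_upwards [hF.mem, hG.mem] with i i1 i2 using i1.periodic.mul i2.periodic
  · have := (hF.lim_mem.isPrim_deriv hq).1.mul (hG.lim_mem.isPrim_deriv hq).1
    simpa only [mul_comm (f _) (_root_.deriv g _)] using this

/-- Starts the argument for inverses: at that point only uniform convergence of `1/F²` is known,
which is still a multiplier on `L²`. -/
lemma mul_uniform (hF : TendH 0 l F f) (hG : TendstoUniformly G g l) (hGc : ∀ᶠ i in l, Continuous (G i))
    (hGp : ∀ᶠ i in l, Function.Periodic (G i) 1) (hg : Continuous g) (hgp : Function.Periodic g 1) :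
    TendH 0 l (fun i x => F i x * G i x) (fun x => f x * g x) := by
  obtain ⟨C, hC0, hC⟩ := bounded_of_periodic hg hgp
  have hmul : ∀ {φ γ : ℝ → ℝ}, MemH 0 φ → Continuous γ → Function.Periodic γ 1 → MemH 0 (fun x => φ x * γ x) :=
    fun h1 h2 h3 => memH_zero_of (h1.periodic.mul h3) (memLp_mul_continuous h1.memLp h2)
  have bd : ∀ {φ γ : ℝ → ℝ} {K : ℝ}, MemH 0 φ → Continuous γ → Function.Periodic γ 1 → (∀ x, |γ x| ≤ K) →
      normSq 0 (fun x => φ x * γ x) ≤ K ^ 2 * normSq 0 φ := by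
    intro φ γ K h1 h2 h3 h4
    rw [normSq_zero_eq (hmul h1 h2 h3).memLp, normSq_zero_eq h1.memLp, ← intervalIntegral.integral_const_mul]
    refine intervalIntegral.integral_mono_on zero_le_one ?_ ?_ fun x _ => ?_
    · rw [intervalIntegrable_iff_integrableOn_Ioc_of_le zero_le_one]; exact (hmul h1 h2 h3).memLp.integrable_sq
    · refine IntervalIntegrable.const_mul ?_ _
      rw [intervalIntegrable_iff_integrableOn_Ioc_of_le zero_le_one]; exact h1.memLp.integrable_sq
    · rw [mul_pow, mul_comm]
      refine mul_le_mul_of_nonneg_right ?_ (sq_nonneg _)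
      rw [← sq_abs]; exact pow_le_pow_left₀ (abs_nonneg _) (h4 x) 2
  have t1 : TendH 0 l (fun i x => (F i x - f x) * G i x) (fun _ => 0) := by
    refine of_normSq ?_ (memH_const 0 0) (b := fun i => (C + 1) ^ 2 * normSq 0 (fun x => F i x - f x)) ?_ ?_
    · filter_upwards [hF.mem, hGc, hGp] with i i1 i2 i3 using hmul (i1.sub hF.lim_mem) i2 i3
    · simpa using hF.tendsto.const_mul ((C + 1) ^ 2)
    · filter_upwards [hF.mem, hGc, hGp, Metric.tendstoUniformly_iff.1 hG 1 one_pos] with i i1 i2 i3 i4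
      simp only [sub_zero]
      refine bd (i1.sub hF.lim_mem) i2 i3 fun x => ?_
      have := i4 x
      rw [dist_comm, Real.dist_eq] at this
      have h5 := abs_sub_abs_le_abs_sub (G i x) (g x)
      linarith [hC x]
  have t2 : TendH 0 l (fun i x => f x * (G i x - g x)) (fun _ => 0) := by
    refine ⟨?_, memH_const 0 0, ?_⟩
    · filter_upwards [hGc, hGp] with i i2 i3 using hmul hF.lim_mem (i2.sub hg) (i3.sub hgp)
    · simp only [sub_zero]
      rw [Metric.tendsto_nhds]
      intro ε hε
      set N := normSq 0 f
      have hN : 0 ≤ N := normSq_nonneg _ _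
      obtain ⟨δ, hδ, hδ2⟩ : ∃ δ > 0, δ ^ 2 * N < ε := by
        refine ⟨√(ε / (N + 1)), Real.sqrt_pos.2 (by positivity), ?_⟩
        rw [Real.sq_sqrt (by positivity), div_mul_eq_mul_div, div_lt_iff₀ (by positivity)]
        nlinarith
      filter_upwards [hGc, hGp, Metric.tendstoUniformly_iff.1 hG δ hδ] with i i2 i3 i4
      rw [Real.dist_eq, sub_zero, abs_of_nonneg (normSq_nonneg _ _)]
      refine (bd hF.lim_mem (i2.sub hg) (i3.sub hgp) fun x => ?_).trans_lt hδ2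
      have := i4 x
      rw [dist_comm, Real.dist_eq] at this
      exact this.le
  have t3 := (t1.add t2).add (const (hmul hF.lim_mem hg hgp) l)
  simp only [zero_add] at t3
  refine t3.congr (Eventually.of_forall fun i => ?_)
  ext x; ring

end TendH

/-! ### Inverses of positive functions -/

lemma exists_pos_le_of_periodic {f : ℝ → ℝ} (hf : Continuous f) (hp : Function.Periodic f 1)
    (h0 : ∀ x, 0 < f x) : ∃ m, 0 < m ∧ ∀ x, m ≤ f x := by
  obtain ⟨z, hz, hmin⟩ := isCompact_Icc.exists_isMinOn (nonempty_Icc.2 (zero_le_one (α := ℝ))) hf.continuousOn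
  refine ⟨f z, h0 z, fun x => ?_⟩
  obtain ⟨y, hy, hxy⟩ := hp.exists_mem_Ico₀ one_pos x
  rw [hxy]
  exact hmin ⟨hy.1, hy.2.le⟩

section
variable {ι : Type*} {l : Filter ι} {F : ι → ℝ → ℝ} {f : ℝ → ℝ}

lemma tendstoUniformly_eventually_le (h : TendstoUniformly F f l) {m : ℝ} (hm : 0 < m)
    (hf : ∀ x, m ≤ f x) : ∀ᶠ i in l, ∀ x, m / 2 ≤ F i x := by
  filter_upwards [Metric.tendstoUniformly_iff.1 h (m / 2) (by positivity)] with i hi x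
  have := hi x
  rw [Real.dist_eq] at this
  linarith [le_abs_self (f x - F i x), hf x]

lemma tendstoUniformly_eventually_abs_le (h : TendstoUniformly F f l) {M : ℝ}
    (hf : ∀ x, |f x| ≤ M) : ∀ᶠ i in l, ∀ x, |F i x| ≤ M + 1 := by
  filter_upwards [Metric.tendstoUniformly_iff.1 h 1 one_pos] with i hi x
  have := hi x
  rw [dist_comm, Real.dist_eq] at this
  linarith [abs_sub_abs_le_abs_sub (F i x) (f x), hf x]

lemma tendstoUniformly_inv (h : TendstoUniformly F f l) {m : ℝ} (hm : 0 < m) (hf : ∀ x, m ≤ f x) :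
    TendstoUniformly (fun i x => (F i x)⁻¹) (fun x => (f x)⁻¹) l := by
  rw [Metric.tendstoUniformly_iff]
  intro ε hε
  filter_upwards [tendstoUniformly_eventually_le h hm hf,
    Metric.tendstoUniformly_iff.1 h (ε * (m * (m / 2))) (by positivity)] with i h1 h2 x
  have hX : 0 < f x := hm.trans_le (hf x)
  have hY : 0 < F i x := (half_pos hm).trans_le (h1 x)
  have e : (f x)⁻¹ - (F i x)⁻¹ = -((f x - F i x) / (f x * F i x)) := by field_simp; ring
  have h3 := h2 x
  rw [Real.dist_eq] at h3 ⊢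
  rw [e, abs_neg, abs_div, abs_of_pos (mul_pos hX hY), div_lt_iff₀ (mul_pos hX hY)]
  refine h3.trans_le ?_
  have := mul_le_mul (hf x) (h1 x) (by positivity) hX.le
  exact mul_le_mul_of_nonneg_left this hε.le

/-- Inversion is continuous on the positive functions of `H^r`, `r ≥ 1`. -/
theorem TendH.inv {r : ℝ} (hr : 1 ≤ r) (hF : TendH r l F f) (hF0 : ∀ᶠ i in l, ∀ x, 0 < F i x)
    (hf0 : ∀ x, 0 < f x) : TendH r l (fun i x => (F i x)⁻¹) (fun x => (f x)⁻¹) := by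
  have hq : 0 ≤ r - 1 := by linarith
  have hr' : r - 1 + 1 = r := by ring
  have hFr : TendH (r - 1 + 1) l F f := by rwa [hr']
  have hD := hFr.deriv hq
  have hfc : Continuous f := hF.lim_mem.continuous (by linarith)
  obtain ⟨m, hm, hfm⟩ := exists_pos_le_of_periodic hfc hF.lim_mem.periodic hf0
  have hprim : ∀ {φ : ℝ → ℝ}, MemH r φ → (∀ x, 0 < φ x) →
      IsPrim (fun x => (φ x)⁻¹) (fun x => (-1) * (_root_.deriv φ x * ((φ x)⁻¹ * (φ x)⁻¹))) := by
    intro φ h1 h2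
    have := ((hr'.symm ▸ h1 : MemH (r - 1 + 1) φ).isPrim_deriv hq).1.inv h2
    convert this using 2 with x
    have := (h2 x).ne'
    field_simp
  have hper : ∀ {φ : ℝ → ℝ}, Function.Periodic φ 1 → Function.Periodic (fun x => (φ x)⁻¹) 1 :=
    fun h x => by simp only [h x]
  -- From `(1/F)' = -F'/F²`: control of this product in `H^a` gives control of `1/F` in `H^{a+1}`.
  have step : ∀ a : ℝ, 0 ≤ a → TendH a l (fun i x => _root_.deriv (F i) x * ((F i x)⁻¹ * (F i x)⁻¹))
      (fun x => _root_.deriv f x * ((f x)⁻¹ * (f x)⁻¹)) →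
      TendH (a + 1) l (fun i x => (F i x)⁻¹) (fun x => (f x)⁻¹) := by
    intro a ha h
    refine TendH.of_prim ha (h.const_mul (-1)) ?_ ?_ (hprim hF.lim_mem hf0) (hper hF.lim_mem.periodic) ?_
    · filter_upwards [hF.mem, hF0] with i i1 i2 using hprim i1 i2
    · filter_upwards [hF.mem] with i i1 using hper i1.periodic
    · exact ((hF.mono hr).tendsto_apply 0).inv₀ (hf0 0).ne'
  have base : TendH 1 l (fun i x => (F i x)⁻¹) (fun x => (f x)⁻¹) := by
    have hsq := ((hF.mono hr).mul le_rfl (hF.mono hr)).tendstoUniformly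
    have hu := tendstoUniformly_inv hsq (m := m * m) (by positivity)
      (fun x => mul_le_mul (hfm x) (hfm x) hm.le (hf0 x).le)
    simp only [mul_inv] at hu
    have h0 := step 0 le_rfl ((hD.mono hq).mul_uniform hu ?_ ?_ ?_ ?_)
    · rwa [zero_add] at h0
    · filter_upwards [hF.mem, hF0] with i i1 i2
      have := (i1.continuous (by linarith)).inv₀ fun x => (i2 x).ne'
      exact this.mul this
    · filter_upwards [hF.mem] with i i1 using (hper i1.periodic).mul (hper i1.periodic)
    · have := hfc.inv₀ fun x => (hf0 x).ne'
      exact this.mul this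
    · exact (hper hF.lim_mem.periodic).mul (hper hF.lim_mem.periodic)
  -- Bootstrap. If `1/F` converges in `H^b`, then `F'/F²` converges in order `min (r-1) (b-3/4)`, so
  -- `1/F` converges in order `min r (b+1/4)`. Each round gains `1/4` until `r` is reached.
  have ind : ∀ k : ℕ, TendH (min r (1 + k / 4)) l (fun i x => (F i x)⁻¹) (fun x => (f x)⁻¹) := by
    intro k
    induction k with
    | zero => simpa [min_eq_right hr] using base
    | succ k ih =>
      set b := min r (1 + (k : ℝ) / 4) with hb
      have hk : (0 : ℝ) ≤ (k : ℝ) / 4 := by positivity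
      have hb1 : 1 ≤ b := le_min hr (by linarith)
      have hsq := ih.mul hb1 ih
      have ha : 0 ≤ min (r - 1) (b - 3 / 4) := le_min hq (by linarith)
      have h1 := step _ ha ((hD.mono (min_le_left _ _)).mul_gap ha
        (by linarith [min_le_right (r - 1) (b - 3 / 4)]) hsq)
      refine h1.mono ?_
      rw [← min_add_add_right, hb]
      push_cast
      refine le_min ((min_le_left _ _).trans (by linarith)) ?_
      rw [sub_add, ← min_sub_sub_right]
      refine le_min ((min_le_left _ _).trans (by linarith)) ((min_le_right _ _).trans (by linarith))
  obtain ⟨k, hk⟩ := exists_nat_gt (4 * r)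
  have := ind k
  rwa [min_eq_left (by linarith)] at this

end

/-! ### Circle diffeomorphisms and change of variables -/

/-- The primitive that vanishes at `0`. -/
def primF (d : ℝ → ℝ) (x : ℝ) : ℝ := ∫ y in (0 : ℝ)..x, d y

/-- `primF d` is an orientation preserving `C¹` diffeomorphism of the circle with inverse `ψ`. -/
structure CircleChange (d ψ : ℝ → ℝ) : Prop where
  cont : Continuous d
  per : Function.Periodic d 1
  pos : ∀ x, 0 < d x
  int_one : ∫ y in (0 : ℝ)..1, d y = 1
  left : ∀ x, ψ (primF d x) = x
  right : ∀ x, primF d (ψ x) = x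

lemma primF_zero (d : ℝ → ℝ) : primF d 0 = 0 := by simp [primF]

lemma isPrim_primF {d : ℝ → ℝ} (h : ∀ a b, IntervalIntegrable d volume a b) : IsPrim (primF d) d :=
  ⟨h, fun x => by simp [primF]⟩

lemma hasDerivAt_primF {d : ℝ → ℝ} (hd : Continuous d) (x : ℝ) : HasDerivAt (primF d) (d x) x :=
  (hd.integral_hasStrictDerivAt 0 x).hasDerivAt

lemma primF_add_one {d : ℝ → ℝ} (hd : Continuous d) (hp : Function.Periodic d 1) (x : ℝ) :
    primF d (x + 1) = primF d x + ∫ y in (0 : ℝ)..1, d y := by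
  have h := (isPrim_primF (fun a b => hd.intervalIntegrable a b)).sub_eq x (x + 1)
  have := hp.intervalIntegral_add_eq x 0
  rw [this, zero_add] at h
  linarith

/-- Total mass `1` makes the primitive fix every integer, so the intermediate value theorem between
consecutive integers gives surjectivity; positivity of `d` gives injectivity. -/
lemma exists_circleChange {d : ℝ → ℝ} (hc : Continuous d) (hp : Function.Periodic d 1)
    (h0 : ∀ x, 0 < d x) (h1 : ∫ y in (0 : ℝ)..1, d y = 1) : ∃ ψ, CircleChange d ψ := by
  have hinj : Function.Injective (primF d) := by
    refine StrictMono.injective (strictMono_of_deriv_pos fun x => ?_)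
    rw [(hasDerivAt_primF hc x).deriv]; exact h0 x
  have hcont : Continuous (primF d) :=
    continuous_iff_continuousAt.2 fun x => (hasDerivAt_primF hc x).continuousAt
  have hint : ∀ n : ℤ, primF d n = n := by
    intro n
    have hper : Function.Periodic (fun x => primF d x - x) 1 := fun x => by
      simp only [primF_add_one hc hp, h1]; ring
    have := hper.int_mul n 0
    simp only [mul_one, zero_add, primF_zero, sub_zero] at this
    linarith
  have hsurj : Function.Surjective (primF d) := by
    intro y
    have := intermediate_value_Icc (a := (⌊y⌋ : ℝ)) (b := ((⌊y⌋ + 1 : ℤ) : ℝ)) (by push_cast; linarith)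
      hcont.continuousOn
    rw [hint, hint] at this
    obtain ⟨x, -, hx⟩ := this ⟨Int.floor_le y, by push_cast; exact (Int.lt_floor_add_one y).le⟩
    exact ⟨x, hx⟩
  exact ⟨Function.invFun (primF d), hc, hp, h0, h1, Function.leftInverse_invFun hinj,
    Function.rightInverse_invFun hsurj⟩

namespace CircleChange
variable {d ψ : ℝ → ℝ}

lemma isPrim (h : CircleChange d ψ) : IsPrim (primF d) d :=
  isPrim_primF fun a b => h.cont.intervalIntegrable a b

lemma add_one (h : CircleChange d ψ) (x : ℝ) : primF d (x + 1) = primF d x + 1 := by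
  rw [primF_add_one h.cont h.per, h.int_one]

lemma one (h : CircleChange d ψ) : primF d 1 = 1 := h.int_one

lemma strictMono (h : CircleChange d ψ) : StrictMono (primF d) :=
  strictMono_of_deriv_pos fun x => by rw [(hasDerivAt_primF h.cont x).deriv]; exact h.pos x

lemma inv_zero (h : CircleChange d ψ) : ψ 0 = 0 := by
  have := h.left 0
  rwa [primF_zero] at this

lemma inv_add_one (h : CircleChange d ψ) (x : ℝ) : ψ (x + 1) = ψ x + 1 := by
  apply h.strictMono.injective
  rw [h.right, h.add_one, h.right]

lemma periodic_comp (h : CircleChange d ψ) {f : ℝ → ℝ} (hf : Function.Periodic f 1) :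
    Function.Periodic (fun x => f (ψ x)) 1 := fun x => by simp only [h.inv_add_one, hf (ψ x)]

lemma inv_strictMono (h : CircleChange d ψ) : StrictMono ψ := by
  intro x y hxy
  rw [← h.strictMono.lt_iff_lt, h.right, h.right]; exact hxy

lemma inv_surjective (h : CircleChange d ψ) : Function.Surjective ψ := fun x => ⟨_, h.left x⟩

lemma inv_continuous (h : CircleChange d ψ) : Continuous ψ :=
  h.inv_strictMono.monotone.continuous_of_surjective h.inv_surjective

/-- The substitution formula holds for arbitrary `g`, without integrability, because the change of
variables is monotone and onto its image interval. -/
lemma integral_comp (h : CircleChange d ψ) (g : ℝ → ℝ) (a b : ℝ) :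
    ∫ x in primF d a..primF d b, g (ψ x) = ∫ y in a..b, g y * d y := by
  have := intervalIntegral.integral_comp_mul_deriv_of_deriv_nonneg (a := a) (b := b) (f := primF d)
    (f' := d) (g := fun x => g (ψ x)) h.isPrim.continuous.continuousOn
    (fun x _ => hasDerivAt_primF h.cont x) (fun x _ => (h.pos x).le)
  rw [← this]
  simp [h.left]

lemma integral_comp_unit (h : CircleChange d ψ) (g : ℝ → ℝ) :
    ∫ x in (0 : ℝ)..1, g (ψ x) = ∫ y in (0 : ℝ)..1, g y * d y := by
  have := h.integral_comp g 0 1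
  rwa [primF_zero, h.one] at this

lemma intervalIntegrable_comp (h : CircleChange d ψ) {g : ℝ → ℝ}
    (hg : ∀ a b, IntervalIntegrable g volume a b) (a b : ℝ) :
    IntervalIntegrable (fun x => g (ψ x)) volume a b := by
  have := intervalIntegral.integrable_comp_mul_deriv_iff_of_deriv_nonneg (a := ψ a) (b := ψ b) (f := primF d)
    (f' := d) (g := fun x => g (ψ x)) h.isPrim.continuous.continuousOn
    (fun x _ => hasDerivAt_primF h.cont x) (fun x _ => (h.pos x).le)
  rw [h.right, h.right] at this
  rw [← this]
  simp only [Function.comp_def, h.left]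
  exact (hg _ _).mul_continuousOn h.cont.continuousOn

lemma memLp_comp (h : CircleChange d ψ) {f : ℝ → ℝ} (hfp : Function.Periodic f 1)
    (hf : MemLp f 2 (volume.restrict (Ioc 0 1))) :
    MemLp (fun x => f (ψ x)) 2 (volume.restrict (Ioc 0 1)) := by
  have h1 := (memH_zero_of hfp hf).intervalIntegrable'
  have h2 : ∀ a b, IntervalIntegrable (fun x => f x ^ 2) volume a b := by
    have hp2 : Function.Periodic (fun x => f x ^ 2) 1 := fun x => by simp only [hfp x]
    refine hp2.intervalIntegrable (t := 0) one_ne_zero ?_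
    rw [intervalIntegrable_iff_integrableOn_Ioc_of_le (by linarith)]
    rw [zero_add]; exact hf.integrable_sq
  rw [memLp_two_iff_integrable_sq (h.intervalIntegrable_comp h1 0 1).1.aestronglyMeasurable]
  exact (h.intervalIntegrable_comp h2 0 1).1

/-- The chain rule for composition with the inverse map. -/
lemma isPrim_comp (h : CircleChange d ψ) {f g : ℝ → ℝ} (hf : IsPrim f g) :
    IsPrim (fun x => f (ψ x)) (fun x => g (ψ x) * (d (ψ x))⁻¹) := by
  have hdinv : Continuous fun x => (d x)⁻¹ := h.cont.inv₀ fun x => (h.pos x).ne'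
  refine ⟨h.intervalIntegrable_comp (g := fun x => g x * (d x)⁻¹)
    fun a b => (hf.int a b).mul_continuousOn hdinv.continuousOn, fun x => ?_⟩
  have := h.integral_comp (fun x => g x * (d x)⁻¹) 0 (ψ x)
  rw [primF_zero, h.right] at this
  rw [this, h.inv_zero, hf.eq (ψ x)]
  congr 2; ext y
  have := (h.pos y).ne'
  field_simp

end CircleChange

/-! ### Composition with diffeomorphisms through the Gagliardo seminorm -/

/-- Weak convergence together with convergence of norms implies convergence, in weighted `ℓ²`. -/
lemma tendsto_tsum_sub_of_tendsto {ι : Type*} {l : Filter ι} {w : ℤ → ℝ} (hw : ∀ n, 0 ≤ w n)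
    {c : ι → ℤ → ℂ} {c₀ : ℤ → ℂ} (hc : ∀ n, Tendsto (fun i => c i n) l (𝓝 (c₀ n)))
    (hs : ∀ᶠ i in l, Summable fun n => w n * ‖c i n‖ ^ 2) (hs₀ : Summable fun n => w n * ‖c₀ n‖ ^ 2)
    (hN : Tendsto (fun i => ∑' n, w n * ‖c i n‖ ^ 2) l (𝓝 (∑' n, w n * ‖c₀ n‖ ^ 2))) :
    Tendsto (fun i => ∑' n, w n * ‖c i n - c₀ n‖ ^ 2) l (𝓝 0) := by
  rw [Metric.tendsto_nhds]
  intro ε hε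
  -- Off a finite set `S` that carries all but `δ` of the limit norm, the tail of `c i` is below
  -- `3δ`, since the norms converge. The total is then below `δ + 2·3δ + 2·δ = 9δ`.
  obtain ⟨δ, hδ, hδε⟩ : ∃ δ > 0, 10 * δ < ε := ⟨ε / 20, by positivity, by linarith⟩
  obtain ⟨S, hS⟩ := (hs₀.hasSum.eventually_const_lt (u := (∑' n, w n * ‖c₀ n‖ ^ 2) - δ) (by linarith)).exists
  have h1 : Tendsto (fun i => ∑ n ∈ S, w n * ‖c i n‖ ^ 2) l (𝓝 (∑ n ∈ S, w n * ‖c₀ n‖ ^ 2)) :=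
    tendsto_finsetSum _ fun n _ => ((hc n).norm.pow 2).const_mul _
  have h2 : Tendsto (fun i => ∑ n ∈ S, w n * ‖c i n - c₀ n‖ ^ 2) l (𝓝 0) := by
    have := tendsto_finsetSum S fun n _ => (((hc n).sub_const (c₀ n)).norm.pow 2).const_mul (w n)
    simpa using this
  filter_upwards [hs, h1.eventually_const_lt (u := (∑ n ∈ S, w n * ‖c₀ n‖ ^ 2) - δ) (by linarith), h2.eventually_lt_const hδ,
    hN.eventually_lt_const (u := (∑' n, w n * ‖c₀ n‖ ^ 2) + δ) (by linarith)] with i i1 i2 i3 i4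
  have hle : ∀ n, w n * ‖c i n - c₀ n‖ ^ 2 ≤ 2 * (w n * ‖c i n‖ ^ 2) + 2 * (w n * ‖c₀ n‖ ^ 2) := by
    intro n
    have : ‖c i n - c₀ n‖ ^ 2 ≤ 2 * ‖c i n‖ ^ 2 + 2 * ‖c₀ n‖ ^ 2 := by
      nlinarith [norm_sub_le (c i n) (c₀ n), sq_nonneg (‖c i n‖ - ‖c₀ n‖), norm_nonneg (c i n - c₀ n)]
    nlinarith [hw n]
  have hsd : Summable fun n => w n * ‖c i n - c₀ n‖ ^ 2 :=
    Summable.of_nonneg_of_le (fun n => mul_nonneg (hw n) (by positivity)) hle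
      ((i1.mul_left 2).add (hs₀.mul_left 2))
  rw [Real.dist_eq, sub_zero, abs_of_nonneg (tsum_nonneg fun n => mul_nonneg (hw n) (by positivity))]
  have e1 := hsd.sum_add_tsum_compl (s := S)
  have e2 := i1.sum_add_tsum_compl (s := S)
  have e3 := hs₀.sum_add_tsum_compl (s := S)
  have s1 : Summable fun n : ↑((↑S : Set ℤ)ᶜ) => w n * ‖c i n‖ ^ 2 := i1.subtype _
  have s2 : Summable fun n : ↑((↑S : Set ℤ)ᶜ) => w n * ‖c₀ n‖ ^ 2 := hs₀.subtype _
  have s3 : Summable fun n : ↑((↑S : Set ℤ)ᶜ) => w n * ‖c i n - c₀ n‖ ^ 2 := hsd.subtype _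
  have h5 := Summable.tsum_le_tsum (fun n : ↑((↑S : Set ℤ)ᶜ) => hle n) s3 ((s1.mul_left 2).add (s2.mul_left 2))
  rw [Summable.tsum_add (s1.mul_left 2) (s2.mul_left 2), tsum_mul_left, tsum_mul_left] at h5
  linarith

/-- The Gagliardo double integral, with kernel `|x - y|^(-(1 + 2θ))`. -/
def gagliardo (θ : ℝ) (f : ℝ → ℝ) : ENNReal :=
  ∫⁻ x in Ioc (0 : ℝ) 1, ∫⁻ y, ENNReal.ofReal (|f x - f y| ^ 2 * |x - y| ^ (-(1 + 2 * θ)))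

/-- The constant in the Fourier representation of the Gagliardo double integral. -/
def gagliardoConst (θ : ℝ) : ENNReal :=
  ∫⁻ z : ℝ, ENNReal.ofReal (‖1 - char (-1) z‖ ^ 2 * |z| ^ (-(1 + 2 * θ)))

lemma norm_one_sub_char_le (z : ℝ) : ‖1 - char (-1) z‖ ≤ 2 * Real.pi * |z| := by
  have h := Real.norm_exp_I_mul_ofReal_sub_one_le (x := 2 * Real.pi * z)
  rw [norm_sub_rev]
  unfold char
  have e : (((-(2 * Real.pi * ((-1 : ℤ) : ℝ) * z) : ℝ) : ℂ) * Complex.I)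
      = Complex.I * ((2 * Real.pi * z : ℝ) : ℂ) := by push_cast; ring
  rw [e]
  refine h.trans (le_of_eq ?_)
  rw [Real.norm_eq_abs, abs_mul, abs_of_pos (by positivity)]

/-- Near `0` the integrand is at most `(2π)² z^{1-2θ}`, integrable because `θ < 1`; beyond `1` it is
at most `4 z^{-1-2θ}`, integrable because `θ > 0`. The negative half line follows by symmetry. -/
lemma gagliardoConst_lt_top {θ : ℝ} (h0 : 0 < θ) (h1 : θ < 1) : gagliardoConst θ < ⊤ := by
  have hI : Integrable (fun z : ℝ => ‖1 - char (-1) z‖ ^ 2 * |z| ^ (-(1 + 2 * θ))) := by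
    have hm : AEStronglyMeasurable (fun z : ℝ => ‖1 - char (-1) z‖ ^ 2 * |z| ^ (-(1 + 2 * θ))) volume := by
      refine Measurable.aestronglyMeasurable ?_
      have : Measurable (char (-1)) := (continuous_char _).measurable
      fun_prop
    have hpos : IntegrableOn (fun z : ℝ => ‖1 - char (-1) z‖ ^ 2 * |z| ^ (-(1 + 2 * θ))) (Ioi 0) := by
      rw [← Ioc_union_Ioi_eq_Ioi zero_le_one]
      refine IntegrableOn.union ?_ ?_
      · have hb : IntegrableOn (fun z : ℝ => (2 * Real.pi) ^ 2 * z ^ (1 - 2 * θ)) (Ioc 0 1) := by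
          refine Integrable.const_mul ?_ _
          have := intervalIntegral.intervalIntegrable_rpow' (a := 0) (b := 1) (r := 1 - 2 * θ) (by linarith)
          exact (intervalIntegrable_iff_integrableOn_Ioc_of_le zero_le_one).1 this
        refine Integrable.mono' hb hm.restrict ?_
        rw [ae_restrict_iff' measurableSet_Ioc]
        refine ae_of_all _ fun z hz => ?_
        have hz0 : 0 < z := hz.1
        rw [Real.norm_of_nonneg (by positivity)]
        have := norm_one_sub_char_le z
        rw [abs_of_pos hz0] at this ⊢
        have e : z ^ (1 - 2 * θ) = z ^ 2 * z ^ (-(1 + 2 * θ)) := by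
          rw [← Real.rpow_natCast z 2, ← Real.rpow_add hz0]; congr 1; push_cast; ring
        rw [e, ← mul_assoc, ← mul_pow]
        gcongr
      · have hb : IntegrableOn (fun z : ℝ => 4 * z ^ (-(1 + 2 * θ))) (Ioi 1) :=
          (integrableOn_Ioi_rpow_of_lt (by linarith) one_pos).const_mul 4
        refine Integrable.mono' hb hm.restrict ?_
        rw [ae_restrict_iff' measurableSet_Ioi]
        refine ae_of_all _ fun z hz => ?_
        have hz0 : (0 : ℝ) < z := one_pos.trans hz
        rw [Real.norm_of_nonneg (by positivity), abs_of_pos hz0]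
        have h3 : ‖1 - char (-1) z‖ ≤ 2 := by
          refine (norm_sub_le _ _).trans ?_
          rw [norm_char, norm_one]; norm_num
        have h4 : ‖1 - char (-1) z‖ ^ 2 ≤ 4 := by nlinarith [norm_nonneg (1 - char (-1) z)]
        exact mul_le_mul_of_nonneg_right h4 (by positivity)
    have heven : ∀ z : ℝ, ‖1 - char (-1) (-z)‖ ^ 2 * |-z| ^ (-(1 + 2 * θ))
        = ‖1 - char (-1) z‖ ^ 2 * |z| ^ (-(1 + 2 * θ)) := by
      intro z
      have : 1 - char (-1) (-z) = (starRingEnd ℂ) (1 - char (-1) z) := by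
        rw [map_sub, map_one, conj_char]
        unfold char; push_cast; ring_nf
      rw [this, Complex.norm_conj, abs_neg]
    have hneg := ((Measure.measurePreserving_neg (volume : Measure ℝ)).integrableOn_comp_preimage
      (MeasurableEquiv.neg ℝ).measurableEmbedding).2 hpos
    have hset : (Neg.neg : ℝ → ℝ) ⁻¹' Ioi 0 = Iio 0 := by ext; simp
    simp only [Function.comp_def, heven, hset] at hneg
    rw [← integrableOn_univ, ← Iic_union_Ioi (a := (0 : ℝ))]
    refine IntegrableOn.union ?_ hpos
    rw [integrableOn_Iic_iff_integrableOn_Iio]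
    exact hneg
  exact hI.lintegral_lt_top

/-- Positivity, with finiteness, allows this constant to be cancelled when passing between the
double integral and the Fourier seminorm. -/
lemma gagliardoConst_pos (θ : ℝ) : 0 < gagliardoConst θ := by
  unfold gagliardoConst
  have hm : Measurable fun z : ℝ => ENNReal.ofReal (‖1 - char (-1) z‖ ^ 2 * |z| ^ (-(1 + 2 * θ))) := by
    have : Measurable (char (-1)) := (continuous_char _).measurable
    fun_prop
  rw [lintegral_pos_iff_support hm]
  have hsub : Ioo (0 : ℝ) 1 ⊆ Function.support
      (fun z : ℝ => ENNReal.ofReal (‖1 - char (-1) z‖ ^ 2 * |z| ^ (-(1 + 2 * θ)))) := by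
    intro z hz
    have hz0 : (0 : ℝ) < |z| := abs_pos.2 hz.1.ne'
    have hne : 1 - char (-1) z ≠ 0 := by
      rw [sub_ne_zero]
      intro h
      unfold char at h
      have h2 := Complex.exp_eq_one_iff.1 h.symm
      obtain ⟨n, hn⟩ := h2
      have h3 := congrArg Complex.im hn
      simp at h3
      have h4 : z = n := by
        have := Real.pi_pos
        have h5 : (2 * Real.pi) * z = (2 * Real.pi) * n := by linarith
        exact mul_left_cancel₀ (by positivity) h5
      have h6 := hz.1
      have h7 := hz.2
      rw [h4] at h6 h7
      have h8 : 0 < n := by exact_mod_cast h6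
      have h9 : n < 1 := by exact_mod_cast h7
      omega
    simp only [Function.mem_support, ne_eq, ENNReal.ofReal_eq_zero, not_le]
    have : 0 < ‖1 - char (-1) z‖ := norm_pos_iff.2 hne
    positivity
  refine lt_of_lt_of_le ?_ (measure_mono hsub)
  simp

lemma lintegral_comp_mul_left_real (G : ℝ → ENNReal) {a : ℝ} (ha : a ≠ 0) :
    ∫⁻ z, G (a * z) = ENNReal.ofReal |a⁻¹| * ∫⁻ z, G z := by
  have := (Homeomorph.mulLeft₀ a ha).toMeasurableEquiv.measurableEmbedding.lintegral_map G (μ := volume)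
  have h2 : ∫⁻ z, G z ∂(Measure.map (fun x => a * x) volume) = ∫⁻ z, G (a * z) := this
  rw [← h2, Real.map_volume_mul_left ha, lintegral_smul_measure, smul_eq_mul]

lemma char_scale (n : ℤ) (z : ℝ) : char (-n) z = char (-1) (n * z) := by
  unfold char; push_cast; ring_nf

/-- The scaling `z ↦ nz` extracts the power `|n|^{2θ}` and leaves the universal constant. -/
lemma lintegral_char_weight (θ : ℝ) {n : ℤ} (hn : n ≠ 0) :
    ∫⁻ z : ℝ, ENNReal.ofReal (‖1 - char (-n) z‖ ^ 2 * |z| ^ (-(1 + 2 * θ)))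
      = ENNReal.ofReal (|(n : ℝ)| ^ (2 * θ)) * gagliardoConst θ := by
  have hn' : (n : ℝ) ≠ 0 := by exact_mod_cast hn
  have hn0 : 0 < |(n : ℝ)| := abs_pos.2 hn'
  have e : ∀ z : ℝ, ENNReal.ofReal (‖1 - char (-n) z‖ ^ 2 * |z| ^ (-(1 + 2 * θ)))
      = ENNReal.ofReal (|(n : ℝ)| ^ (1 + 2 * θ)) *
        ENNReal.ofReal (‖1 - char (-1) (n * z)‖ ^ 2 * |n * z| ^ (-(1 + 2 * θ))) := by
    intro z
    rw [← ENNReal.ofReal_mul (by positivity), char_scale, abs_mul,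
      Real.mul_rpow (abs_nonneg _) (abs_nonneg _), Real.rpow_neg hn0.le]
    congr 1
    have : |(n : ℝ)| ^ (1 + 2 * θ) ≠ 0 := by positivity
    field_simp
  simp only [e]
  rw [lintegral_const_mul' _ _ ENNReal.ofReal_ne_top,
    lintegral_comp_mul_left_real (fun z => ENNReal.ofReal (‖1 - char (-1) z‖ ^ 2 * |z| ^ (-(1 + 2 * θ)))) hn',
    ← mul_assoc, ← ENNReal.ofReal_mul (by positivity), abs_inv, ← Real.rpow_neg_one, ← Real.rpow_add hn0]
  congr 3
  ring

lemma fourierC_translate {f : ℝ → ℝ} (hp : Function.Periodic f 1) (z : ℝ) (n : ℤ) :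
    fourierC (fun x => f (x + z)) n = char (-n) z * fourierC f n := by
  rw [fourierC_eq_integral, fourierC_eq_integral, ← intervalIntegral.integral_const_mul]
  have h1 : ∀ x, char n x * (f (x + z) : ℂ) = (fun y => char (-n) z * (char n y * (f y : ℂ))) (x + z) := by
    intro x
    simp only
    have : char n x = char (-n) z * char n (x + z) := by
      unfold char
      rw [← Complex.exp_add]
      congr 1; push_cast; ring
    rw [this]; ring
  simp only [h1]
  rw [intervalIntegral.integral_comp_add_right (fun y => char (-n) z * (char n y * (f y : ℂ))) z]
  have hper : Function.Periodic (fun y => char (-n) z * (char n y * (f y : ℂ))) 1 := by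
    intro y
    have : char n (y + 1) = char n y := by
      unfold char
      have e : (((-(2 * Real.pi * n * (y + 1)) : ℝ) : ℂ) * Complex.I)
          = ((-(2 * Real.pi * n * y) : ℝ) : ℂ) * Complex.I + ((-n : ℤ) : ℂ) * (2 * Real.pi * Complex.I) := by
        push_cast; ring
      rw [e, Complex.exp_add, Complex.exp_int_mul_two_pi_mul_I, mul_one]
    simp only [this, hp y]
  have := hper.intervalIntegral_add_eq z 0
  simp only [zero_add] at this ⊢
  rw [add_comm 1 z, this]

lemma aemeasurable_of_periodic {f : ℝ → ℝ} (hp : Function.Periodic f 1)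
    (hf : MemLp f 2 (volume.restrict (Ioc 0 1))) : AEMeasurable f volume := by
  have h := (memH_zero_of hp hf).intervalIntegrable'
  have h2 : LocallyIntegrable f volume := by
    intro x
    have := h (x - 1) (x + 1)
    rw [intervalIntegrable_iff_integrableOn_Ioo_of_le (by linarith)] at this
    exact ⟨Ioo (x - 1) (x + 1), Ioo_mem_nhds (by linarith) (by linarith), this⟩
  exact h2.aestronglyMeasurable.aemeasurable

lemma memLp_translate {f : ℝ → ℝ} (hp : Function.Periodic f 1)
    (hf : MemLp f 2 (volume.restrict (Ioc 0 1))) (z : ℝ) :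
    MemLp (fun x => f (x + z)) 2 (volume.restrict (Ioc 0 1)) := by
  have hp2 : Function.Periodic (fun x => f x ^ 2) 1 := fun x => by simp only [hp x]
  have h2 : ∀ a b, IntervalIntegrable (fun x => f x ^ 2) volume a b := by
    refine hp2.intervalIntegrable (t := 0) one_ne_zero ?_
    rw [intervalIntegrable_iff_integrableOn_Ioc_of_le (by linarith), zero_add]
    exact hf.integrable_sq
  have hm : AEStronglyMeasurable (fun x => f (x + z)) volume :=
    ((aemeasurable_of_periodic hp hf).comp_quasiMeasurePreserving
      (measurePreserving_add_right volume z).quasiMeasurePreserving).aestronglyMeasurable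
  rw [memLp_two_iff_integrable_sq hm.restrict]
  have := (h2 (0 + z) (1 + z)).comp_add_right z
  simp only [add_sub_cancel_right] at this
  exact this.1

/-- Substitute `y = x + z` and exchange the integrals. For fixed `z`, Parseval applies to `f - f(· +
z)`, whose coefficients are `(1 - e^{2πinz}) f̂(n)`; integrating each mode over `z` gives
`lintegral_char_weight`. The identity lives in `[0,∞]`, so it also decides whether `f` has order
`θ`. -/
theorem gagliardo_eq {θ : ℝ} (hθ : 0 < θ) {f : ℝ → ℝ} (hp : Function.Periodic f 1)
    (hf : MemLp f 2 (volume.restrict (Ioc 0 1))) :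
    gagliardo θ f = gagliardoConst θ * ∑' n : ℤ, ENNReal.ofReal (|(n : ℝ)| ^ (2 * θ) * ‖fourierC f n‖ ^ 2) := by
  have hfm := aemeasurable_of_periodic hp hf
  set W : ℝ → ℝ := fun z => |z| ^ (-(1 + 2 * θ)) with hW
  have hWm : Measurable W := by fun_prop
  have hW0 : ∀ z, 0 ≤ W z := fun z => by positivity
  have step1 : gagliardo θ f = ∫⁻ x in Ioc (0 : ℝ) 1, ∫⁻ z, ENNReal.ofReal (|f x - f (x + z)| ^ 2 * W z) := by
    unfold gagliardo
    congr 1; ext x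
    rw [← lintegral_add_left_eq_self _ x]
    congr 1; ext z
    have : x - (x + z) = -z := by ring
    rw [this, abs_neg]
  have hmeas : AEMeasurable (Function.uncurry fun x z => ENNReal.ofReal (|f x - f (x + z)| ^ 2 * W z))
      ((volume.restrict (Ioc 0 1)).prod volume) := by
    have h1 : AEMeasurable (fun p : ℝ × ℝ => f p.1) ((volume.restrict (Ioc 0 1)).prod volume) :=
      hfm.restrict.comp_fst
    have h2 : AEMeasurable (fun p : ℝ × ℝ => f (p.1 + p.2)) ((volume.restrict (Ioc 0 1)).prod volume) := by
      have h3 : AEMeasurable (fun p : ℝ × ℝ => f p.2) ((volume.restrict (Ioc 0 1)).prod volume) :=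
        hfm.comp_snd
      exact h3.comp_quasiMeasurePreserving
        (measurePreserving_prod_add (volume.restrict (Ioc (0 : ℝ) 1)) volume).quasiMeasurePreserving
    have h4 : AEMeasurable (fun p : ℝ × ℝ => W p.2) ((volume.restrict (Ioc 0 1)).prod volume) :=
      (hWm.comp measurable_snd).aemeasurable
    have h5 : AEMeasurable (fun p : ℝ × ℝ => |f p.1 - f (p.1 + p.2)|) ((volume.restrict (Ioc 0 1)).prod volume) :=
      continuous_abs.measurable.comp_aemeasurable (h1.sub h2)
    exact ((h5.pow_const 2).mul h4).ennreal_ofReal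
  rw [step1, lintegral_lintegral_swap hmeas]
  have step2 : ∀ z : ℝ, ∫⁻ x in Ioc (0 : ℝ) 1, ENNReal.ofReal (|f x - f (x + z)| ^ 2 * W z)
      = ∑' n : ℤ, ENNReal.ofReal (‖fourierC f n‖ ^ 2) * ENNReal.ofReal (‖1 - char (-n) z‖ ^ 2 * W z) := by
    intro z
    have hm := hf.sub (memLp_translate hp hf z)
    have hint : IntegrableOn (fun x => (f x - f (x + z)) ^ 2) (Ioc 0 1) volume := hm.integrable_sq
    have h1 := hasSum_sq_fourierC hm
    have h2 : ∀ n, ‖fourierC (f - fun x => f (x + z)) n‖ ^ 2 = ‖fourierC f n‖ ^ 2 * ‖1 - char (-n) z‖ ^ 2 := by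
      intro n
      have : fourierC (f - fun x => f (x + z)) n = fourierC f n - fourierC (fun x => f (x + z)) n :=
        fourierC_sub (MemLp.intervalIntegrable_unit hf) (MemLp.intervalIntegrable_unit (memLp_translate hp hf z)) n
      rw [this, fourierC_translate hp, ← mul_pow, ← norm_mul]
      congr 2; ring
    simp only [h2, Pi.sub_apply] at h1
    have h3 := h1.mul_right (W z)
    have h4 : ∀ x, |f x - f (x + z)| ^ 2 * W z = (f x - f (x + z)) ^ 2 * W z := fun x => by rw [sq_abs]
    simp only [h4]
    rw [← ofReal_integral_eq_lintegral_ofReal (hint.mul_const _)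
      (ae_of_all _ fun x => mul_nonneg (sq_nonneg _) (hW0 z)), integral_mul_const,
      ← intervalIntegral.integral_of_le zero_le_one, ← h3.tsum_eq,
      ENNReal.ofReal_tsum_of_nonneg (fun n => mul_nonneg (by positivity) (hW0 z)) h3.summable]
    congr 1; ext n
    rw [← ENNReal.ofReal_mul (by positivity), mul_assoc]
  simp only [step2]
  rw [lintegral_tsum, ← ENNReal.tsum_mul_left]
  · congr 1; ext n
    rw [lintegral_const_mul' _ _ ENNReal.ofReal_ne_top]
    by_cases hn : n = 0
    · subst hn
      have : ∀ z, char (-0) z = 1 := fun z => by simp [char]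
      simp only [this, sub_self, norm_zero, ne_eq, OfNat.ofNat_ne_zero, not_false_eq_true, zero_pow, zero_mul,
        ENNReal.ofReal_zero, lintegral_const, mul_zero, Int.cast_zero, abs_zero]
      rw [Real.zero_rpow (by positivity)]; simp
    · rw [lintegral_char_weight θ hn, ENNReal.ofReal_mul (by positivity)]
      ring
  · intro n
    have : Measurable (char (-n)) := (continuous_char _).measurable
    exact Measurable.aemeasurable (by fun_prop)

/-- The homogeneous squared seminorm of order `θ`. -/
def semiSq (θ : ℝ) (f : ℝ → ℝ) : ℝ := ∑' n : ℤ, |(n : ℝ)| ^ (2 * θ) * ‖fourierC f n‖ ^ 2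

lemma abs_rpow_le_weight {θ : ℝ} (h0 : 0 ≤ θ) (n : ℤ) : |(n : ℝ)| ^ (2 * θ) ≤ (1 + (n : ℝ) ^ 2) ^ θ := by
  rw [Real.rpow_mul (abs_nonneg _), Real.rpow_two, sq_abs]
  exact Real.rpow_le_rpow (by positivity) (by linarith) h0

lemma weight_le {θ : ℝ} (h0 : 0 ≤ θ) (h1 : θ ≤ 1) (n : ℤ) :
    (1 + (n : ℝ) ^ 2) ^ θ ≤ 1 + |(n : ℝ)| ^ (2 * θ) := by
  rw [Real.rpow_mul (abs_nonneg _), Real.rpow_two, sq_abs]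
  have := Real.rpow_add_le_add_rpow (zero_le_one' ℝ) (sq_nonneg (n : ℝ)) h0 h1
  simpa using this

lemma semiSq_nonneg (θ : ℝ) (f : ℝ → ℝ) : 0 ≤ semiSq θ f := tsum_nonneg fun n => by positivity

lemma MemH.summable_semi {θ : ℝ} (h0 : 0 ≤ θ) {f : ℝ → ℝ} (hf : MemH θ f) :
    Summable fun n : ℤ => |(n : ℝ)| ^ (2 * θ) * ‖fourierC f n‖ ^ 2 :=
  Summable.of_nonneg_of_le (fun n => by positivity)
    (fun n => mul_le_mul_of_nonneg_right (abs_rpow_le_weight h0 n) (by positivity)) hf.summable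

lemma MemH.semiSq_le {θ : ℝ} (h0 : 0 ≤ θ) {f : ℝ → ℝ} (hf : MemH θ f) : semiSq θ f ≤ normSq θ f :=
  (hf.summable_semi h0).tsum_le_tsum
    (fun n => mul_le_mul_of_nonneg_right (abs_rpow_le_weight h0 n) (by positivity)) hf.summable

lemma summable_weight_of_semi {θ : ℝ} (h0 : 0 ≤ θ) (h1 : θ ≤ 1) {f : ℝ → ℝ}
    (hf : MemLp f 2 (volume.restrict (Ioc 0 1)))
    (hs : Summable fun n : ℤ => |(n : ℝ)| ^ (2 * θ) * ‖fourierC f n‖ ^ 2) :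
    (Summable fun n : ℤ => (1 + (n : ℝ) ^ 2) ^ θ * ‖fourierC f n‖ ^ 2) ∧
      normSq θ f ≤ normSq 0 f + semiSq θ f := by
  have h2 : ∀ n : ℤ, (1 + (n : ℝ) ^ 2) ^ θ * ‖fourierC f n‖ ^ 2
      ≤ ‖fourierC f n‖ ^ 2 + |(n : ℝ)| ^ (2 * θ) * ‖fourierC f n‖ ^ 2 := fun n => by
    have := mul_le_mul_of_nonneg_right (weight_le h0 h1 n) (sq_nonneg ‖fourierC f n‖)
    linarith
  have hL := (hasSum_sq_fourierC hf).summable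
  have hsum := Summable.of_nonneg_of_le (fun n => by positivity) h2 (hL.add hs)
  refine ⟨hsum, ?_⟩
  have := hsum.tsum_le_tsum h2 (hL.add hs)
  rw [hL.tsum_add hs] at this
  simpa [normSq, semiSq] using this

section
variable {θ : ℝ}

lemma gagliardo_eq_semiSq (h0 : 0 < θ) {f : ℝ → ℝ} (hp : Function.Periodic f 1)
    (hf : MemLp f 2 (volume.restrict (Ioc 0 1)))
    (hs : Summable fun n : ℤ => |(n : ℝ)| ^ (2 * θ) * ‖fourierC f n‖ ^ 2) :
    gagliardo θ f = gagliardoConst θ * ENNReal.ofReal (semiSq θ f) := by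
  rw [gagliardo_eq h0 hp hf, semiSq, ENNReal.ofReal_tsum_of_nonneg (fun n => by positivity) hs]

lemma summable_semi_of_gagliardo (h0 : 0 < θ) {f : ℝ → ℝ} (hp : Function.Periodic f 1)
    (hf : MemLp f 2 (volume.restrict (Ioc 0 1))) (hg : gagliardo θ f < ⊤) :
    Summable fun n : ℤ => |(n : ℝ)| ^ (2 * θ) * ‖fourierC f n‖ ^ 2 := by
  rw [gagliardo_eq h0 hp hf] at hg
  have h1 := (ENNReal.mul_lt_top_iff.1 hg)
  have hne := (gagliardoConst_pos θ).ne'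
  have h2 : ∑' n : ℤ, ENNReal.ofReal (|(n : ℝ)| ^ (2 * θ) * ‖fourierC f n‖ ^ 2) ≠ ⊤ := by
    rcases h1 with h | h | h
    · exact h.2.ne
    · exact absurd h hne
    · rw [h]; exact ENNReal.zero_ne_top
  have h3 := ENNReal.summable_toReal h2
  refine h3.congr fun n => ENNReal.toReal_ofReal (by positivity)

lemma lintegral_comp_primF {d ψ : ℝ → ℝ} (h : CircleChange d ψ) (G : ℝ → ENNReal) :
    ∫⁻ y, G y = ∫⁻ b, ENNReal.ofReal (d b) * G (primF d b) := by
  have := lintegral_image_eq_lintegral_abs_deriv_mul (s := univ) (f := primF d) (f' := d) MeasurableSet.univ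
    (fun x _ => (hasDerivAt_primF h.cont x).hasDerivWithinAt) h.strictMono.injective.injOn G
  rw [image_univ, (Function.RightInverse.surjective h.right).range_eq] at this
  simpa [abs_of_pos (h.pos _)] using this

lemma lintegral_comp_primF_Ioc {d ψ : ℝ → ℝ} (h : CircleChange d ψ) (G : ℝ → ENNReal) :
    ∫⁻ y in Ioc 0 1, G y = ∫⁻ b in Ioc 0 1, ENNReal.ofReal (d b) * G (primF d b) := by
  have := lintegral_image_eq_lintegral_abs_deriv_mul (s := Ioc 0 1) (f := primF d) (f' := d) measurableSet_Ioc
    (fun x _ => (hasDerivAt_primF h.cont x).hasDerivWithinAt) h.strictMono.injective.injOn G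
  have himg : primF d '' Ioc 0 1 = Ioc 0 1 := by
    ext x
    constructor
    · rintro ⟨y, hy, rfl⟩
      constructor
      · rw [← primF_zero d]; exact h.strictMono hy.1
      · rw [← h.one]; exact h.strictMono.monotone hy.2
    · intro hx
      refine ⟨ψ x, ⟨?_, ?_⟩, h.right x⟩
      · rw [← h.inv_zero]; exact h.inv_strictMono hx.1
      · have : ψ 1 = 1 := by have := h.left 1; rwa [h.one] at this
        rw [← this]; exact h.inv_strictMono.monotone hx.2
  rw [himg] at this
  simpa [abs_of_pos (h.pos _)] using this

/-- The Gagliardo kernel in the new variables. -/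
def kernel (θ : ℝ) (d : ℝ → ℝ) (a b : ℝ) : ℝ :=
  d a * d b * |primF d a - primF d b| ^ (-(1 + 2 * θ))

/-- The diffeomorphism moves into the kernel and leaves `f` untouched, which is what makes
domination and pointwise limits available for rough `f`. -/
lemma gagliardo_comp {d ψ : ℝ → ℝ} (h : CircleChange d ψ) (f : ℝ → ℝ) :
    gagliardo θ (fun x => f (ψ x)) =
      ∫⁻ a in Ioc (0 : ℝ) 1, ∫⁻ b, ENNReal.ofReal (|f a - f b| ^ 2 * kernel θ d a b) := by
  unfold gagliardo
  rw [lintegral_comp_primF_Ioc h]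
  congr 1; ext a
  rw [lintegral_comp_primF h, ← lintegral_const_mul' _ _ ENNReal.ofReal_ne_top]
  congr 1; ext b
  rw [← ENNReal.ofReal_mul (h.pos b).le, ← ENNReal.ofReal_mul (h.pos a).le]
  simp only [h.left]
  unfold kernel
  congr 1; ring

lemma abs_primF_sub_ge {d ψ : ℝ → ℝ} (h : CircleChange d ψ) {m : ℝ} (hm : ∀ x, m ≤ d x) (a b : ℝ) :
    m * |a - b| ≤ |primF d a - primF d b| := by
  wlog hab : b ≤ a generalizing a b
  · rw [abs_sub_comm, abs_sub_comm (primF d a)]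
    exact this b a (le_of_not_ge hab)
  rw [abs_of_nonneg (sub_nonneg.2 hab), h.isPrim.sub_eq]
  refine le_trans ?_ (le_abs_self _)
  have := intervalIntegral.integral_mono_on hab (continuous_const.intervalIntegrable b a)
    (h.cont.intervalIntegrable b a) (f := fun _ => m) (μ := volume) (fun x _ => hm x)
  simpa [mul_comm] using this

lemma kernel_le (h0 : 0 < θ) {d ψ : ℝ → ℝ} (h : CircleChange d ψ) {m M : ℝ} (hm0 : 0 < m) (hm : ∀ x, m ≤ d x)
    (hM : ∀ x, d x ≤ M) (a b : ℝ) :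
    kernel θ d a b ≤ M ^ 2 * m ^ (-(1 + 2 * θ)) * |a - b| ^ (-(1 + 2 * θ)) := by
  have hM0 : 0 < M := hm0.trans_le ((hm 0).trans (hM 0))
  have hne : -(1 + 2 * θ) ≠ 0 := by linarith
  unfold kernel
  -- On the diagonal both sides vanish, by the convention `0 ^ x = 0` for nonzero real exponents.
  by_cases hab : a = b
  · rw [hab, sub_self, sub_self, abs_zero, Real.zero_rpow hne, mul_zero, mul_zero]
  have hab' : 0 < |a - b| := abs_pos.2 (sub_ne_zero.2 hab)
  have h1 : |primF d a - primF d b| ^ (-(1 + 2 * θ)) ≤ (m * |a - b|) ^ (-(1 + 2 * θ)) :=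
    Real.rpow_le_rpow_of_nonpos (by positivity) (abs_primF_sub_ge h hm a b) (by linarith)
  rw [Real.mul_rpow hm0.le hab'.le] at h1
  rw [mul_assoc (M ^ 2), pow_two]
  exact mul_le_mul (mul_le_mul (hM a) (hM b) (h.pos b).le hM0.le) h1 (by positivity) (mul_pos hM0 hM0).le

lemma gagliardo_comp_le (h0 : 0 < θ) {d ψ : ℝ → ℝ} (h : CircleChange d ψ) {m M : ℝ} (hm0 : 0 < m)
    (hm : ∀ x, m ≤ d x) (hM : ∀ x, d x ≤ M) (f : ℝ → ℝ) :
    gagliardo θ (fun x => f (ψ x)) ≤ ENNReal.ofReal (M ^ 2 * m ^ (-(1 + 2 * θ))) * gagliardo θ f := by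
  rw [gagliardo_comp h, gagliardo, ← lintegral_const_mul' _ _ ENNReal.ofReal_ne_top]
  refine lintegral_mono fun a => ?_
  rw [← lintegral_const_mul' _ _ ENNReal.ofReal_ne_top]
  refine lintegral_mono fun b => ?_
  rw [← ENNReal.ofReal_mul (by positivity)]
  refine ENNReal.ofReal_le_ofReal ?_
  have := mul_le_mul_of_nonneg_left (kernel_le h0 h hm0 hm hM a b) (sq_nonneg |f a - f b|)
  linarith

lemma normSq_zero_comp_le {d ψ : ℝ → ℝ} (h : CircleChange d ψ) {M : ℝ} (hM : ∀ x, d x ≤ M) {f : ℝ → ℝ}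
    (hp : Function.Periodic f 1) (hf : MemLp f 2 (volume.restrict (Ioc 0 1))) :
    normSq 0 (fun x => f (ψ x)) ≤ M * normSq 0 f := by
  rw [normSq_zero_eq (h.memLp_comp hp hf), normSq_zero_eq hf, h.integral_comp_unit (fun x => f x ^ 2),
    ← intervalIntegral.integral_const_mul]
  have hi : IntervalIntegrable (fun x => f x ^ 2) volume 0 1 := by
    rw [intervalIntegrable_iff_integrableOn_Ioc_of_le zero_le_one]; exact hf.integrable_sq
  refine intervalIntegral.integral_mono_on zero_le_one (hi.mul_continuousOn h.cont.continuousOn)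
    (hi.const_mul _) fun x _ => ?_
  rw [mul_comm]
  exact mul_le_mul_of_nonneg_right (hM x) (sq_nonneg _)

/-- The constant depends on the diffeomorphism only through the bounds `m` and `M` of its
derivative, so it is uniform along a convergent family. -/
lemma memH_comp (h0 : 0 ≤ θ) (h1 : θ < 1) {m M : ℝ} (hm0 : 0 < m) :
    ∃ C, 0 ≤ C ∧ ∀ d ψ f : ℝ → ℝ, CircleChange d ψ → (∀ x, m ≤ d x) → (∀ x, d x ≤ M) → MemH θ f →
      MemH θ (fun x => f (ψ x)) ∧ normSq θ (fun x => f (ψ x)) ≤ C * normSq θ f := by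
  rcases h0.eq_or_lt with rfl | h0
  · refine ⟨|M|, abs_nonneg _, fun d ψ f h _ hM hf => ⟨memH_zero_of (h.periodic_comp hf.periodic)
      (h.memLp_comp hf.periodic hf.memLp), ?_⟩⟩
    refine (normSq_zero_comp_le h hM hf.periodic hf.memLp).trans ?_
    exact mul_le_mul_of_nonneg_right (le_abs_self M) (normSq_nonneg _ _)
  · set K := M ^ 2 * m ^ (-(1 + 2 * θ)) with hK
    have hK0 : 0 ≤ K := by positivity
    refine ⟨|M| + K, by positivity, fun d ψ f h hm hM hf => ?_⟩
    have hp := h.periodic_comp hf.periodic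
    have hL := h.memLp_comp hf.periodic hf.memLp
    have hs := hf.summable_semi h0.le
    have hCtop := gagliardoConst_lt_top h0 h1
    have hg := gagliardo_comp_le h0 h hm0 hm hM f
    rw [gagliardo_eq_semiSq h0 hf.periodic hf.memLp hs] at hg
    have hs' := summable_semi_of_gagliardo h0 hp hL (hg.trans_lt
      (ENNReal.mul_lt_top ENNReal.ofReal_lt_top (ENNReal.mul_lt_top hCtop ENNReal.ofReal_lt_top)))
    rw [gagliardo_eq_semiSq h0 hp hL hs', ← mul_assoc, mul_comm (ENNReal.ofReal _) (gagliardoConst θ),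
      mul_assoc, ← ENNReal.ofReal_mul hK0, ENNReal.mul_le_mul_iff_right (gagliardoConst_pos θ).ne' hCtop.ne,
      ENNReal.ofReal_le_ofReal_iff (mul_nonneg hK0 (semiSq_nonneg _ _))] at hg
    obtain ⟨w1, w2⟩ := summable_weight_of_semi h0.le h1.le hL hs'
    refine ⟨⟨hp, hL, w1, fun hc => (hf.continuous hc).comp h.inv_continuous⟩, ?_⟩
    have e1 := normSq_zero_comp_le h hM hf.periodic hf.memLp
    have e2 := normSq_mono hf h0.le
    have e3 := hf.semiSq_le h0.le
    have e4 := mul_le_mul_of_nonneg_left e3 hK0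
    have e5 := mul_le_mul_of_nonneg_left e2 (abs_nonneg M)
    have e6 := mul_le_mul_of_nonneg_right (le_abs_self M) (normSq_nonneg 0 f)
    linarith

/-- After the substitution the diffeomorphism appears only in its derivative and inside a smooth
character. Limits and time derivatives can therefore be taken with no regularity of `f`. -/
lemma fourierC_comp {d ψ : ℝ → ℝ} (h : CircleChange d ψ) (f : ℝ → ℝ) (n : ℤ) :
    fourierC (fun x => f (ψ x)) n = ∫ y in (0 : ℝ)..1, (d y : ℂ) * (char n (primF d y) * (f y : ℂ)) := by
  rw [fourierC_eq_integral]
  have := intervalIntegral.integral_deriv_smul_comp_of_deriv_nonneg (a := 0) (b := 1) (f := primF d)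
    (f' := d) (g := fun x => char n x * (f (ψ x) : ℂ)) h.isPrim.continuous.continuousOn
    (fun x _ => hasDerivAt_primF h.cont x) (fun x _ => (h.pos x).le)
  rw [primF_zero, h.one] at this
  rw [← this]
  simp [h.left]

variable {ι : Type*} {l : Filter ι} {D Ψ : ι → ℝ → ℝ} {δ ψ : ℝ → ℝ}

lemma tendsto_primF (hD : TendstoUniformly D δ l) (hDc : ∀ᶠ i in l, Continuous (D i)) (hδ : Continuous δ)
    (x : ℝ) : Tendsto (fun i => primF (D i) x) l (𝓝 (primF δ x)) := by
  rw [Metric.tendsto_nhds]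
  intro ε hε
  filter_upwards [hDc, Metric.tendstoUniformly_iff.1 hD (ε / (|x| + 1)) (by positivity)] with i i1 i2
  rw [Real.dist_eq]
  unfold primF
  rw [← intervalIntegral.integral_sub (i1.intervalIntegrable _ _) (hδ.intervalIntegrable _ _)]
  have := intervalIntegral.norm_integral_le_of_norm_le_const (a := 0) (b := x)
    (f := fun y => D i y - δ y) (C := ε / (|x| + 1)) (fun y _ => by
      have := i2 y
      rw [dist_comm, Real.dist_eq] at this
      exact this.le)
  rw [Real.norm_eq_abs, sub_zero] at this
  refine this.trans_lt ?_
  rw [div_mul_eq_mul_div, div_lt_iff₀ (by positivity)]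
  nlinarith [abs_nonneg x]

/-- Fourier coefficients, `L²` norms and, for `θ > 0`, Gagliardo integrals of `f∘Ψ i` all converge
by dominated convergence, so `tendsto_tsum_sub_of_tendsto` upgrades the weak convergence to
convergence in norm. -/
theorem tendH_comp_fixed [l.IsCountablyGenerated] (h0 : 0 ≤ θ) (h1 : θ < 1) (hD : TendstoUniformly D δ l)
    (hDΨ : ∀ᶠ i in l, CircleChange (D i) (Ψ i)) (hδ : CircleChange δ ψ) {f : ℝ → ℝ} (hf : MemH θ f) :
    TendH θ l (fun i x => f (Ψ i x)) (fun x => f (ψ x)) := by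
  obtain ⟨m, hm, hmδ⟩ := exists_pos_le_of_periodic hδ.cont hδ.per hδ.pos
  obtain ⟨M, hM, hMδ⟩ := bounded_of_periodic hδ.cont hδ.per
  have em := tendstoUniformly_eventually_le hD hm hmδ
  have eM : ∀ᶠ i in l, ∀ x, D i x ≤ M + 1 := by
    filter_upwards [tendstoUniformly_eventually_abs_le hD hMδ] with i hi x using (le_abs_self _).trans (hi x)
  obtain ⟨C, -, hC⟩ := memH_comp h0 h1 (m := m / 2) (M := M + 1) (by positivity)
  have hmem : ∀ᶠ i in l, MemH θ (fun x => f (Ψ i x)) := by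
    filter_upwards [hDΨ, em, eM] with i i1 i2 i3 using (hC _ _ f i1 i2 i3 hf).1
  have hmem0 : MemH θ (fun x => f (ψ x)) :=
    (hC _ _ f hδ (fun x => by linarith [hmδ x]) (fun x => by linarith [le_abs_self (δ x), hMδ x]) hf).1
  have hDc : ∀ᶠ i in l, Continuous (D i) := by filter_upwards [hDΨ] with i hi using hi.cont
  have hP := tendsto_primF hD hDc hδ.cont
  -- the Fourier coefficients converge
  have hcoef : ∀ n, Tendsto (fun i => fourierC (fun x => f (Ψ i x)) n) l (𝓝 (fourierC (fun x => f (ψ x)) n)) := by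
    intro n
    rw [fourierC_comp hδ]
    have key := intervalIntegral.tendsto_integral_filter_of_dominated_convergence (μ := volume) (a := 0) (b := 1)
      (l := l) (F := fun i y => (D i y : ℂ) * (char n (primF (D i) y) * (f y : ℂ)))
      (f := fun y => (δ y : ℂ) * (char n (primF δ y) * (f y : ℂ))) (fun y => (M + 1) * |f y|)
      (by
        filter_upwards [hDΨ] with i i1
        have h2 : AEStronglyMeasurable (fun y => (f y : ℂ)) (volume.restrict (uIoc 0 1)) := by
          have := hf.intervalIntegrable
          rw [intervalIntegrable_iff] at this
          exact Complex.continuous_ofReal.comp_aestronglyMeasurable this.aestronglyMeasurable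
        have h3 : Continuous fun y => (D i y : ℂ) := Complex.continuous_ofReal.comp i1.cont
        have h4 : Continuous fun y => char n (primF (D i) y) := (continuous_char n).comp i1.isPrim.continuous
        exact h3.aestronglyMeasurable.mul (h4.aestronglyMeasurable.mul h2))
      (by
        filter_upwards [hDΨ, eM] with i i1 i2
        refine ae_of_all _ fun y _ => ?_
        rw [norm_mul, norm_mul, norm_char, one_mul, Complex.norm_real, Complex.norm_real,
          Real.norm_of_nonneg (i1.pos y).le, Real.norm_eq_abs]
        exact mul_le_mul_of_nonneg_right (i2 y) (abs_nonneg _))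
      (hf.intervalIntegrable.abs.const_mul _)
      (ae_of_all _ fun y _ => by
        have h2 : Tendsto (fun i => (D i y : ℂ)) l (𝓝 (δ y : ℂ)) :=
          (Complex.continuous_ofReal.tendsto _).comp (hD.tendsto_at y)
        have h3 : Tendsto (fun i => char n (primF (D i) y)) l (𝓝 (char n (primF δ y))) :=
          ((continuous_char n).tendsto _).comp (hP y)
        exact h2.mul (h3.mul_const _))
    refine key.congr' ?_
    filter_upwards [hDΨ] with i i1
    rw [fourierC_comp i1]
  have hi2 : IntervalIntegrable (fun x => f x ^ 2) volume 0 1 := by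
    rw [intervalIntegrable_iff_integrableOn_Ioc_of_le zero_le_one]; exact hf.memLp.integrable_sq
  -- the `L²` norms converge
  have hL2 : Tendsto (fun i => normSq 0 (fun x => f (Ψ i x))) l (𝓝 (normSq 0 (fun x => f (ψ x)))) := by
    rw [normSq_zero_eq hmem0.memLp, hδ.integral_comp_unit (fun x => f x ^ 2)]
    have key := intervalIntegral.tendsto_integral_filter_of_dominated_convergence (μ := volume) (a := 0) (b := 1)
      (l := l) (F := fun i y => f y ^ 2 * D i y)
      (f := fun y => f y ^ 2 * δ y) (fun y => f y ^ 2 * (M + 1))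
      (by
        filter_upwards [hDΨ] with i i1
        rw [intervalIntegrable_iff] at hi2
        exact hi2.aestronglyMeasurable.mul i1.cont.aestronglyMeasurable)
      (by
        filter_upwards [hDΨ, eM] with i i1 i2
        refine ae_of_all _ fun y _ => ?_
        rw [Real.norm_of_nonneg (mul_nonneg (sq_nonneg _) (i1.pos y).le)]
        exact mul_le_mul_of_nonneg_left (i2 y) (sq_nonneg _))
      (hi2.mul_const _)
      (ae_of_all _ fun y _ => (hD.tendsto_at y).const_mul _)
    refine key.congr' ?_
    filter_upwards [hDΨ, hmem] with i i1 i2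
    rw [normSq_zero_eq i2.memLp, i1.integral_comp_unit (fun x => f x ^ 2)]
  have hsub : ∀ᶠ i in l, ∀ n, fourierC (fun x => f (Ψ i x) - f (ψ x)) n
      = fourierC (fun x => f (Ψ i x)) n - fourierC (fun x => f (ψ x)) n := by
    filter_upwards [hmem] with i i1 n using fourierC_sub i1.intervalIntegrable hmem0.intervalIntegrable n
  have c0 : Tendsto (fun i => normSq 0 (fun x => f (Ψ i x) - f (ψ x))) l (𝓝 0) := by
    have := tendsto_tsum_sub_of_tendsto (w := fun n => (1 + (n : ℝ) ^ 2) ^ (0 : ℝ)) (fun n => by positivity) hcoef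
      (by filter_upwards [hmem] with i i1 using (i1.mono h0).summable) (hmem0.mono h0).summable hL2
    refine this.congr' ?_
    filter_upwards [hsub] with i i1
    simp only [normSq, i1]
  refine TendH.of_normSq hmem hmem0
    -- For `θ = 0` the `L²` part alone is the norm, and the Gagliardo representation is not
    -- available.
    (b := fun i => normSq 0 (fun x => f (Ψ i x) - f (ψ x)) +
      if θ = 0 then 0 else semiSq θ (fun x => f (Ψ i x) - f (ψ x))) ?_ ?_
  · rcases h0.eq_or_lt with rfl | h0
    · simpa using c0
    simp only [h0.ne', if_false]
    have hCtop := gagliardoConst_lt_top h0 h1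
    have hsf := hf.summable_semi h0.le
    have hGf : gagliardo θ f < ⊤ := by
      rw [gagliardo_eq_semiSq h0 hf.periodic hf.memLp hsf]
      exact ENNReal.mul_lt_top hCtop ENNReal.ofReal_lt_top
    have hfm := aemeasurable_of_periodic hf.periodic hf.memLp
    have hdiff : AEMeasurable (fun p : ℝ × ℝ => |f p.1 - f p.2| ^ 2) ((volume.restrict (Ioc 0 1)).prod volume) := by
      have a1 : AEMeasurable (fun p : ℝ × ℝ => f p.1) ((volume.restrict (Ioc 0 1)).prod volume) :=
        hfm.restrict.comp_fst
      have a2 : AEMeasurable (fun p : ℝ × ℝ => f p.2) ((volume.restrict (Ioc 0 1)).prod volume) := hfm.comp_snd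
      exact (continuous_abs.measurable.comp_aemeasurable (a1.sub a2)).pow_const 2
    have hker : ∀ {d φ : ℝ → ℝ}, CircleChange d φ → Measurable (fun p : ℝ × ℝ => kernel θ d p.1 p.2) := by
      intro d φ h
      have := h.cont.measurable
      have := h.isPrim.continuous.measurable
      unfold kernel
      fun_prop
    have hmeas : ∀ {k : ℝ × ℝ → ℝ}, Measurable k → AEMeasurable (fun p : ℝ × ℝ =>
        ENNReal.ofReal (|f p.1 - f p.2| ^ 2 * k p)) ((volume.restrict (Ioc 0 1)).prod volume) :=
      fun hk => (hdiff.mul hk.aemeasurable).ennreal_ofReal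
    have hprod : ∀ {k : ℝ → ℝ → ℝ}, Measurable (fun p : ℝ × ℝ => k p.1 p.2) →
        ∫⁻ a in Ioc (0 : ℝ) 1, ∫⁻ b, ENNReal.ofReal (|f a - f b| ^ 2 * k a b) =
        ∫⁻ p, ENNReal.ofReal (|f p.1 - f p.2| ^ 2 * k p.1 p.2) ∂((volume.restrict (Ioc (0 : ℝ) 1)).prod volume) :=
      fun hk => (lintegral_prod _ (hmeas hk)).symm
    set K := (M + 1) ^ 2 * (m / 2) ^ (-(1 + 2 * θ)) with hK
    have hK0 : 0 ≤ K := by positivity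
    have hgag : Tendsto (fun i => gagliardo θ (fun x => f (Ψ i x))) l (𝓝 (gagliardo θ (fun x => f (ψ x)))) := by
      rw [gagliardo_comp hδ, hprod (hker hδ)]
      have hmW : Measurable (fun p : ℝ × ℝ => K * |p.1 - p.2| ^ (-(1 + 2 * θ))) := by fun_prop
      have key := tendsto_lintegral_filter_of_dominated_convergence' (l := l)
        (μ := (volume.restrict (Ioc (0 : ℝ) 1)).prod volume)
        (F := fun i p => ENNReal.ofReal (|f p.1 - f p.2| ^ 2 * kernel θ (D i) p.1 p.2))
        (f := fun p => ENNReal.ofReal (|f p.1 - f p.2| ^ 2 * kernel θ δ p.1 p.2))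
        (fun p => ENNReal.ofReal (|f p.1 - f p.2| ^ 2 * (K * |p.1 - p.2| ^ (-(1 + 2 * θ)))))
        (by filter_upwards [hDΨ] with i i1 using hmeas (hker i1))
        (by
          filter_upwards [hDΨ, em, eM] with i i1 i2 i3
          refine ae_of_all _ fun p => ENNReal.ofReal_le_ofReal ?_
          exact mul_le_mul_of_nonneg_left (kernel_le h0 i1 (by positivity) i2 i3 _ _) (by positivity))
        (by
          rw [← hprod (k := fun a b => K * |a - b| ^ (-(1 + 2 * θ))) hmW]
          refine ne_of_lt (lt_of_le_of_lt (b := ENNReal.ofReal K * gagliardo θ f) (le_of_eq ?_)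
            (ENNReal.mul_lt_top ENNReal.ofReal_lt_top hGf))
          rw [gagliardo, ← lintegral_const_mul' _ _ ENNReal.ofReal_ne_top]
          congr 1; ext a
          rw [← lintegral_const_mul' _ _ ENNReal.ofReal_ne_top]
          congr 1; ext b
          rw [← ENNReal.ofReal_mul hK0]
          congr 1; ring)
        (ae_of_all _ fun p => by
          refine (ENNReal.continuous_ofReal.tendsto _).comp (Tendsto.const_mul _ ?_)
          unfold kernel
          by_cases hp : p.1 = p.2
          · have hne : -(1 + 2 * θ) ≠ 0 := by linarith
            simp only [hp, sub_self, abs_zero, Real.zero_rpow hne, mul_zero]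
            exact tendsto_const_nhds
          · refine ((hD.tendsto_at _).mul (hD.tendsto_at _)).mul ?_
            refine Tendsto.rpow_const (((hP _).sub (hP _)).abs) (Or.inl ?_)
            rw [abs_ne_zero, sub_ne_zero]
            exact fun h => hp (hδ.strictMono.injective h))
      refine key.congr' ?_
      filter_upwards [hDΨ] with i i1
      rw [gagliardo_comp i1, hprod (hker i1)]
    have hsemi : Tendsto (fun i => semiSq θ (fun x => f (Ψ i x))) l (𝓝 (semiSq θ (fun x => f (ψ x)))) := by
      have hconv : ∀ {g : ℝ → ℝ}, MemH θ g →
          semiSq θ g = (gagliardo θ g).toReal / (gagliardoConst θ).toReal := by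
        intro g hg
        rw [gagliardo_eq_semiSq h0 hg.periodic hg.memLp (hg.summable_semi h0.le), ENNReal.toReal_mul,
          ENNReal.toReal_ofReal (semiSq_nonneg _ _)]
        have : (gagliardoConst θ).toReal ≠ 0 := (ENNReal.toReal_pos (gagliardoConst_pos θ).ne' hCtop.ne).ne'
        field_simp
      rw [hconv hmem0]
      have hfin : gagliardo θ (fun x => f (ψ x)) ≠ ⊤ := by
        rw [gagliardo_eq_semiSq h0 hmem0.periodic hmem0.memLp (hmem0.summable_semi h0.le)]
        exact (ENNReal.mul_lt_top hCtop ENNReal.ofReal_lt_top).ne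
      refine (((ENNReal.tendsto_toReal hfin).comp hgag).div_const _).congr' ?_
      filter_upwards [hmem] with i i1
      rw [hconv i1]; rfl
    have c1 : Tendsto (fun i => semiSq θ (fun x => f (Ψ i x) - f (ψ x))) l (𝓝 0) := by
      have := tendsto_tsum_sub_of_tendsto (w := fun n => |(n : ℝ)| ^ (2 * θ)) (fun n => by positivity) hcoef
        (by filter_upwards [hmem] with i i1 using i1.summable_semi h0.le) (hmem0.summable_semi h0.le) hsemi
      refine this.congr' ?_
      filter_upwards [hsub] with i i1
      simp only [semiSq, i1]
    simpa using c0.add c1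
  · filter_upwards [hmem] with i i1
    have := i1.sub hmem0
    split_ifs with h
    · subst h; simp
    · exact (summable_weight_of_semi h0 h1.le this.memLp (this.summable_semi h0)).2

/-- Composition with the inverses of a convergent family of circle diffeomorphisms is continuous
on `H^q`. -/
theorem TendH.comp [l.IsCountablyGenerated] {r q : ℝ} (hr : 1 ≤ r) (hD : TendH r l D δ)
    (hDΨ : ∀ᶠ i in l, CircleChange (D i) (Ψ i)) (hδ : CircleChange δ ψ) (hq : 0 ≤ q) (hqr : q ≤ r)
    {F : ι → ℝ → ℝ} {f : ℝ → ℝ} (hF : TendH q l F f) :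
    TendH q l (fun i x => F i (Ψ i x)) (fun x => f (ψ x)) := by
  have hDu := (hD.mono hr).tendstoUniformly
  obtain ⟨m, hm, hmδ⟩ := exists_pos_le_of_periodic hδ.cont hδ.per hδ.pos
  obtain ⟨M, hM, hMδ⟩ := bounded_of_periodic hδ.cont hδ.per
  have em := tendstoUniformly_eventually_le hDu hm hmδ
  have eM : ∀ᶠ i in l, ∀ x, D i x ≤ M + 1 := by
    filter_upwards [tendstoUniformly_eventually_abs_le hDu hMδ] with i hi x using (le_abs_self _).trans (hi x)
  have hinv : TendH r l (fun i x => (D i x)⁻¹) (fun x => (δ x)⁻¹) :=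
    hD.inv hr (by filter_upwards [hDΨ] with i i1 using i1.pos) hδ.pos
  -- Write `F i∘Ψ i - f∘ψ = (F i - f)∘Ψ i + (f∘Ψ i - f∘ψ)`: the first part is small by the uniform
  -- bound, the second by the case of fixed `f`.
  have base : ∀ θ : ℝ, 0 ≤ θ → θ < 1 → ∀ {F : ι → ℝ → ℝ} {f : ℝ → ℝ}, TendH θ l F f →
      TendH θ l (fun i x => F i (Ψ i x)) (fun x => f (ψ x)) := by
    intro θ h0 h1 F f hF
    obtain ⟨C, -, hC⟩ := memH_comp h0 h1 (m := m / 2) (M := M + 1) (by positivity)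
    have t1 := tendH_comp_fixed h0 h1 hDu hDΨ hδ hF.lim_mem
    have t2 : TendH θ l (fun i x => F i (Ψ i x) - f (Ψ i x)) (fun _ => 0) := by
      refine TendH.of_normSq ?_ (memH_const θ 0) (b := fun i => C * normSq θ (fun x => F i x - f x)) ?_ ?_
      · filter_upwards [hDΨ, em, eM, hF.mem] with i i1 i2 i3 i4
        exact (hC _ _ _ i1 i2 i3 (i4.sub hF.lim_mem)).1
      · simpa using hF.tendsto.const_mul C
      · filter_upwards [hDΨ, em, eM, hF.mem] with i i1 i2 i3 i4
        simpa using (hC _ _ _ i1 i2 i3 (i4.sub hF.lim_mem)).2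
    have t3 := t2.add t1
    simp only [zero_add, sub_add_cancel] at t3
    exact t3
  -- Induction on the integer part of the order: the derivative of `F∘Ψ` is `(F'/D)∘Ψ`, of order one
  -- less, while `Ψ` fixes `0`.
  have ind : ∀ k : ℕ, ∀ q : ℝ, 0 ≤ q → q ≤ r → q < k + 1 → ∀ {F : ι → ℝ → ℝ} {f : ℝ → ℝ}, TendH q l F f →
      TendH q l (fun i x => F i (Ψ i x)) (fun x => f (ψ x)) := by
    intro k
    induction k with
    | zero => intro q h0 _ h1; exact base q h0 (by simpa using h1)
    | succ k ih =>
      intro q h0 hqr h1 F f hF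
      rcases lt_or_ge q 1 with hq1 | hq1
      · exact base q h0 hq1 hF
      obtain ⟨p, rfl⟩ : ∃ p, q = p + 1 := ⟨q - 1, by ring⟩
      have hp : 0 ≤ p := by linarith
      have hd := ih p hp (by linarith) (by push_cast at h1; linarith)
        ((hF.deriv hp).mul_gap hp (by linarith) hinv)
      refine hd.of_prim hp ?_ ?_ (hδ.isPrim_comp (hF.lim_mem.isPrim_deriv hp).1)
        (hδ.periodic_comp hF.lim_mem.periodic) ?_
      · filter_upwards [hDΨ, hF.mem] with i i1 i2 using i1.isPrim_comp (i2.isPrim_deriv hp).1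
      · filter_upwards [hDΨ, hF.mem] with i i1 i2 using i1.periodic_comp i2.periodic
      · rw [hδ.inv_zero]
        refine ((hF.mono hq1).tendsto_apply 0).congr' ?_
        filter_upwards [hDΨ] with i i1
        rw [i1.inv_zero]
  obtain ⟨k, hk⟩ := exists_nat_gt q
  exact ind k q hq hqr (by linarith) hF

end

/-! ### Differentiable curves in Sobolev spaces -/

lemma ordConnected_timeInterval (T : EReal) : OrdConnected (timeInterval T) := by
  refine ⟨fun x hx y hy z hz => ⟨hx.1.trans hz.1, lt_of_le_of_lt ?_ hy.2⟩⟩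
  exact_mod_cast hz.2

lemma convex_timeInterval (T : EReal) : Convex ℝ (timeInterval T) :=
  (ordConnected_timeInterval T).convex

lemma zero_mem_timeInterval {T : EReal} (hT : 0 < T) : (0 : ℝ) ∈ timeInterval T :=
  ⟨le_rfl, by exact_mod_cast hT⟩

/-- A curve whose Fourier coefficients are differentiable, with the coefficients of a curve that is
continuous in `H^r` as derivatives, is differentiable in `H^r`. -/
theorem hasDerivH_of_fourierC {r : ℝ} {T : EReal} {w v : ℝ → ℝ → ℝ} (hw : ContH r T w) (hv : ContH r T v)
    (h : ∀ n, ∀ t ∈ timeInterval T,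
      HasDerivWithinAt (fun τ => fourierC (w τ) n) (fourierC (v t) n) (timeInterval T) t) :
    HasDerivH r T w v := by
  intro t ht
  rw [tendsto_normH_iff, Metric.tendsto_nhds]
  intro ε hε
  have hvt := ((contH_iff.1 hv t ht).tendsto).eventually_lt_const (show (0 : ℝ) < ε / 2 by positivity)
  obtain ⟨δ, hδ, hball⟩ := Metric.mem_nhdsWithin_iff.1 hvt
  have hnear : (timeInterval T \ {t}) ∩ Metric.ball t δ ∈ 𝓝[timeInterval T \ {t}] t :=
    inter_mem_nhdsWithin _ (Metric.ball_mem_nhds t hδ)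
  filter_upwards [hnear] with τ hτ
  obtain ⟨⟨hτI, hτt⟩, hτb⟩ := hτ
  have hne : τ - t ≠ 0 := sub_ne_zero.2 hτt
  have hmt := hw.1 t ht
  have hmτ := hw.1 τ hτI
  have hvm := hv.1 t ht
  have hquot : MemH r (fun x => (w τ x - w t x) / (τ - t) - v t x) := by
    have := ((hmτ.sub hmt).const_mul (τ - t)⁻¹).sub hvm
    simpa only [div_eq_inv_mul] using this
  set z : ℤ → ℂ := fun n => fourierC (fun x => (w τ x - w t x) / (τ - t) - v t x) n with hz
  have hzn : ∀ n, z n * (τ - t : ℝ) = fourierC (w τ) n - fourierC (w t) n - (τ - t : ℝ) * fourierC (v t) n := by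
    intro n
    have e : (fun x => (w τ x - w t x) / (τ - t) - v t x) = fun x => (τ - t)⁻¹ * (w τ x - w t x) - v t x := by
      ext x; rw [div_eq_inv_mul]
    rw [hz]; simp only
    rw [e, fourierC_sub ((hmτ.sub hmt).const_mul (τ - t)⁻¹).intervalIntegrable hvm.intervalIntegrable,
      fourierC_const_mul, fourierC_sub hmτ.intervalIntegrable hmt.intervalIntegrable]
    have : ((τ - t : ℝ) : ℂ) ≠ 0 := by exact_mod_cast hne
    push_cast at this ⊢
    field_simp
  rw [Real.dist_eq, sub_zero, abs_of_nonneg (normSq_nonneg _ _)]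
  refine lt_of_le_of_lt ?_ (half_lt_self hε)
  refine hquot.summable.tsum_le_of_sum_le fun S => ?_
  set W : ℤ → ℝ := fun n => (1 + (n : ℝ) ^ 2) ^ r with hW
  have hW0 : ∀ n, 0 ≤ W n := fun n => (weight_pos r n).le
  set A := ∑ n ∈ S, W n * ‖z n‖ ^ 2 with hA
  have hA0 : 0 ≤ A := Finset.sum_nonneg fun n _ => mul_nonneg (hW0 n) (by positivity)
  -- Duality argument. `G` pairs the remainder of the curve with the weighted conjugate of the
  -- quotient error `z`, so `G τ - G t = A (τ - t)`. The derivative of `G` is at most `A/2 + ε/4` by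
  -- `ab ≤ (a² + b²)/2`, and the mean value inequality gives `A ≤ A/2 + ε/4`. The sum over `S` is
  -- finite, so only the coefficients need to be differentiated, and the bound does not depend on
  -- `S`.
  set G : ℝ → ℂ := fun σ => ∑ n ∈ S, ((W n : ℂ) * (starRingEnd ℂ) (z n)) *
    (fourierC (w σ) n - (σ - t : ℝ) * fourierC (v t) n) with hG
  set J := timeInterval T ∩ Metric.ball t δ with hJ
  have hJc : Convex ℝ J := (convex_timeInterval T).inter (convex_ball t δ)
  have hderiv : ∀ σ ∈ J, HasDerivWithinAt G (∑ n ∈ S, ((W n : ℂ) * (starRingEnd ℂ) (z n)) *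
      (fourierC (v σ) n - fourierC (v t) n)) J σ := by
    intro σ hσ
    refine HasDerivWithinAt.fun_sum fun n _ => HasDerivWithinAt.const_mul _ ?_
    refine ((h n σ hσ.1).mono inter_subset_left).sub ?_
    have h1 : HasDerivWithinAt (fun σ : ℝ => ((σ - t : ℝ) : ℂ)) 1 J σ := by
      have := (((hasDerivAt_id σ).sub_const t).ofReal_comp).hasDerivWithinAt (s := J)
      simpa using this
    simpa using h1.mul_const (fourierC (v t) n)
  have hbound : ∀ σ ∈ J, ‖∑ n ∈ S, ((W n : ℂ) * (starRingEnd ℂ) (z n)) *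
      (fourierC (v σ) n - fourierC (v t) n)‖ ≤ A / 2 + ε / 2 / 2 := by
    intro σ hσ
    have h1 : normSq r (fun x => v σ x - v t x) < ε / 2 := hball ⟨hσ.2, hσ.1⟩
    have hmσ := hv.1 σ hσ.1
    have h2 : ∑ n ∈ S, W n * ‖fourierC (v σ) n - fourierC (v t) n‖ ^ 2 ≤ ε / 2 := by
      refine le_trans ?_ h1.le
      have := (hmσ.sub hvm).summable.sum_le_tsum S (fun n _ => by positivity)
      refine le_trans (le_of_eq (Finset.sum_congr rfl fun n _ => ?_)) this
      rw [fourierC_sub hmσ.intervalIntegrable hvm.intervalIntegrable]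
    refine (norm_sum_le _ _).trans ?_
    have h3 : ∀ n ∈ S, ‖((W n : ℂ) * (starRingEnd ℂ) (z n)) * (fourierC (v σ) n - fourierC (v t) n)‖
        ≤ W n * ‖z n‖ ^ 2 / 2 + W n * ‖fourierC (v σ) n - fourierC (v t) n‖ ^ 2 / 2 := by
      intro n _
      rw [norm_mul, norm_mul, Complex.norm_conj, Complex.norm_real, Real.norm_of_nonneg (hW0 n)]
      have := mul_nonneg (hW0 n) (sq_nonneg (‖z n‖ - ‖fourierC (v σ) n - fourierC (v t) n‖))
      nlinarith
    refine (Finset.sum_le_sum h3).trans ?_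
    rw [Finset.sum_add_distrib, ← Finset.sum_div, ← Finset.sum_div]
    linarith
  have htJ : t ∈ J := ⟨ht, Metric.mem_ball_self hδ⟩
  have hmv := hJc.norm_image_sub_le_of_norm_hasDerivWithin_le hderiv hbound htJ ⟨hτI, hτb⟩
  have hGd : G τ - G t = ((A * (τ - t) : ℝ) : ℂ) := by
    rw [hG]; simp only
    rw [← Finset.sum_sub_distrib, hA, Finset.sum_mul, Complex.ofReal_sum]
    refine Finset.sum_congr rfl fun n _ => ?_
    have h1 : (starRingEnd ℂ) (z n) * z n = ((‖z n‖ ^ 2 : ℝ) : ℂ) := by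
      rw [mul_comm, Complex.mul_conj, Complex.normSq_eq_norm_sq]
    have h2 := hzn n
    rw [← mul_sub]
    have h3 : fourierC (w τ) n - ((τ - t : ℝ) : ℂ) * fourierC (v t) n -
        (fourierC (w t) n - ((t - t : ℝ) : ℂ) * fourierC (v t) n) = z n * (τ - t : ℝ) := by
      rw [h2]; push_cast; ring
    rw [h3, mul_assoc, ← mul_assoc _ (z n), h1]
    push_cast; ring
  rw [hGd, Complex.norm_real, Real.norm_eq_abs, Real.norm_eq_abs, abs_mul, abs_of_nonneg hA0] at hmv
  have := le_of_mul_le_mul_right hmv (abs_pos.2 hne)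
  have : A ≤ ε / 2 := by linarith
  exact this

/-- Differentiation under the integral sign, for a jointly continuous derivative. -/
lemma hasDerivAt_integral_of_continuous {G G' : ℝ → ℝ → ℂ} (hG : ∀ t, Continuous (G t))
    (hG' : Continuous (Function.uncurry G')) (h : ∀ t y, HasDerivAt (fun τ => G τ y) (G' t y) t) (t : ℝ) :
    HasDerivAt (fun τ => ∫ y in (0 : ℝ)..1, G τ y) (∫ y in (0 : ℝ)..1, G' t y) t := by
  obtain ⟨C, hC⟩ := ((isCompact_closedBall t 1).prod (isCompact_Icc (a := (0 : ℝ)) (b := 1))).exists_bound_of_continuousOn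
    hG'.continuousOn
  refine (intervalIntegral.hasDerivAt_integral_of_dominated_loc_of_deriv_le (s := Metric.ball t 1)
    (bound := fun _ => C) (Metric.ball_mem_nhds t one_pos)
    (Eventually.of_forall fun τ => (hG τ).aestronglyMeasurable) ((hG t).intervalIntegrable _ _)
    (hG'.comp (Continuous.prodMk_right t)).aestronglyMeasurable
    (ae_of_all _ fun y hy τ hτ => ?_) (by simp) (ae_of_all _ fun y _ τ _ => h τ y)).2
  rw [uIoc_of_le zero_le_one] at hy
  exact hC (τ, y) ⟨Metric.ball_subset_closedBall hτ, hy.1.le, hy.2⟩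

/-! ### The Jacobian of the explicit flow -/

/-- The solution of `y'' = -c y`, `y(0) = 1`, `y'(0) = 0`, for `c = 1, 0, -1`. -/
def cosC (c t : ℝ) : ℝ := if c = 1 then Real.cos t else if c = 0 then 1 else Real.cosh t

/-- The solution of `y'' = -c y`, `y(0) = 0`, `y'(0) = 1`, for `c = 1, 0, -1`. -/
def sinC (c t : ℝ) : ℝ := if c = 1 then Real.sin t else if c = 0 then t else Real.sinh t

section trig
variable {c : ℝ} (hc : c = 1 ∨ c = 0 ∨ c = -1)
include hc

lemma hasDerivAt_cosC (t : ℝ) : HasDerivAt (cosC c) (-(c * sinC c t)) t := by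
  rcases hc with rfl | rfl | rfl
  · have : cosC 1 = Real.cos := by ext; simp [cosC]
    rw [this]; simpa [sinC] using Real.hasDerivAt_cos t
  · have : cosC 0 = fun _ => 1 := by ext; simp [cosC]
    rw [this]; simpa using hasDerivAt_const t (1 : ℝ)
  · have : cosC (-1) = Real.cosh := by ext; norm_num [cosC]
    rw [this]; convert! Real.hasDerivAt_cosh t using 1; norm_num [sinC]

lemma hasDerivAt_sinC (t : ℝ) : HasDerivAt (sinC c) (cosC c t) t := by
  rcases hc with rfl | rfl | rfl
  · have : sinC 1 = Real.sin := by ext; simp [sinC]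
    rw [this]; simpa [cosC] using Real.hasDerivAt_sin t
  · have : sinC 0 = fun t => t := by ext; simp [sinC]
    rw [this]; simpa [cosC] using hasDerivAt_id' t
  · have : sinC (-1) = Real.sinh := by ext; norm_num [sinC]
    rw [this]; convert! Real.hasDerivAt_sinh t using 1; norm_num [cosC]

lemma cosC_sq_add (t : ℝ) : cosC c t ^ 2 + c * sinC c t ^ 2 = 1 := by
  rcases hc with rfl | rfl | rfl
  · simp [cosC, sinC, Real.cos_sq_add_sin_sq]
  · simp [cosC, sinC]
  · norm_num [cosC, sinC]; linarith [Real.cosh_sq t]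

lemma continuous_cosC : Continuous (cosC c) :=
  continuous_iff_continuousAt.2 fun t => (hasDerivAt_cosC hc t).continuousAt

lemma continuous_sinC : Continuous (sinC c) :=
  continuous_iff_continuousAt.2 fun t => (hasDerivAt_sinC hc t).continuousAt

omit hc in
lemma cosC_zero : cosC c 0 = 1 := by unfold cosC; split_ifs <;> simp

omit hc in
lemma sinC_zero : sinC c 0 = 0 := by unfold sinC; split_ifs <;> simp

end trig

/-- The Jacobian of the explicit flow. -/
def jac (c : ℝ) (f g : ℝ → ℝ) (t y : ℝ) : ℝ :=
  (cosC c t + f y / 2 * sinC c t) ^ 2 - g y ^ 2 / 4 * sinC c t ^ 2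

/-- The time derivative of the Jacobian. -/
def jac' (c : ℝ) (f g : ℝ → ℝ) (t y : ℝ) : ℝ :=
  -(2 * c * cosC c t * sinC c t) + (cosC c t ^ 2 - c * sinC c t ^ 2) * f y
    + 2 * sinC c t * cosC c t * ((f y ^ 2 - g y ^ 2) / 4)

/-- The second time derivative of the Jacobian. -/
def jac'' (c : ℝ) (f g : ℝ → ℝ) (t y : ℝ) : ℝ :=
  -(2 * c * (cosC c t ^ 2 - c * sinC c t ^ 2)) - 4 * c * cosC c t * sinC c t * f y
    + 2 * (cosC c t ^ 2 - c * sinC c t ^ 2) * ((f y ^ 2 - g y ^ 2) / 4)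

lemma explicitFlow_eq {c : ℝ} (u₀ ρ₀ : ℝ → ℝ) (t : ℝ) :
    explicitFlow c u₀ ρ₀ t = primF (jac c (deriv u₀) ρ₀ t) := by
  ext x
  unfold explicitFlow primF jac cosC sinC
  split_ifs <;> rfl

/-- In expanded form, coefficients depending on time alone multiply three fixed functions. Time
derivatives and convergence in `H^r` thus reduce to those of scalars. -/
lemma jac_eq (c : ℝ) (f g : ℝ → ℝ) (t y : ℝ) :
    jac c f g t y = cosC c t ^ 2 + cosC c t * sinC c t * f y + sinC c t ^ 2 * ((f y ^ 2 - g y ^ 2) / 4) := by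
  unfold jac; ring

/-- The data of the explicit solution: `f = u₀'` and `g = ρ₀` are in `H^r`. -/
structure Data (c r : ℝ) (f g : ℝ → ℝ) : Prop where
  hc : c = 1 ∨ c = 0 ∨ c = -1
  hr : 1 ≤ r
  hf : MemH r f
  hg : MemH r g
  mean : ∫ y in (0 : ℝ)..1, f y = 0
  energy : ∫ y in (0 : ℝ)..1, (f y ^ 2 - g y ^ 2) / 4 = c

namespace Data
variable {c r : ℝ} {f g : ℝ → ℝ} (h : Data c r f g)
include h

lemma cf : Continuous f := h.hf.continuous (by linarith [h.hr])
lemma cg : Continuous g := h.hg.continuous (by linarith [h.hr])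

lemma ck : Continuous fun y => (f y ^ 2 - g y ^ 2) / 4 := by
  have := h.cf; have := h.cg; fun_prop

lemma memH_k : MemH r fun y => (f y ^ 2 - g y ^ 2) / 4 := by
  -- Membership of a product is read off from the convergence of constant families, along a trivial
  -- filter.
  have h1 := (TendH.const h.hf (pure ())).mul h.hr (TendH.const h.hf _)
  have h2 := (TendH.const h.hg (pure ())).mul h.hr (TendH.const h.hg _)
  have := (h1.lim_mem.sub h2.lim_mem).const_mul (1 / 4)
  convert this using 2 with y; ring

lemma continuous_jac (t : ℝ) : Continuous (jac c f g t) := by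
  have := h.cf; have := h.cg; unfold jac; fun_prop

lemma continuous_jac' (t : ℝ) : Continuous (jac' c f g t) := by
  have := h.cf; have := h.cg; unfold jac'; fun_prop

lemma continuous_jac'' (t : ℝ) : Continuous (jac'' c f g t) := by
  have := h.cf; have := h.cg; unfold jac''; fun_prop

lemma continuous_uncurry_jac : Continuous (Function.uncurry (jac c f g)) := by
  have := h.cf; have := h.cg; have := continuous_cosC h.hc; have := continuous_sinC h.hc
  unfold jac Function.uncurry; fun_prop

lemma continuous_uncurry_jac' : Continuous (Function.uncurry (jac' c f g)) := by
  have := h.cf; have := h.cg; have := continuous_cosC h.hc; have := continuous_sinC h.hc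
  unfold jac' Function.uncurry; fun_prop

lemma primF_combination (a b d : ℝ) (x : ℝ) :
    primF (fun y => a + b * f y + d * ((f y ^ 2 - g y ^ 2) / 4)) x
      = a * x + b * primF f x + d * primF (fun y => (f y ^ 2 - g y ^ 2) / 4) x := by
  unfold primF
  rw [intervalIntegral.integral_add, intervalIntegral.integral_add, intervalIntegral.integral_const_mul,
    intervalIntegral.integral_const_mul, intervalIntegral.integral_const]
  · simp [mul_comm]
  · simp
  · exact (h.cf.intervalIntegrable _ _).const_mul _
  · exact (continuous_const.add (continuous_const.mul h.cf)).intervalIntegrable _ _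
  · exact (h.ck.intervalIntegrable _ _).const_mul _

lemma primF_jac (t x : ℝ) : primF (jac c f g t) x = cosC c t ^ 2 * x + cosC c t * sinC c t * primF f x
    + sinC c t ^ 2 * primF (fun y => (f y ^ 2 - g y ^ 2) / 4) x := by
  rw [← h.primF_combination]
  congr 1; ext y; rw [jac_eq]

lemma primF_jac' (t x : ℝ) : primF (jac' c f g t) x = -(2 * c * cosC c t * sinC c t) * x
    + (cosC c t ^ 2 - c * sinC c t ^ 2) * primF f x
    + 2 * sinC c t * cosC c t * primF (fun y => (f y ^ 2 - g y ^ 2) / 4) x := by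
  rw [← h.primF_combination]; rfl

lemma primF_jac'' (t x : ℝ) : primF (jac'' c f g t) x = -(2 * c * (cosC c t ^ 2 - c * sinC c t ^ 2)) * x
    + (-(4 * c * cosC c t * sinC c t)) * primF f x
    + 2 * (cosC c t ^ 2 - c * sinC c t ^ 2) * primF (fun y => (f y ^ 2 - g y ^ 2) / 4) x := by
  rw [← h.primF_combination]
  congr 1; ext y; unfold jac''; ring

/-- Here the normalisation of the energy enters: the total mass is `C² + c S² = 1`, so the flow
closes up on the circle. -/
lemma primF_jac_one (t : ℝ) : primF (jac c f g t) 1 = 1 := by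
  rw [h.primF_jac]
  have e1 : primF f 1 = 0 := h.mean
  have e2 : primF (fun y => (f y ^ 2 - g y ^ 2) / 4) 1 = c := h.energy
  rw [e1, e2]
  linear_combination cosC_sq_add h.hc t

lemma primF_jac'_one (t : ℝ) : primF (jac' c f g t) 1 = 0 := by
  rw [h.primF_jac']
  have e1 : primF f 1 = 0 := h.mean
  have e2 : primF (fun y => (f y ^ 2 - g y ^ 2) / 4) 1 = c := h.energy
  rw [e1, e2]; ring

lemma hasDerivAt_jac (t y : ℝ) : HasDerivAt (fun τ => jac c f g τ y) (jac' c f g t y) t := by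
  have hC := hasDerivAt_cosC h.hc t
  have hS := hasDerivAt_sinC h.hc t
  have := ((hC.add (hS.const_mul (f y / 2))).pow 2).sub ((hS.pow 2).const_mul (g y ^ 2 / 4))
  refine this.congr_deriv ?_
  simp only [jac', Pi.add_apply]
  push_cast; ring

lemma hasDerivAt_flow (t x : ℝ) :
    HasDerivAt (fun τ => primF (jac c f g τ) x) (primF (jac' c f g t) x) t := by
  simp only [h.primF_jac, h.primF_jac']
  have hC := hasDerivAt_cosC h.hc t
  have hS := hasDerivAt_sinC h.hc t
  have := (((hC.pow 2).mul_const x).add ((hC.mul hS).mul_const (primF f x))).add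
    ((hS.pow 2).mul_const (primF (fun y => (f y ^ 2 - g y ^ 2) / 4) x))
  refine this.congr_deriv ?_
  push_cast; ring

lemma hasDerivAt_flow' (t x : ℝ) :
    HasDerivAt (fun τ => primF (jac' c f g τ) x) (primF (jac'' c f g t) x) t := by
  simp only [h.primF_jac', h.primF_jac'']
  have hC := hasDerivAt_cosC h.hc t
  have hS := hasDerivAt_sinC h.hc t
  have := ((((hC.mul hS).const_mul (-(2 * c))).mul_const x).add
    ((((hC.pow 2).sub ((hS.pow 2).const_mul c))).mul_const (primF f x))).add
    (((hS.mul hC).const_mul 2).mul_const (primF (fun y => (f y ^ 2 - g y ^ 2) / 4) x))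
  refine (this.congr_of_eventuallyEq (Eventually.of_forall fun τ => ?_)).congr_deriv ?_
  · simp only [Pi.mul_apply, Pi.add_apply, Pi.sub_apply, Pi.pow_apply]; ring
  · push_cast; ring

lemma periodic_jac (t : ℝ) : Function.Periodic (jac c f g t) 1 := fun x => by
  simp only [jac, h.hf.periodic x, h.hg.periodic x]

lemma periodic_jac' (t : ℝ) : Function.Periodic (jac' c f g t) 1 := fun x => by
  simp only [jac', h.hf.periodic x, h.hg.periodic x]

lemma exists_change {t : ℝ} (hpos : ∀ x, 0 < jac c f g t x) : ∃ ψ, CircleChange (jac c f g t) ψ :=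
  exists_circleChange (h.continuous_jac t) (h.periodic_jac t) hpos (h.primF_jac_one t)

lemma tendH_jac (l : Filter ℝ) {t : ℝ} (hl : l ≤ 𝓝 t) : TendH r l (jac c f g) (jac c f g t) := by
  have hC := ((continuous_cosC h.hc).tendsto t).mono_left hl
  have hS := ((continuous_sinC h.hc).tendsto t).mono_left hl
  have h1 := ((TendH.scalar r (hC.pow 2)).add (TendH.smul_const (hC.mul hS) h.hf)).add
    (TendH.smul_const (hS.pow 2) h.memH_k)
  have e : ∀ τ, jac c f g τ = fun y => cosC c τ ^ 2 + cosC c τ * sinC c τ * f y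
      + sinC c τ ^ 2 * ((f y ^ 2 - g y ^ 2) / 4) := fun τ => funext fun y => jac_eq _ _ _ _ _
  rw [e t]
  exact h1.congr (Eventually.of_forall fun τ => (e τ).symm)

lemma tendH_jac' (l : Filter ℝ) {t : ℝ} (hl : l ≤ 𝓝 t) : TendH r l (jac' c f g) (jac' c f g t) := by
  have hC := ((continuous_cosC h.hc).tendsto t).mono_left hl
  have hS := ((continuous_sinC h.hc).tendsto t).mono_left hl
  exact ((TendH.scalar r (((hC.const_mul (2 * c)).mul hS).neg)).add
    (TendH.smul_const ((hC.pow 2).sub ((hS.pow 2).const_mul c)) h.hf)).add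
    (TendH.smul_const ((hS.const_mul 2).mul hC) h.memH_k)

/-- The identity behind the conservation of the energy. -/
lemma jac'_sq_sub (t y : ℝ) :
    jac' c f g t y ^ 2 - g y ^ 2 = 2 * jac c f g t y * (jac'' c f g t y + 2 * c * jac c f g t y) := by
  have hid := cosC_sq_add h.hc t
  -- Multiplying by `(C² + c S²)² = 1` makes both sides homogeneous of degree four in `C` and `S`,
  -- and the identity becomes polynomial.
  have e : g y ^ 2 = g y ^ 2 * (cosC c t ^ 2 + c * sinC c t ^ 2) ^ 2 := by rw [hid]; ring
  rw [e]
  unfold jac jac' jac''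
  ring

end Data

/-! ### From primitive forms to the weak equations -/

namespace IsTest
variable {ζ : ℝ → ℝ}

lemma isPrim (h : IsTest ζ) : IsPrim ζ (deriv ζ) :=
  IsPrim.of_hasDerivAt (fun x => ((h.1.differentiable (by simp)) x).hasDerivAt) (h.1.continuous_deriv (by simp))

lemma continuous (h : IsTest ζ) : Continuous ζ := h.1.continuous

lemma deriv (h : IsTest ζ) : IsTest (deriv ζ) :=
  ⟨(contDiff_infty_iff_deriv.1 h.1).2, periodic_deriv h.2⟩

end IsTest

/-- A primitive form of the momentum equation implies the weak form. -/
lemma weakMomentumEq_of_isPrim {u v ρ : ℝ → ℝ} {k : ℝ} (hu : Continuous (deriv u)) (hρ : Continuous ρ)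
    (hp : Function.Periodic (fun x => v x + u x * deriv u x) 1)
    (h : IsPrim (fun x => v x + u x * deriv u x) fun x => (deriv u x ^ 2 - ρ x ^ 2) / 2 - k) :
    WeakMomentumEq (-1) u v ρ := by
  intro ζ hζ
  have h1 := h.integral_mul_eq hζ.deriv.isPrim hp hζ.deriv.2
  have h2 := hζ.isPrim.integral_deriv_eq_zero hζ.2
  have c1 := hζ.deriv.continuous
  have c2 := hζ.deriv.deriv.continuous
  have hw := h.continuous
  -- The constant `k` is invisible to the weak form, since a derivative of a test function has mean
  -- zero.
  have e : ∀ x, (-(v x + u x * deriv u x) * deriv (deriv ζ) x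
        - (1 / 2) * ((deriv u x) ^ 2 + (-1) * (ρ x) ^ 2) * deriv ζ x)
      = -((v x + u x * deriv u x) * deriv (deriv ζ) x)
        - (((deriv u x ^ 2 - ρ x ^ 2) / 2 - k) * deriv ζ x + k * deriv ζ x) := fun x => by ring
  simp only [e]
  rw [intervalIntegral.integral_sub, intervalIntegral.integral_neg, intervalIntegral.integral_add,
    intervalIntegral.integral_const_mul, h1, h2]
  · ring
  · exact Continuous.intervalIntegrable (by fun_prop) _ _
  · exact Continuous.intervalIntegrable (by fun_prop) _ _
  · exact (hw.mul c2).neg.intervalIntegrable _ _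
  · exact Continuous.intervalIntegrable (by fun_prop) _ _

lemma weakContinuityEq_of_isPrim {u ρ σ : ℝ → ℝ} (hp : Function.Periodic (fun x => u x * ρ x) 1)
    (h : IsPrim (fun x => u x * ρ x) fun x => -σ x) : WeakContinuityEq u ρ σ := by
  intro ζ hζ
  have h1 := h.integral_mul_eq hζ.isPrim hp hζ.2
  have hσ : IntervalIntegrable σ volume 0 1 := by
    have := (h.int 0 1).neg
    convert! this using 1
    ext x; simp
  have c1 : Continuous fun x => u x * ρ x * deriv ζ x := h.continuous.mul hζ.deriv.continuous
  rw [intervalIntegral.integral_sub (hσ.mul_continuousOn hζ.continuous.continuousOn)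
    (c1.intervalIntegrable _ _)]
  simp only [neg_mul, intervalIntegral.integral_neg] at h1
  linarith

lemma hasDerivAt_char (n : ℤ) (x : ℝ) :
    HasDerivAt (char n) (((-(2 * Real.pi * n) : ℝ) : ℂ) * Complex.I * char n x) x := by
  unfold char
  have h1 : HasDerivAt (fun x : ℝ => -(2 * Real.pi * n * x)) (-(2 * Real.pi * n)) x := by
    simpa using ((hasDerivAt_id x).const_mul (2 * Real.pi * n)).fun_neg
  have := (h1.ofReal_comp.mul_const Complex.I).cexp
  refine this.congr_deriv ?_
  ring

lemma continuous_primF {d : ℝ → ℝ} (hd : Continuous d) : Continuous (primF d) :=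
  (isPrim_primF fun a b => hd.intervalIntegrable a b).continuous

/-! ### The explicit solution and its regularity -/

section explicit
variable (c : ℝ) (f g : ℝ → ℝ) (ψ : ℝ → ℝ → ℝ)

/-- The slope `u_x` of the explicit solution. -/
def solUx (t x : ℝ) : ℝ := jac' c f g t (ψ t x) * (jac c f g t (ψ t x))⁻¹

/-- The density `ρ` of the explicit solution. -/
def solRho (t x : ℝ) : ℝ := g (ψ t x) * (jac c f g t (ψ t x))⁻¹

/-- The velocity `u` of the explicit solution. -/
def solU (t : ℝ) : ℝ → ℝ := primF (solUx c f g ψ t)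

/-- The primitive of `(u_x² - ρ²) / 2 - 2c`. -/
def solW (t : ℝ) : ℝ → ℝ :=
  primF fun x => (solUx c f g ψ t x ^ 2 - solRho c f g ψ t x ^ 2) / 2 - 2 * c

/-- The time derivative of `u`. -/
def solV (t x : ℝ) : ℝ := solW c f g ψ t x - solU c f g ψ t x * solUx c f g ψ t x

/-- The time derivative of `ρ`. -/
def solSigma (t x : ℝ) : ℝ :=
  -(solUx c f g ψ t x * solRho c f g ψ t x + solU c f g ψ t x * deriv (solRho c f g ψ t) x)

end explicit

namespace Data
variable {c r : ℝ} {f g : ℝ → ℝ} {T : EReal} {ψ : ℝ → ℝ → ℝ}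

lemma tendH_comp (h : Data c r f g) (hψ : ∀ t ∈ timeInterval T, CircleChange (jac c f g t) (ψ t))
    {t : ℝ} (ht : t ∈ timeInterval T) {q : ℝ} (hq : 0 ≤ q) (hqr : q ≤ r) {F : ℝ → ℝ → ℝ}
    (hF : TendH q (𝓝[timeInterval T] t) F (F t)) :
    TendH q (𝓝[timeInterval T] t) (fun τ x => F τ (ψ τ x)) (fun x => F t (ψ t x)) :=
  TendH.comp h.hr (h.tendH_jac _ nhdsWithin_le_nhds)
    (by filter_upwards [self_mem_nhdsWithin] with τ hτ using hψ τ hτ) (hψ t ht) hq hqr hF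

lemma tendH_inv_jac (h : Data c r f g) (hψ : ∀ t ∈ timeInterval T, CircleChange (jac c f g t) (ψ t))
    {t : ℝ} (ht : t ∈ timeInterval T) :
    TendH r (𝓝[timeInterval T] t) (fun τ x => (jac c f g τ x)⁻¹) (fun x => (jac c f g t x)⁻¹) :=
  (h.tendH_jac _ nhdsWithin_le_nhds).inv h.hr
    (by filter_upwards [self_mem_nhdsWithin] with τ hτ using (hψ τ hτ).pos) (hψ t ht).pos

lemma tendH_solUx (h : Data c r f g) (hψ : ∀ t ∈ timeInterval T, CircleChange (jac c f g t) (ψ t))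
    {t : ℝ} (ht : t ∈ timeInterval T) :
    TendH r (𝓝[timeInterval T] t) (solUx c f g ψ) (solUx c f g ψ t) :=
  h.tendH_comp hψ ht (by linarith [h.hr]) le_rfl (F := fun τ x => jac' c f g τ x * (jac c f g τ x)⁻¹)
    ((h.tendH_jac' _ nhdsWithin_le_nhds).mul h.hr (h.tendH_inv_jac hψ ht))

lemma tendH_solRho (h : Data c r f g) (hψ : ∀ t ∈ timeInterval T, CircleChange (jac c f g t) (ψ t))
    {t : ℝ} (ht : t ∈ timeInterval T) :
    TendH r (𝓝[timeInterval T] t) (solRho c f g ψ) (solRho c f g ψ t) :=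
  h.tendH_comp hψ ht (by linarith [h.hr]) le_rfl (F := fun τ x => g x * (jac c f g τ x)⁻¹)
    ((TendH.const h.hg _).mul h.hr (h.tendH_inv_jac hψ ht))

lemma primF_jac''_one (h : Data c r f g) (t : ℝ) : primF (jac'' c f g t) 1 = 0 := by
  rw [h.primF_jac'']
  have e1 : primF f 1 = 0 := h.mean
  have e2 : primF (fun y => (f y ^ 2 - g y ^ 2) / 4) 1 = c := h.energy
  rw [e1, e2]; ring

lemma solUx_periodic (h : Data c r f g) (t : ℝ) (hψ : CircleChange (jac c f g t) (ψ t)) :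
    Function.Periodic (solUx c f g ψ t) 1 :=
  hψ.periodic_comp (f := fun x => jac' c f g t x * (jac c f g t x)⁻¹) fun x => by
    simp only [h.periodic_jac t x, h.periodic_jac' t x]

lemma solUx_continuous (h : Data c r f g) (t : ℝ) (hψ : CircleChange (jac c f g t) (ψ t)) :
    Continuous (solUx c f g ψ t) :=
  ((h.continuous_jac' t).comp hψ.inv_continuous).mul
    (((h.continuous_jac t).comp hψ.inv_continuous).inv₀ fun _ => (hψ.pos _).ne')

lemma solRho_continuous (h : Data c r f g) (t : ℝ) (hψ : CircleChange (jac c f g t) (ψ t)) :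
    Continuous (solRho c f g ψ t) :=
  (h.cg.comp hψ.inv_continuous).mul
    (((h.continuous_jac t).comp hψ.inv_continuous).inv₀ fun _ => (hψ.pos _).ne')

lemma solRho_periodic (h : Data c r f g) (t : ℝ) (hψ : CircleChange (jac c f g t) (ψ t)) :
    Function.Periodic (solRho c f g ψ t) 1 :=
  hψ.periodic_comp (f := fun x => g x * (jac c f g t x)⁻¹) fun x => by
    simp only [h.periodic_jac t x, h.hg.periodic x]

/-- This is the flow equation `u∘φ = φ_t`: the right side is the time derivative of the flow by
`hasDerivAt_flow`. -/
lemma solU_comp (t : ℝ) (hψ : CircleChange (jac c f g t) (ψ t)) (y : ℝ) :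
    solU c f g ψ t (primF (jac c f g t) y) = primF (jac' c f g t) y := by
  have := hψ.integral_comp (fun x => jac' c f g t x * (jac c f g t x)⁻¹) 0 y
  rw [primF_zero] at this
  unfold solU primF at *
  refine this.trans (intervalIntegral.integral_congr fun x _ => ?_)
  have := (hψ.pos x).ne'
  field_simp

/-- Dividing the energy identity `jac'_sq_sub` by `2 J` shows that `(u_x² - ρ²)/2 - 2c`, pulled back
and multiplied by `J`, is `J_tt`. Hence the primitive `W` is the acceleration `φ_tt∘φ⁻¹`, that is,
`u_t + u u_x`. -/
lemma solW_comp (h : Data c r f g) (t : ℝ) (hψ : CircleChange (jac c f g t) (ψ t)) (y : ℝ) :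
    solW c f g ψ t (primF (jac c f g t) y) = primF (jac'' c f g t) y := by
  have := hψ.integral_comp (fun x => ((jac' c f g t x * (jac c f g t x)⁻¹) ^ 2
    - (g x * (jac c f g t x)⁻¹) ^ 2) / 2 - 2 * c) 0 y
  rw [primF_zero] at this
  unfold solW primF at *
  refine this.trans (intervalIntegral.integral_congr fun x _ => ?_)
  have h0 := (hψ.pos x).ne'
  have h1 := h.jac'_sq_sub t x
  field_simp
  linear_combination h1

lemma solU_eq (t : ℝ) (hψ : CircleChange (jac c f g t) (ψ t)) (x : ℝ) :
    solU c f g ψ t x = primF (jac' c f g t) (ψ t x) := by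
  rw [← solU_comp t hψ, hψ.right]

lemma solW_eq (h : Data c r f g) (t : ℝ) (hψ : CircleChange (jac c f g t) (ψ t)) (x : ℝ) :
    solW c f g ψ t x = primF (jac'' c f g t) (ψ t x) := by
  rw [← h.solW_comp t hψ, hψ.right]

lemma solU_periodic (h : Data c r f g) (t : ℝ) (hψ : CircleChange (jac c f g t) (ψ t)) :
    Function.Periodic (solU c f g ψ t) 1 := fun x => by
  have e : primF (solUx c f g ψ t) 1 = 0 := by
    have := solU_comp t hψ 1
    rwa [h.primF_jac_one, h.primF_jac'_one] at this
  unfold solU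
  rw [primF_add_one (h.solUx_continuous t hψ) (h.solUx_periodic t hψ)]
  simpa [primF] using e

lemma solW_continuous_aux (h : Data c r f g) (t : ℝ) (hψ : CircleChange (jac c f g t) (ψ t)) :
    Continuous fun x => (solUx c f g ψ t x ^ 2 - solRho c f g ψ t x ^ 2) / 2 - 2 * c := by
  have := h.solUx_continuous t hψ
  have := h.solRho_continuous t hψ
  fun_prop

lemma solW_periodic (h : Data c r f g) (t : ℝ) (hψ : CircleChange (jac c f g t) (ψ t)) :
    Function.Periodic (solW c f g ψ t) 1 := fun x => by
  have e : solW c f g ψ t 1 = 0 := by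
    have := h.solW_comp t hψ 1
    rwa [h.primF_jac_one, h.primF_jac''_one] at this
  unfold solW
  rw [primF_add_one (h.solW_continuous_aux t hψ) fun x => by
    simp only [h.solUx_periodic t hψ x, h.solRho_periodic t hψ x]]
  unfold solW at e
  simpa [primF] using e

lemma isPrim_solU (h : Data c r f g) (t : ℝ) (hψ : CircleChange (jac c f g t) (ψ t)) :
    IsPrim (solU c f g ψ t) (solUx c f g ψ t) :=
  isPrim_primF fun a b => (h.solUx_continuous t hψ).intervalIntegrable a b

lemma isPrim_solW (h : Data c r f g) (t : ℝ) (hψ : CircleChange (jac c f g t) (ψ t)) :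
    IsPrim (solW c f g ψ t) fun x => (solUx c f g ψ t x ^ 2 - solRho c f g ψ t x ^ 2) / 2 - 2 * c :=
  isPrim_primF fun a b => (h.solW_continuous_aux t hψ).intervalIntegrable a b

lemma deriv_solU (h : Data c r f g) (t : ℝ) (hψ : CircleChange (jac c f g t) (ψ t)) :
    deriv (solU c f g ψ t) = solUx c f g ψ t := (h.isPrim_solU t hψ).deriv_eq (h.solUx_continuous t hψ)

lemma tendH_solU (h : Data c r f g) (hψ : ∀ t ∈ timeInterval T, CircleChange (jac c f g t) (ψ t))
    {t : ℝ} (ht : t ∈ timeInterval T) :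
    TendH (r + 1) (𝓝[timeInterval T] t) (solU c f g ψ) (solU c f g ψ t) := by
  refine TendH.of_prim (by linarith [h.hr]) (h.tendH_solUx hψ ht) ?_ ?_ (h.isPrim_solU t (hψ t ht))
    (h.solU_periodic t (hψ t ht)) ?_
  · filter_upwards [self_mem_nhdsWithin] with τ hτ using h.isPrim_solU τ (hψ τ hτ)
  · filter_upwards [self_mem_nhdsWithin] with τ hτ using h.solU_periodic τ (hψ τ hτ)
  · simp [solU, primF_zero, tendsto_const_nhds]

lemma tendH_solW (h : Data c r f g) (hψ : ∀ t ∈ timeInterval T, CircleChange (jac c f g t) (ψ t))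
    {t : ℝ} (ht : t ∈ timeInterval T) :
    TendH (r + 1) (𝓝[timeInterval T] t) (solW c f g ψ) (solW c f g ψ t) := by
  have hU := h.tendH_solUx hψ ht
  have hR := h.tendH_solRho hψ ht
  have hG : TendH r (𝓝[timeInterval T] t)
      (fun τ x => (solUx c f g ψ τ x ^ 2 - solRho c f g ψ τ x ^ 2) / 2 - 2 * c)
      (fun x => (solUx c f g ψ t x ^ 2 - solRho c f g ψ t x ^ 2) / 2 - 2 * c) := by
    have := (((hU.mul h.hr hU).sub (hR.mul h.hr hR)).const_mul (1 / 2)).sub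
      (TendH.const (memH_const r (2 * c)) _)
    convert! this using 3 <;> ring
  refine TendH.of_prim (by linarith [h.hr]) hG ?_ ?_ (h.isPrim_solW t (hψ t ht))
    (h.solW_periodic t (hψ t ht)) ?_
  · filter_upwards [self_mem_nhdsWithin] with τ hτ using h.isPrim_solW τ (hψ τ hτ)
  · filter_upwards [self_mem_nhdsWithin] with τ hτ using h.solW_periodic τ (hψ τ hτ)
  · simp [solW, primF_zero, tendsto_const_nhds]

lemma tendH_solV (h : Data c r f g) (hψ : ∀ t ∈ timeInterval T, CircleChange (jac c f g t) (ψ t))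
    {t : ℝ} (ht : t ∈ timeInterval T) :
    TendH r (𝓝[timeInterval T] t) (solV c f g ψ) (solV c f g ψ t) :=
  ((h.tendH_solW hψ ht).mono (by linarith)).sub
    (((h.tendH_solU hψ ht).mono (by linarith)).mul h.hr (h.tendH_solUx hψ ht))

/-- The only loss is in `ρ_x`, of order `r - 1 ≥ 0`; its factor `u` has order `r + 1`, well above
the gap needed for the product. -/
lemma tendH_solSigma (h : Data c r f g) (hψ : ∀ t ∈ timeInterval T, CircleChange (jac c f g t) (ψ t))
    {t : ℝ} (ht : t ∈ timeInterval T) :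
    TendH (r - 1) (𝓝[timeInterval T] t) (solSigma c f g ψ) (solSigma c f g ψ t) := by
  have hR := h.tendH_solRho hψ ht
  have h1 := ((h.tendH_solUx hψ ht).mul h.hr hR).mono (show r - 1 ≤ r by linarith)
  have hR' : TendH (r - 1) (𝓝[timeInterval T] t) (fun τ => deriv (solRho c f g ψ τ))
      (deriv (solRho c f g ψ t)) :=
    TendH.deriv (by linarith [h.hr]) (by simpa using hR)
  have h2 := TendH.mul_gap (by linarith [h.hr]) (by linarith) hR' (h.tendH_solU hψ ht)
  have := (h1.add h2).const_mul (-1)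
  have e : ∀ τ, solSigma c f g ψ τ = fun x => -1 * (solUx c f g ψ τ x * solRho c f g ψ τ x
      + deriv (solRho c f g ψ τ) x * solU c f g ψ τ x) := fun τ => by ext x; unfold solSigma; ring
  rw [e t]
  exact this.congr (Eventually.of_forall fun τ => (e τ).symm)

lemma isPrim_solRho (h : Data c r f g) {t : ℝ} (hm : MemH r (solRho c f g ψ t)) :
    IsPrim (solRho c f g ψ t) (deriv (solRho c f g ψ t)) :=
  (MemH.isPrim_deriv (q := r - 1) (by linarith [h.hr]) (by simpa using hm)).1

lemma isPrim_mul_solRho (h : Data c r f g) {t : ℝ} (hψ : CircleChange (jac c f g t) (ψ t))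
    (hm : MemH r (solRho c f g ψ t)) :
    IsPrim (fun x => solU c f g ψ t x * solRho c f g ψ t x) fun x => -solSigma c f g ψ t x := by
  convert (h.isPrim_solU t hψ).mul (h.isPrim_solRho hm) using 2
  simp [solSigma]

lemma continuous_uncurry_flow (h : Data c r f g) :
    Continuous fun p : ℝ × ℝ => primF (jac c f g p.1) p.2 := by
  simp only [h.primF_jac]
  have := continuous_cosC h.hc; have := continuous_sinC h.hc
  have := (isPrim_primF fun a b => h.cf.intervalIntegrable a b).continuous
  have := (isPrim_primF fun a b => h.ck.intervalIntegrable a b).continuous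
  fun_prop

lemma continuous_uncurry_flow' (h : Data c r f g) :
    Continuous fun p : ℝ × ℝ => primF (jac' c f g p.1) p.2 := by
  simp only [h.primF_jac']
  have := continuous_cosC h.hc; have := continuous_sinC h.hc
  have := (isPrim_primF fun a b => h.cf.intervalIntegrable a b).continuous
  have := (isPrim_primF fun a b => h.ck.intervalIntegrable a b).continuous
  fun_prop

lemma continuous_uncurry_flow'' (h : Data c r f g) :
    Continuous fun p : ℝ × ℝ => primF (jac'' c f g p.1) p.2 := by
  simp only [h.primF_jac'']
  have := continuous_cosC h.hc; have := continuous_sinC h.hc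
  have := (isPrim_primF fun a b => h.cf.intervalIntegrable a b).continuous
  have := (isPrim_primF fun a b => h.ck.intervalIntegrable a b).continuous
  fun_prop

lemma fourierC_solU {t : ℝ} (hψ : CircleChange (jac c f g t) (ψ t)) (n : ℤ) :
    fourierC (solU c f g ψ t) n = ∫ y in (0 : ℝ)..1,
      (jac c f g t y : ℂ) * (char n (primF (jac c f g t) y) * (primF (jac' c f g t) y : ℂ)) := by
  rw [← fourierC_comp hψ]
  congr 1; ext x; exact solU_eq t hψ x

/-- An exact derivative on the circle. -/
lemma integral_exact (h : Data c r f g) (t : ℝ) (n : ℤ) :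
    ∫ y in (0 : ℝ)..1, ((((-(2 * Real.pi * n) : ℝ) : ℂ) * Complex.I * char n (primF (jac c f g t) y)
      * (jac c f g t y : ℂ)) * (primF (jac' c f g t) y : ℂ) ^ 2
      + char n (primF (jac c f g t) y) * (2 * (primF (jac' c f g t) y : ℂ) * (jac' c f g t y : ℂ))) = 0 := by
  have cj := h.continuous_jac t; have cj' := h.continuous_jac' t
  have cF := (isPrim_primF fun a b => cj.intervalIntegrable a b).continuous
  have cF' := (isPrim_primF fun a b => cj'.intervalIntegrable a b).continuous
  have cc := (continuous_char n).comp cF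
  have hd : ∀ y, HasDerivAt (fun y => char n (primF (jac c f g t) y) * (primF (jac' c f g t) y : ℂ) ^ 2)
      ((((-(2 * Real.pi * n) : ℝ) : ℂ) * Complex.I * char n (primF (jac c f g t) y)
      * (jac c f g t y : ℂ)) * (primF (jac' c f g t) y : ℂ) ^ 2
      + char n (primF (jac c f g t) y) * (2 * (primF (jac' c f g t) y : ℂ) * (jac' c f g t y : ℂ))) y := by
    intro y
    have h1 := (hasDerivAt_char n (primF (jac c f g t) y)).scomp y (hasDerivAt_primF cj y)
    have h2 := ((hasDerivAt_primF cj' y).ofReal_comp).pow 2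
    refine (h1.mul h2).congr_deriv ?_
    simp only [Complex.real_smul, Function.comp, Pi.pow_apply]
    push_cast; ring
  rw [intervalIntegral.integral_eq_sub_of_hasDerivAt (fun y _ => hd y)]
  · simp [h.primF_jac'_one, primF_zero]
  · refine Continuous.intervalIntegrable ?_ _ _
    simp only [Function.comp_def] at cc
    fun_prop

/-- In Lagrangian form the `n`-th coefficient is `∫ J e(φ) φ_t`, where `e(x) = exp(-2πinx)`, and can
be differentiated under the integral. The outcome differs from the coefficient of `W - u u_x` by the
integral of the `y`-derivative of `e(φ) φ_t²`, which vanishes by `integral_exact`. -/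
lemma hasDerivH_solU (h : Data c r f g) (hψ : ∀ t ∈ timeInterval T, CircleChange (jac c f g t) (ψ t)) :
    HasDerivH r T (solU c f g ψ) (solV c f g ψ) := by
  refine hasDerivH_of_fourierC (contH_iff.2 fun t ht => (h.tendH_solU hψ ht).mono (by linarith))
    (contH_iff.2 fun t ht => h.tendH_solV hψ ht) fun n t ht => ?_
  have c1 := h.continuous_uncurry_jac; have c2 := h.continuous_uncurry_jac'
  have c3 := h.continuous_uncurry_flow; have c4 := h.continuous_uncurry_flow'
  have c5 := h.continuous_uncurry_flow''
  have c6 := (continuous_char n).comp c3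
  simp only [Function.uncurry_def, Function.comp_def] at c1 c2 c6
  have key := hasDerivAt_integral_of_continuous
    (G := fun τ y => (jac c f g τ y : ℂ) * (char n (primF (jac c f g τ) y) * (primF (jac' c f g τ) y : ℂ)))
    (G' := fun τ y => (jac' c f g τ y : ℂ) * (char n (primF (jac c f g τ) y) * (primF (jac' c f g τ) y : ℂ))
      + (jac c f g τ y : ℂ) * ((((-(2 * Real.pi * n) : ℝ) : ℂ) * Complex.I * char n (primF (jac c f g τ) y)
        * (primF (jac' c f g τ) y : ℂ)) * (primF (jac' c f g τ) y : ℂ)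
        + char n (primF (jac c f g τ) y) * (primF (jac'' c f g τ) y : ℂ)))
    (fun τ => by
      have d1 : Continuous fun y => jac c f g τ y := h.continuous_jac τ
      have d3 : Continuous fun y => primF (jac c f g τ) y := continuous_primF (h.continuous_jac τ)
      have d4 : Continuous fun y => primF (jac' c f g τ) y := continuous_primF (h.continuous_jac' τ)
      have d6 := (continuous_char n).comp d3
      simp only [Function.comp_def] at d6
      fun_prop)
    (by simp only [Function.uncurry_def]; fun_prop)
    (fun τ y => by
      have h1 := (h.hasDerivAt_jac τ y).ofReal_comp
      have h2 := (hasDerivAt_char n (primF (jac c f g τ) y)).scomp τ (h.hasDerivAt_flow τ y)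
      have h3 := (h.hasDerivAt_flow' τ y).ofReal_comp
      refine (h1.mul (h2.mul h3)).congr_deriv ?_
      simp only [Complex.real_smul, Function.comp, Pi.mul_apply]
      ring) t
  refine (key.hasDerivWithinAt.congr (fun τ hτ => fourierC_solU (hψ τ hτ) n)
    (fourierC_solU (hψ t ht) n)).congr_deriv ?_
  have e : solV c f g ψ t = fun x => primF (jac'' c f g t) (ψ t x)
      - primF (jac' c f g t) (ψ t x) * (jac' c f g t (ψ t x) * (jac c f g t (ψ t x))⁻¹) := by
    ext x; simp only [solV, h.solW_eq t (hψ t ht), solU_eq t (hψ t ht), solUx]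
  rw [e, fourierC_comp (hψ t ht) (fun y => primF (jac'' c f g t) y
      - primF (jac' c f g t) y * (jac' c f g t y * (jac c f g t y)⁻¹)), ← sub_eq_zero,
    ← intervalIntegral.integral_sub]
  · rw [← h.integral_exact t n]
    refine intervalIntegral.integral_congr fun y _ => ?_
    have h0 : (jac c f g t y : ℂ) ≠ 0 := by exact_mod_cast ((hψ t ht).pos y).ne'
    push_cast
    field_simp; ring
  all_goals
    have d1 : Continuous fun y => jac c f g t y := h.continuous_jac t
    have d2 : Continuous fun y => jac' c f g t y := h.continuous_jac' t
    have d3 : Continuous fun y => primF (jac c f g t) y := continuous_primF (h.continuous_jac t)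
    have d4 : Continuous fun y => primF (jac' c f g t) y := continuous_primF (h.continuous_jac' t)
    have d5 : Continuous fun y => primF (jac'' c f g t) y := continuous_primF (h.continuous_jac'' t)
    have d6 := (continuous_char n).comp d3
    have d7 : Continuous fun y => (jac c f g t y)⁻¹ := d1.inv₀ fun y => ((hψ t ht).pos y).ne'
    simp only [Function.comp_def] at d6
    exact Continuous.intervalIntegrable (by fun_prop) _ _

/-- Conservation of mass turns the `n`-th coefficient into `∫ e(φ) ρ₀`, with `e(x) = exp(-2πinx)`.
Its time derivative is `-2πin ∫ e(φ) φ_t ρ₀`, the coefficient of `-(uρ)_x`. -/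
lemma hasDerivH_solRho (h : Data c r f g) (hψ : ∀ t ∈ timeInterval T, CircleChange (jac c f g t) (ψ t)) :
    HasDerivH (r - 1) T (solRho c f g ψ) (solSigma c f g ψ) := by
  refine hasDerivH_of_fourierC (contH_iff.2 fun t ht => (h.tendH_solRho hψ ht).mono (by linarith))
    (contH_iff.2 fun t ht => h.tendH_solSigma hψ ht) fun n t ht => ?_
  have c3 := h.continuous_uncurry_flow; have c4 := h.continuous_uncurry_flow'
  have c6 := (continuous_char n).comp c3
  have cg := h.cg
  simp only [Function.comp_def] at c6
  have key := hasDerivAt_integral_of_continuous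
    (G := fun τ y => char n (primF (jac c f g τ) y) * (g y : ℂ))
    (G' := fun τ y => (((-(2 * Real.pi * n) : ℝ) : ℂ) * Complex.I * char n (primF (jac c f g τ) y)
        * (primF (jac' c f g τ) y : ℂ)) * (g y : ℂ))
    (fun τ => by
      have d3 : Continuous fun y => primF (jac c f g τ) y := continuous_primF (h.continuous_jac τ)
      have d6 := (continuous_char n).comp d3
      simp only [Function.comp_def] at d6
      fun_prop)
    (by simp only [Function.uncurry_def]; fun_prop)
    (fun τ y => by
      have h2 := (hasDerivAt_char n (primF (jac c f g τ) y)).scomp τ (h.hasDerivAt_flow τ y)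
      refine (h2.mul_const (g y : ℂ)).congr_deriv ?_
      simp only [Complex.real_smul]
      ring) t
  have hfc : ∀ τ ∈ timeInterval T, fourierC (solRho c f g ψ τ) n
      = ∫ y in (0 : ℝ)..1, char n (primF (jac c f g τ) y) * (g y : ℂ) := by
    intro τ hτ
    have := fourierC_comp (hψ τ hτ) (fun y => g y * (jac c f g τ y)⁻¹) n
    refine this.trans (intervalIntegral.integral_congr fun y _ => ?_)
    have h0 : (jac c f g τ y : ℂ) ≠ 0 := by exact_mod_cast ((hψ τ hτ).pos y).ne'
    push_cast; field_simp
  refine (key.hasDerivWithinAt.congr hfc (hfc t ht)).congr_deriv ?_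
  have hp : Function.Periodic (fun x => solU c f g ψ t x * solRho c f g ψ t x) 1 :=
    (h.solU_periodic t (hψ t ht)).mul (h.solRho_periodic t (hψ t ht))
  have h1 := (h.isPrim_mul_solRho (hψ t ht) (h.tendH_solRho hψ ht).lim_mem).fourierC_eq hp n
  have h2 := fourierC_const_mul (-1) (solSigma c f g ψ t) n
  simp only [neg_mul, one_mul] at h2
  have h3 : fourierC (solSigma c f g ψ t) n = -((2 * Real.pi * n : ℝ) * Complex.I
      * fourierC (fun x => solU c f g ψ t x * solRho c f g ψ t x) n) := by
    rw [← h1, h2]; push_cast; ring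
  have e : (fun x => solU c f g ψ t x * solRho c f g ψ t x) = fun x => primF (jac' c f g t) (ψ t x)
      * (g (ψ t x) * (jac c f g t (ψ t x))⁻¹) := by
    ext x; simp only [solU_eq t (hψ t ht), solRho]
  rw [h3, e, fourierC_comp (hψ t ht) (fun y => primF (jac' c f g t) y * (g y * (jac c f g t y)⁻¹)),
    ← intervalIntegral.integral_const_mul, ← intervalIntegral.integral_neg]
  refine intervalIntegral.integral_congr fun y _ => ?_
  have h0 : (jac c f g t y : ℂ) ≠ 0 := by exact_mod_cast ((hψ t ht).pos y).ne'
  push_cast; field_simp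

theorem isSolution (h : Data c r f g) (hT : 0 < T)
    (hψ : ∀ t ∈ timeInterval T, CircleChange (jac c f g t) (ψ t)) {u₀ : ℝ → ℝ} (hu : IsPrim u₀ f) (hu0 : u₀ 0 = 0) :
    IsSolution (-1) (r + 1) T u₀ g (solU c f g ψ) (solRho c f g ψ) := by
  have r1 : r + 1 - 1 = r := by ring
  have r2 : r + 1 - 2 = r - 1 := by ring
  have hj0 : jac c f g 0 = fun _ => 1 := by ext; simp [jac, cosC_zero, sinC_zero]
  have hj0' : jac' c f g 0 = f := by ext; simp [jac', cosC_zero, sinC_zero]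
  -- At time `0` the Jacobian is `1`, so the chosen inverse is the identity; this yields the initial
  -- data.
  have hψ0 : ∀ x, ψ 0 x = x := fun x => by
    have := (hψ 0 (zero_mem_timeInterval hT)).left x
    rw [hj0] at this
    simpa [primF] using this
  refine ⟨hT, contH_iff.2 fun t ht => h.tendH_solU hψ ht, fun t _ => by simp [solU, primF_zero],
    by rw [r1]; exact contH_iff.2 fun t ht => h.tendH_solRho hψ ht,
    ⟨solV c f g ψ, solSigma c f g ψ, by rw [r1]; exact contH_iff.2 fun t ht => h.tendH_solV hψ ht,
      fun t _ => by simp [solV, solW, solU, primF_zero], by rw [r1]; exact h.hasDerivH_solU hψ,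
      by rw [r2]; exact contH_iff.2 fun t ht => h.tendH_solSigma hψ ht,
      by rw [r2]; exact h.hasDerivH_solRho hψ, fun t ht => ⟨?_, ?_⟩⟩, ?_, ?_⟩
  · have e : (fun x => solV c f g ψ t x + solU c f g ψ t x * deriv (solU c f g ψ t) x) = solW c f g ψ t := by
      ext x; simp only [h.deriv_solU t (hψ t ht), solV]; ring
    refine weakMomentumEq_of_isPrim (k := 2 * c) ?_ (h.solRho_continuous t (hψ t ht)) ?_ ?_
    · rw [h.deriv_solU t (hψ t ht)]; exact h.solUx_continuous t (hψ t ht)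
    · rw [e]; exact h.solW_periodic t (hψ t ht)
    · rw [e, h.deriv_solU t (hψ t ht)]; exact h.isPrim_solW t (hψ t ht)
  · exact weakContinuityEq_of_isPrim ((h.solU_periodic t (hψ t ht)).mul (h.solRho_periodic t (hψ t ht)))
      (h.isPrim_mul_solRho (hψ t ht) (h.tendH_solRho hψ ht).lim_mem)
  · ext x
    rw [solU_eq 0 (hψ 0 (zero_mem_timeInterval hT)), hψ0, hj0', hu.eq x, hu0, zero_add, primF]
  · ext x
    simp [solRho, hψ0, hj0]

end Data

/-! ### Weak solutions satisfy the equations almost everywhere -/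

lemma isTest_cos (n : ℤ) : IsTest fun x => Real.cos (2 * Real.pi * n * x) :=
  ⟨by fun_prop, periodic_cos n⟩

lemma isTest_sin (n : ℤ) : IsTest fun x => Real.sin (2 * Real.pi * n * x) :=
  ⟨by fun_prop, periodic_sin n⟩

lemma deriv_cos_mul (a : ℝ) : deriv (fun x => Real.cos (a * x)) = fun x => -(a * Real.sin (a * x)) :=
  (isPrim_cos a).deriv_eq (by fun_prop)

lemma deriv_sin_mul (a : ℝ) : deriv (fun x => Real.sin (a * x)) = fun x => a * Real.cos (a * x) :=
  (isPrim_sin a).deriv_eq (by fun_prop)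

lemma deriv_deriv_cos_mul (a : ℝ) :
    deriv (deriv fun x => Real.cos (a * x)) = fun x => -a ^ 2 * Real.cos (a * x) := by
  rw [deriv_cos_mul]
  have := ((isPrim_sin a).const_mul (-a)).deriv_eq (by fun_prop)
  have e : (fun x => -(a * Real.sin (a * x))) = fun x => -a * Real.sin (a * x) := by ext; ring
  rw [e, this]; ext; ring

lemma deriv_deriv_sin_mul (a : ℝ) :
    deriv (deriv fun x => Real.sin (a * x)) = fun x => -a ^ 2 * Real.sin (a * x) := by
  rw [deriv_sin_mul]
  have := ((isPrim_cos a).const_mul a).deriv_eq (by fun_prop)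
  rw [this]; ext; ring

/-- A continuous function that is weakly orthogonal to all second derivatives is constant. -/
lemma eq_const_of_integral_deriv_deriv {f : ℝ → ℝ} (hf : Continuous f) (hp : Function.Periodic f 1)
    (h : ∀ ζ, IsTest ζ → ∫ x in (0 : ℝ)..1, f x * deriv (deriv ζ) x = 0) (x : ℝ) : f x = f 0 := by
  have key : ∀ n : ℤ, n ≠ 0 → fourierC f n = 0 := by
    intro n hn
    have ha : (2 * Real.pi * n) ^ 2 ≠ 0 := by
      have := Real.pi_ne_zero
      have : (n : ℝ) ≠ 0 := by exact_mod_cast hn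
      positivity
    have h1 := h _ (isTest_cos n)
    have h2 := h _ (isTest_sin n)
    rw [deriv_deriv_cos_mul] at h1
    rw [deriv_deriv_sin_mul] at h2
    have e1 : ∀ x, f x * (-(2 * Real.pi * n) ^ 2 * Real.cos (2 * Real.pi * n * x))
      = -(2 * Real.pi * n) ^ 2 * (f x * Real.cos (2 * Real.pi * n * x)) := fun x => by ring
    have e2 : ∀ x, f x * (-(2 * Real.pi * n) ^ 2 * Real.sin (2 * Real.pi * n * x))
      = -(2 * Real.pi * n) ^ 2 * (f x * Real.sin (2 * Real.pi * n * x)) := fun x => by ring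
    simp only [e1, e2, intervalIntegral.integral_const_mul] at h1 h2
    have h1' := (mul_eq_zero.1 h1).resolve_left (neg_ne_zero.2 ha)
    have h2' := (mul_eq_zero.1 h2).resolve_left (neg_ne_zero.2 ha)
    rw [fourierC_eq_cos_sin (hf.intervalIntegrable _ _), h1', h2']
    simp
  have : f = fun _ => ∫ x in (0 : ℝ)..1, f x := by
    refine eq_of_fourierC_eq hf continuous_const hp (fun _ => rfl) fun n => ?_
    have e := fourierC_const_mul (∫ x in (0 : ℝ)..1, f x) (fun _ => 1) n
    simp only [mul_one] at e
    rw [e, fourierC_one]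
    split_ifs with hn
    · rw [hn, fourierC_eq_cos_sin (hf.intervalIntegrable _ _)]; simp
    · rw [key n hn]; simp
  rw [this]

/-- Subtracting the mean `k` makes the primitive `P` of `H - k` periodic. The weak equation then
says that `v + u u_x - P` is orthogonal to all second derivatives of test functions, hence constant.
-/
lemma exists_isPrim_of_weakMomentumEq {u v ρ : ℝ → ℝ} (hu' : Continuous (deriv u)) (hρ : Continuous ρ)
    (hup : Function.Periodic u 1) (hρp : Function.Periodic ρ 1) (hvp : Function.Periodic v 1)
    (hu : Continuous u) (hv : Continuous v) (h : WeakMomentumEq (-1) u v ρ) :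
    ∃ k, IsPrim (fun x => v x + u x * deriv u x) fun x => (deriv u x ^ 2 - ρ x ^ 2) / 2 - k := by
  set H : ℝ → ℝ := fun x => (deriv u x ^ 2 - ρ x ^ 2) / 2 with hH
  have hHc : Continuous H := by fun_prop
  have hu'p := periodic_deriv hup
  set k := ∫ x in (0 : ℝ)..1, H x with hk
  refine ⟨k, ?_⟩
  have hP : IsPrim (primF fun x => H x - k) fun x => H x - k :=
    isPrim_primF fun a b => (hHc.sub continuous_const).intervalIntegrable a b
  have hPp : Function.Periodic (primF fun x => H x - k) 1 := fun x => by
    rw [primF_add_one (by fun_prop) fun x => by simp only [hH, hu'p x, hρp x],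
      intervalIntegral.integral_sub (hHc.intervalIntegrable _ _) (by simp)]
    simp [hk]
  have key := eq_const_of_integral_deriv_deriv
    (f := fun x => (v x + u x * deriv u x) - primF (fun x => H x - k) x)
    ((hv.add (hu.mul hu')).sub hP.continuous)
    (fun x => by simp only [hvp x, hup x, hu'p x, hPp x]) fun ζ hζ => by
      have h1 := hP.integral_mul_eq hζ.deriv.isPrim hPp hζ.deriv.2
      have h2 := hζ.isPrim.integral_deriv_eq_zero hζ.2
      have h3 := h ζ hζ
      have c1 := hζ.deriv.continuous
      have c2 := hζ.deriv.deriv.continuous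
      have c3 := hP.continuous
      have e : ∀ x, (-(v x + u x * deriv u x) * deriv (deriv ζ) x
        - (1 / 2) * ((deriv u x) ^ 2 + (-1) * (ρ x) ^ 2) * deriv ζ x)
        = -(((v x + u x * deriv u x) - primF (fun x => H x - k) x) * deriv (deriv ζ) x)
          - primF (fun x => H x - k) x * deriv (deriv ζ) x
          - ((H x - k) * deriv ζ x + k * deriv ζ x) := fun x => by simp only [hH]; ring
      simp only [e] at h3
      rw [intervalIntegral.integral_sub, intervalIntegral.integral_sub, intervalIntegral.integral_neg,
        intervalIntegral.integral_add, intervalIntegral.integral_const_mul, h1, h2] at h3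
      · linarith
      all_goals exact Continuous.intervalIntegrable (by fun_prop) _ _
  refine ⟨hP.int, fun x => ?_⟩
  have := key x
  have e := hP.eq x
  rw [primF_zero] at this e
  linarith

lemma ae_eq_of_weakContinuityEq {u ρ σ τ : ℝ → ℝ} (hσ : MemH 0 σ) (hτp : Function.Periodic τ 1)
    (hτ : MemLp τ 2 (volume.restrict (Ioc 0 1))) (hp : Function.Periodic (fun x => u x * ρ x) 1)
    (h : IsPrim (fun x => u x * ρ x) τ) (hw : WeakContinuityEq u ρ σ) : σ =ᵐ[volume] fun x => -τ x := by
  refine ae_eq_of_periodic hσ.periodic (fun x => by simp only [hτp x])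
    (ae_eq_of_fourierC_eq hσ.memLp hτ.neg fun n => ?_)
  have e := fourierC_const_mul (-1) τ n
  have e' : fourierC (fun x => -τ x) n = -fourierC τ n := by
    simpa using e
  change fourierC σ n = fourierC (fun x => -τ x) n
  have hc := h.continuous
  have h1 := hw _ (isTest_cos n)
  have h2 := hw _ (isTest_sin n)
  rw [deriv_cos_mul] at h1
  rw [deriv_sin_mul] at h2
  have s1 : IntervalIntegrable (fun x => σ x * Real.cos (2 * Real.pi * n * x)) volume 0 1 :=
    hσ.intervalIntegrable.mul_continuousOn (by fun_prop)
  have s2 : IntervalIntegrable (fun x => σ x * Real.sin (2 * Real.pi * n * x)) volume 0 1 :=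
    hσ.intervalIntegrable.mul_continuousOn (by fun_prop)
  rw [intervalIntegral.integral_sub s1 (Continuous.intervalIntegrable (by fun_prop) _ _)] at h1
  rw [intervalIntegral.integral_sub s2 (Continuous.intervalIntegrable (by fun_prop) _ _)] at h2
  have e1 : ∀ x, u x * ρ x * -(2 * Real.pi * n * Real.sin (2 * Real.pi * n * x))
    = -(2 * Real.pi * n) * (u x * ρ x * Real.sin (2 * Real.pi * n * x)) := fun x => by ring
  have e2 : ∀ x, u x * ρ x * (2 * Real.pi * n * Real.cos (2 * Real.pi * n * x))
    = (2 * Real.pi * n) * (u x * ρ x * Real.cos (2 * Real.pi * n * x)) := fun x => by ring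
  simp only [e1, e2, intervalIntegral.integral_const_mul] at h1 h2
  rw [e', h.fourierC_eq hp, fourierC_eq_cos_sin hσ.intervalIntegrable,
    fourierC_eq_cos_sin (hc.intervalIntegrable _ _), sub_eq_zero.1 h1, sub_eq_zero.1 h2]
  push_cast
  linear_combination (2 * Real.pi * n * (∫ x in (0 : ℝ)..1, u x * ρ x * Real.sin (2 * Real.pi * n * x) : ℝ) : ℂ)
    * -Complex.I_sq

/-- The equations at a fixed time, in strong form. -/
structure Strong (u v ρ σ : ℝ → ℝ) : Prop where
  zero : u 0 = 0
  per_u : Function.Periodic u 1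
  per_ρ : Function.Periodic ρ 1
  prim_u : IsPrim u (deriv u)
  prim_u' : IsPrim (deriv u) (deriv (deriv u))
  prim_ρ : IsPrim ρ (deriv ρ)
  mem_u'' : MemH 0 (deriv (deriv u))
  mem_ρ' : MemH 0 (deriv ρ)
  mem_v' : MemH 0 (deriv v)
  mem_σ : MemH 0 σ
  momentum : ∃ k, deriv v =ᵐ[volume] fun x =>
    -(deriv u x ^ 2 + ρ x ^ 2) / 2 - k - u x * deriv (deriv u) x
  continuity : σ =ᵐ[volume] fun x => -(deriv u x * ρ x + u x * deriv ρ x)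

/-- The hypothesis `s ≥ 2` puts `u_xx`, `ρ_x`, `v_x` and `σ` in `L²`, the least regularity at which
the equations can be tested with differences of solutions. -/
lemma strong_of_weak {s : ℝ} (hs : 2 ≤ s) {u v ρ σ : ℝ → ℝ} (hu : MemH s u) (hv : MemH (s - 1) v)
    (hρ : MemH (s - 1) ρ) (hσ : MemH (s - 2) σ) (hu0 : u 0 = 0)
    (hm : WeakMomentumEq (-1) u v ρ) (hc : WeakContinuityEq u ρ σ) : Strong u v ρ σ := by
  obtain ⟨pu, mu'⟩ := MemH.isPrim_deriv (q := s - 1) (by linarith) (by simpa using hu)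
  obtain ⟨pu', mu''⟩ := MemH.isPrim_deriv (q := s - 2) (by linarith) (mu'.mono (by linarith))
  obtain ⟨pρ, mρ'⟩ := MemH.isPrim_deriv (q := s - 2) (by linarith) (hρ.mono (by linarith))
  obtain ⟨pv, mv'⟩ := MemH.isPrim_deriv (q := s - 2) (by linarith) (hv.mono (by linarith))
  have hs0 : (0 : ℝ) ≤ s - 2 := by linarith
  have hup := hu.periodic
  have hup' := mu'.periodic
  have hρp := hρ.periodic
  have hρp' := mρ'.periodic
  refine ⟨hu0, hup, hρp, pu, pu', pρ, mu''.mono hs0, mρ'.mono hs0, mv'.mono hs0, hσ.mono hs0, ?_, ?_⟩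
  · obtain ⟨k, hk⟩ := exists_isPrim_of_weakMomentumEq pu'.continuous pρ.continuous hup hρp hv.periodic
      pu.continuous pv.continuous hm
    refine ⟨k, ?_⟩
    have := (pv.add (pu.mul pu')).ae_unique hk
    filter_upwards [this] with x hx
    linarith
  · refine ae_eq_of_weakContinuityEq (τ := fun x => deriv u x * ρ x + u x * deriv ρ x) (hσ.mono hs0) ?_ ?_
      (hup.mul hρp) (pu.mul pρ) hc
    · exact (hup'.mul hρp).add (hup.mul hρp')
    · refine (memLp_of_continuous (pu'.continuous.mul pρ.continuous)).add ?_
      have := memLp_mul_continuous mρ'.memLp pu.continuous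
      simpa only [mul_comm] using this

/-! ### Uniqueness by an energy estimate -/

lemma MemH.integrable_sq {f : ℝ → ℝ} (h : MemH 0 f) : IntervalIntegrable (fun x => f x ^ 2) volume 0 1 := by
  rw [intervalIntegrable_iff_integrableOn_Ioc_of_le zero_le_one]
  exact h.memLp.integrable_sq

/-- The differential inequality for the distance of two solutions. -/
lemma abs_integral_le {u₁ v₁ ρ₁ σ₁ u₂ v₂ ρ₂ σ₂ : ℝ → ℝ} (h₁ : Strong u₁ v₁ ρ₁ σ₁) (h₂ : Strong u₂ v₂ ρ₂ σ₂)
    {M N : ℝ} (b1 : ∀ x, |deriv u₁ x| ≤ M) (b2 : ∀ x, |deriv u₂ x| ≤ M)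
    (b3 : ∀ x, |ρ₁ x| ≤ M) (b4 : ∀ x, |ρ₂ x| ≤ M)
    (hN : ∫ x in (0 : ℝ)..1, (deriv (deriv u₂) x ^ 2 + deriv ρ₂ x ^ 2) ≤ N) :
    |∫ x in (0 : ℝ)..1, (2 * (deriv u₁ x - deriv u₂ x) * (deriv v₁ x - deriv v₂ x)
      + 2 * (ρ₁ x - ρ₂ x) * (σ₁ x - σ₂ x))| ≤
      (3 * M + 1 + 2 * N) * ∫ x in (0 : ℝ)..1, ((deriv u₁ x - deriv u₂ x) ^ 2 + (ρ₁ x - ρ₂ x) ^ 2) := by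
  obtain ⟨k₁, m₁⟩ := h₁.momentum
  obtain ⟨k₂, m₂⟩ := h₂.momentum
  set E := ∫ x in (0 : ℝ)..1, ((deriv u₁ x - deriv u₂ x) ^ 2 + (ρ₁ x - ρ₂ x) ^ 2) with hE
  have cu1 := h₁.prim_u'.continuous
  have cu2 := h₂.prim_u'.continuous
  have cr1 := h₁.prim_ρ.continuous
  have cr2 := h₂.prim_ρ.continuous
  have cU1 := h₁.prim_u.continuous
  have cU2 := h₂.prim_u.continuous
  have hp := h₁.prim_u'.sub h₂.prim_u'
  have hq := h₁.prim_ρ.sub h₂.prim_ρ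
  have hw := h₁.prim_u.sub h₂.prim_u
  -- Writing `p`, `q` for the differences of the slopes and densities, the exact derivative of `u₁
  -- (p² + q²)` absorbs the transport terms, the only ones containing derivatives of `p` and `q`.
  have hD := h₁.prim_u.mul ((hp.mul hp).add (hq.mul hq))
  have hDp : Function.Periodic (fun x => u₁ x * ((deriv u₁ x - deriv u₂ x) * (deriv u₁ x - deriv u₂ x)
      + (ρ₁ x - ρ₂ x) * (ρ₁ x - ρ₂ x))) 1 := fun x => by
    simp only [h₁.per_u x, periodic_deriv h₁.per_u x, periodic_deriv h₂.per_u x, h₁.per_ρ x, h₂.per_ρ x]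
  have hD0 := hD.integral_deriv_eq_zero hDp
  -- The difference of the slopes has mean zero, which removes the unknown constants `k₁ - k₂`.
  have hw0 := hw.integral_deriv_eq_zero (h₁.per_u.sub h₂.per_u)
  -- What remains is quadratic in the differences; the second derivative and the density slope occur
  -- only for the second solution and are multiplied by `u₁ - u₂`.
  set Q : ℝ → ℝ := fun x => -(deriv u₂ x * (deriv u₁ x - deriv u₂ x) ^ 2)
    - (ρ₁ x + 3 * ρ₂ x) * ((deriv u₁ x - deriv u₂ x) * (ρ₁ x - ρ₂ x)) - deriv u₁ x * (ρ₁ x - ρ₂ x) ^ 2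
    - 2 * (u₁ x - u₂ x) * (deriv u₁ x - deriv u₂ x) * deriv (deriv u₂) x
    - 2 * (u₁ x - u₂ x) * (ρ₁ x - ρ₂ x) * deriv ρ₂ x with hQ
  have iJ : IntervalIntegrable (fun x => 2 * (deriv u₁ x - deriv u₂ x) * (deriv v₁ x - deriv v₂ x)
      + 2 * (ρ₁ x - ρ₂ x) * (σ₁ x - σ₂ x)) volume 0 1 :=
    ((h₁.mem_v'.intervalIntegrable.sub h₂.mem_v'.intervalIntegrable).continuousOn_mul
      (Continuous.continuousOn (by fun_prop))).add
    ((h₁.mem_σ.intervalIntegrable.sub h₂.mem_σ.intervalIntegrable).continuousOn_mul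
      (Continuous.continuousOn (by fun_prop)))
  have iQ : IntervalIntegrable Q volume 0 1 :=
    ((Continuous.intervalIntegrable (by fun_prop) _ _).sub
      (h₂.mem_u''.intervalIntegrable.continuousOn_mul (Continuous.continuousOn (by fun_prop)))).sub
      (h₂.mem_ρ'.intervalIntegrable.continuousOn_mul (Continuous.continuousOn (by fun_prop)))
  have hJQ : ∫ x in (0 : ℝ)..1, (2 * (deriv u₁ x - deriv u₂ x) * (deriv v₁ x - deriv v₂ x)
      + 2 * (ρ₁ x - ρ₂ x) * (σ₁ x - σ₂ x)) = ∫ x in (0 : ℝ)..1, Q x := by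
    have i3 : IntervalIntegrable (fun x => 2 * (k₁ - k₂) * (deriv u₁ x - deriv u₂ x)) volume 0 1 :=
      Continuous.intervalIntegrable (by fun_prop) _ _
    have e : ∫ x in (0 : ℝ)..1, ((2 * (deriv u₁ x - deriv u₂ x) * (deriv v₁ x - deriv v₂ x)
      + 2 * (ρ₁ x - ρ₂ x) * (σ₁ x - σ₂ x)) +
      (deriv u₁ x * ((deriv u₁ x - deriv u₂ x) * (deriv u₁ x - deriv u₂ x)
      + (ρ₁ x - ρ₂ x) * (ρ₁ x - ρ₂ x)) + u₁ x * (((deriv (deriv u₁) x - deriv (deriv u₂) x) *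
        (deriv u₁ x - deriv u₂ x) + (deriv u₁ x - deriv u₂ x) * (deriv (deriv u₁) x - deriv (deriv u₂) x))
        + ((deriv ρ₁ x - deriv ρ₂ x) * (ρ₁ x - ρ₂ x) + (ρ₁ x - ρ₂ x) * (deriv ρ₁ x - deriv ρ₂ x))))
      + 2 * (k₁ - k₂) * (deriv u₁ x - deriv u₂ x)) = ∫ x in (0 : ℝ)..1, Q x := by
      refine intervalIntegral.integral_congr_ae ?_
      filter_upwards [m₁, m₂, h₁.continuity, h₂.continuity] with x a1 a2 a3 a4 _
      rw [a1, a2, a3, a4, hQ]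
      ring
    rw [← e, intervalIntegral.integral_add (iJ.add (hD.int 0 1)) i3, intervalIntegral.integral_add iJ (hD.int 0 1),
      intervalIntegral.integral_const_mul, hD0, hw0]
    ring
  rw [hJQ]
  have hM : 0 ≤ M := (abs_nonneg _).trans (b1 0)
  have hE0 : 0 ≤ E := intervalIntegral.integral_nonneg zero_le_one fun x _ => by positivity
  have iE : IntervalIntegrable (fun x => (deriv u₁ x - deriv u₂ x) ^ 2 + (ρ₁ x - ρ₂ x) ^ 2) volume 0 1 :=
    Continuous.intervalIntegrable (by fun_prop) _ _
  have iN := h₂.mem_u''.integrable_sq.add h₂.mem_ρ'.integrable_sq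
  -- Both velocities vanish at `0`, so their difference is bounded pointwise by the `L²` norm of its
  -- derivative.
  have hwE : ∀ x ∈ Icc (0 : ℝ) 1, (u₁ x - u₂ x) ^ 2 ≤ 2 * E := by
    intro x hx
    have a := integral_sq_prim_le hw (memLp_of_continuous (by fun_prop)) hx
    simp only [h₁.zero, h₂.zero, sub_self] at a
    have b : ∫ y in (0 : ℝ)..1, (deriv u₁ y - deriv u₂ y) ^ 2 ≤ E :=
      intervalIntegral.integral_mono_on zero_le_one (Continuous.intervalIntegrable (by fun_prop) _ _) iE
        fun y _ => by nlinarith [sq_nonneg (ρ₁ y - ρ₂ y)]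
    linarith
  have hQb : ∀ x ∈ Icc (0 : ℝ) 1, |Q x| ≤ (3 * M + 1) * ((deriv u₁ x - deriv u₂ x) ^ 2 + (ρ₁ x - ρ₂ x) ^ 2)
      + 2 * E * (deriv (deriv u₂) x ^ 2 + deriv ρ₂ x ^ 2) := by
    intro x hx
    have hwx := hwE x hx
    have c1 := abs_le.1 (b1 x); have c2 := abs_le.1 (b2 x)
    have c3 := abs_le.1 (b3 x); have c4 := abs_le.1 (b4 x)
    simp only [hQ]
    generalize deriv u₁ x = p1 at *
    generalize deriv u₂ x = p2 at *
    generalize ρ₁ x = q1 at *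
    generalize ρ₂ x = q2 at *
    generalize deriv (deriv u₂) x = a at *
    generalize deriv ρ₂ x = b at *
    generalize u₁ x - u₂ x = w at *
    have t1 : |p2 * (p1 - p2) ^ 2| ≤ M * (p1 - p2) ^ 2 := by
      rw [abs_mul, abs_of_nonneg (sq_nonneg (p1 - p2))]
      exact mul_le_mul_of_nonneg_right (abs_le.2 c2) (sq_nonneg _)
    have t2 : |(q1 + 3 * q2) * ((p1 - p2) * (q1 - q2))| ≤ 2 * M * ((p1 - p2) ^ 2 + (q1 - q2) ^ 2) := by
      rw [abs_mul]
      have d1 : |q1 + 3 * q2| ≤ 4 * M := abs_le.2 ⟨by linarith, by linarith⟩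
      have d2 : |(p1 - p2) * (q1 - q2)| ≤ ((p1 - p2) ^ 2 + (q1 - q2) ^ 2) / 2 :=
        abs_le.2 ⟨by nlinarith [sq_nonneg ((p1 - p2) + (q1 - q2))],
          by nlinarith [sq_nonneg ((p1 - p2) - (q1 - q2))]⟩
      calc _ ≤ 4 * M * (((p1 - p2) ^ 2 + (q1 - q2) ^ 2) / 2) :=
            mul_le_mul d1 d2 (abs_nonneg _) (by linarith)
        _ = _ := by ring
    have t3 : |p1 * (q1 - q2) ^ 2| ≤ M * (q1 - q2) ^ 2 := by
      rw [abs_mul, abs_of_nonneg (sq_nonneg (q1 - q2))]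
      exact mul_le_mul_of_nonneg_right (abs_le.2 c1) (sq_nonneg _)
    have t4 : ∀ p a : ℝ, |2 * w * p * a| ≤ p ^ 2 + 2 * E * a ^ 2 := by
      intro p a
      have d := mul_le_mul_of_nonneg_right hwx (sq_nonneg a)
      exact abs_le.2 ⟨by nlinarith [sq_nonneg (p + w * a)], by nlinarith [sq_nonneg (p - w * a)]⟩
    have t5 := t4 (p1 - p2) a
    have t6 := t4 (q1 - q2) b
    rw [abs_le] at *
    constructor <;> linarith
  have iB := (iE.const_mul (3 * M + 1)).add (iN.const_mul (2 * E))
  calc |∫ x in (0 : ℝ)..1, Q x| ≤ ∫ x in (0 : ℝ)..1, |Q x| :=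
        intervalIntegral.abs_integral_le_integral_abs zero_le_one
    _ ≤ ∫ x in (0 : ℝ)..1, ((3 * M + 1) * ((deriv u₁ x - deriv u₂ x) ^ 2 + (ρ₁ x - ρ₂ x) ^ 2)
      + 2 * E * (deriv (deriv u₂) x ^ 2 + deriv ρ₂ x ^ 2)) :=
        intervalIntegral.integral_mono_on zero_le_one iQ.abs iB hQb
    _ = (3 * M + 1) * E + 2 * E * ∫ x in (0 : ℝ)..1, (deriv (deriv u₂) x ^ 2 + deriv ρ₂ x ^ 2) := by
        rw [intervalIntegral.integral_add (iE.const_mul _) (iN.const_mul _),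
          intervalIntegral.integral_const_mul, intervalIntegral.integral_const_mul]
    _ ≤ _ := by nlinarith

lemma MemH.integrable_mul {f g : ℝ → ℝ} (hf : MemH 0 f) (hg : MemH 0 g) :
    IntervalIntegrable (fun x => f x * g x) volume 0 1 := by
  rw [intervalIntegrable_iff_integrableOn_Ioc_of_le zero_le_one]
  exact hf.memLp.integrable_mul hg.memLp

/-- The Cauchy–Schwarz inequality on a period. -/
lemma sq_integral_mul_le {f g : ℝ → ℝ} (hf : MemH 0 f) (hg : MemH 0 g) :
    (∫ x in (0 : ℝ)..1, f x * g x) ^ 2 ≤ normSq 0 f * normSq 0 g := by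
  rw [normSq_zero_eq hf.memLp, normSq_zero_eq hg.memLp]
  have key : ∀ a : ℝ, 0 ≤ (∫ x in (0 : ℝ)..1, g x ^ 2) * (a * a)
      + (2 * ∫ x in (0 : ℝ)..1, f x * g x) * a + ∫ x in (0 : ℝ)..1, f x ^ 2 := by
    intro a
    have e : ∫ x in (0 : ℝ)..1, (f x + a * g x) ^ 2 = (∫ x in (0 : ℝ)..1, g x ^ 2) * (a * a)
      + (2 * ∫ x in (0 : ℝ)..1, f x * g x) * a + ∫ x in (0 : ℝ)..1, f x ^ 2 := by
      have e1 : ∀ x, (f x + a * g x) ^ 2 = (a * a) * g x ^ 2 + (2 * a) * (f x * g x) + f x ^ 2 :=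
        fun x => by ring
      simp only [e1]
      rw [intervalIntegral.integral_add ((hg.integrable_sq.const_mul _).add ((hf.integrable_mul hg).const_mul _))
        hf.integrable_sq, intervalIntegral.integral_add (hg.integrable_sq.const_mul _)
        ((hf.integrable_mul hg).const_mul _), intervalIntegral.integral_const_mul,
        intervalIntegral.integral_const_mul]
      ring
    rw [← e]
    exact intervalIntegral.integral_nonneg zero_le_one fun x _ => sq_nonneg _
  have := discrim_le_zero key
  rw [discrim] at this
  linarith

lemma TendH.tendsto_integral_mul {ι : Type*} {l : Filter ι} {F G : ι → ℝ → ℝ} {f g : ℝ → ℝ}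
    (hF : TendH 0 l F f) (hG : TendH 0 l G g) :
    Tendsto (fun i => ∫ x in (0 : ℝ)..1, F i x * G i x) l (𝓝 (∫ x in (0 : ℝ)..1, f x * g x)) := by
  have aux : ∀ {A B : ι → ℝ → ℝ} {b : ι → ℝ} {b₀ : ℝ}, (∀ᶠ i in l, MemH 0 (A i)) → (∀ᶠ i in l, MemH 0 (B i)) →
      Tendsto (fun i => normSq 0 (A i)) l (𝓝 0) → (∀ᶠ i in l, normSq 0 (B i) ≤ b i) → Tendsto b l (𝓝 b₀) →
      Tendsto (fun i => ∫ x in (0 : ℝ)..1, A i x * B i x) l (𝓝 0) := by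
    intro A B b b₀ hA hB h0 hb hb0
    have h1 : Tendsto (fun i => (∫ x in (0 : ℝ)..1, A i x * B i x) ^ 2) l (𝓝 0) := by
      refine tendsto_of_tendsto_of_tendsto_of_le_of_le' tendsto_const_nhds
        (by simpa using h0.mul hb0) (Eventually.of_forall fun i => sq_nonneg _) ?_
      filter_upwards [hA, hB, hb] with i a b c
      exact (sq_integral_mul_le a b).trans (mul_le_mul_of_nonneg_left c (normSq_nonneg _ _))
    have h2 := h1.sqrt
    simp only [Real.sqrt_sq_eq_abs, Real.sqrt_zero] at h2
    exact (tendsto_zero_iff_abs_tendsto_zero _).2 h2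
  have hFf : ∀ᶠ i in l, MemH 0 fun x => F i x - f x := hF.mem.mono fun i hi => hi.sub hF.lim_mem
  have hGg : ∀ᶠ i in l, MemH 0 fun x => G i x - g x := hG.mem.mono fun i hi => hi.sub hG.lim_mem
  have t1 := aux hFf hGg hF.tendsto (Eventually.of_forall fun i => le_rfl) hG.tendsto
  have t2 := aux (B := fun _ => g) hFf (Eventually.of_forall fun _ => hG.lim_mem) hF.tendsto
    (Eventually.of_forall fun i => le_rfl) tendsto_const_nhds
  have t3 := aux (B := fun _ => f) hGg (Eventually.of_forall fun _ => hF.lim_mem) hG.tendsto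
    (Eventually.of_forall fun i => le_rfl) tendsto_const_nhds
  have t := ((t1.add t2).add t3).add_const (∫ x in (0 : ℝ)..1, f x * g x)
  simp only [add_zero, zero_add] at t
  refine t.congr' ?_
  filter_upwards [hF.mem, hG.mem, hFf, hGg] with i a b c d
  rw [← intervalIntegral.integral_add (c.integrable_mul d) (c.integrable_mul hG.lim_mem),
    ← intervalIntegral.integral_add ((c.integrable_mul d).add (c.integrable_mul hG.lim_mem))
      (d.integrable_mul hF.lim_mem),
    ← intervalIntegral.integral_add (((c.integrable_mul d).add (c.integrable_mul hG.lim_mem)).add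
      (d.integrable_mul hF.lim_mem)) (hF.lim_mem.integrable_mul hG.lim_mem)]
  refine intervalIntegral.integral_congr fun x _ => ?_
  ring

/-- Difference quotients that converge in `H^r`, as `TendH`. -/
lemma HasDerivH.tendH {r : ℝ} {T : EReal} {w v : ℝ → ℝ → ℝ} (h : HasDerivH r T w v)
    (hw : ∀ t ∈ timeInterval T, MemH r (w t)) (hv : ∀ t ∈ timeInterval T, MemH r (v t))
    {t : ℝ} (ht : t ∈ timeInterval T) :
    TendH r (𝓝[timeInterval T \ {t}] t) (fun τ x => (τ - t)⁻¹ * (w τ x - w t x)) (v t) where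
  mem := by
    filter_upwards [self_mem_nhdsWithin] with τ hτ
    exact ((hw τ hτ.1).sub (hw t ht)).const_mul _
  lim_mem := hv t ht
  tendsto := by
    have := tendsto_normH_iff.1 (h t ht)
    simpa only [div_eq_inv_mul] using this

/-- The slope of `∫ w²` is the `L²` product of the difference quotient with `w τ + w t`, and both
factors converge in `L²`. -/
lemma hasDerivWithinAt_integral_sq {T : EReal} {w : ℝ → ℝ → ℝ} {v : ℝ → ℝ} {t : ℝ}
    (hw : TendH 0 (𝓝[timeInterval T] t) w (w t))
    (h : TendH 0 (𝓝[timeInterval T \ {t}] t) (fun τ x => (τ - t)⁻¹ * (w τ x - w t x)) v) :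
    HasDerivWithinAt (fun τ => ∫ x in (0 : ℝ)..1, w τ x ^ 2) (∫ x in (0 : ℝ)..1, 2 * w t x * v x)
      (timeInterval T) t := by
  rw [hasDerivWithinAt_iff_tendsto_slope]
  have hl : 𝓝[timeInterval T \ {t}] t ≤ 𝓝[timeInterval T] t := nhdsWithin_mono _ sdiff_subset
  have hw' : TendH 0 (𝓝[timeInterval T \ {t}] t) w (w t) := ⟨hl hw.mem, hw.lim_mem, hw.tendsto.mono_left hl⟩
  have := h.tendsto_integral_mul (hw'.add (TendH.const hw.lim_mem _))
  have e : ∫ x in (0 : ℝ)..1, 2 * w t x * v x = ∫ x in (0 : ℝ)..1, v x * (w t x + w t x) :=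
    intervalIntegral.integral_congr fun x _ => by ring
  rw [e]
  refine this.congr' ?_
  filter_upwards [hw'.mem] with τ hτ
  rw [slope_def_field, ← intervalIntegral.integral_sub hτ.integrable_sq hw.lim_mem.integrable_sq,
    div_eq_inv_mul, ← intervalIntegral.integral_const_mul]
  exact intervalIntegral.integral_congr fun x _ => by ring

/-- Boundedness holds near each time by continuity and passes to `[0,a]` by compactness. -/
lemma ContH.bounded {r : ℝ} {T : EReal} {w : ℝ → ℝ → ℝ} (h : ContH r T w) {a : ℝ} (ha : a ∈ timeInterval T) :
    ∃ B, 0 ≤ B ∧ ∀ t ∈ Icc 0 a, normSq r (w t) ≤ B := by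
  have hsub : Icc 0 a ⊆ timeInterval T :=
    fun t ht => (ordConnected_timeInterval T).out (zero_mem_timeInterval (lt_of_le_of_lt
      (by exact_mod_cast ha.1) ha.2)) ha ht
  have : ∃ B, ∀ t ∈ Icc 0 a, normSq r (w t) ≤ B := by
    refine isCompact_Icc.induction_on (p := fun s => ∃ B, ∀ t ∈ s, normSq r (w t) ≤ B) ⟨0, by simp⟩
      (fun s t hst ⟨B, hB⟩ => ⟨B, fun x hx => hB x (hst hx)⟩)
      (fun s t ⟨B, hB⟩ ⟨B', hB'⟩ => ⟨max B B', ?_⟩) fun t ht => ?_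
    · rintro x (hx | hx)
      exacts [(hB x hx).trans (le_max_left _ _), (hB' x hx).trans (le_max_right _ _)]
    · have hT := contH_iff.1 h t (hsub ht)
      have := hT.tendsto.eventually_lt_const one_pos
      refine ⟨_, nhdsWithin_mono t hsub (hT.mem.and this), 2 * 1 + 2 * normSq r (w t), fun τ hτ => ?_⟩
      have h1 := normSq_add_le (hτ.1.sub hT.lim_mem) hT.lim_mem
      simp only [sub_add_cancel] at h1
      have h2 := hτ.2.le
      linarith
  obtain ⟨B, hB⟩ := this
  exact ⟨max B 0, le_max_right _ _, fun t ht => (hB t ht).trans (le_max_left _ _)⟩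

lemma HasDerivH.sub {r : ℝ} {T : EReal} {w v w' v' : ℝ → ℝ → ℝ} (h : HasDerivH r T w v)
    (h' : HasDerivH r T w' v') (hw : ∀ t ∈ timeInterval T, MemH r (w t)) (hv : ∀ t ∈ timeInterval T, MemH r (v t))
    (hw' : ∀ t ∈ timeInterval T, MemH r (w' t)) (hv' : ∀ t ∈ timeInterval T, MemH r (v' t))
    {t : ℝ} (ht : t ∈ timeInterval T) :
    TendH r (𝓝[timeInterval T \ {t}] t) (fun τ x => (τ - t)⁻¹ * ((w τ x - w' τ x) - (w t x - w' t x)))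
      (fun x => v t x - v' t x) := by
  have := (h.tendH hw hv ht).sub (h'.tendH hw' hv' ht)
  convert! this using 3
  ring

/-- Grönwall for `E = ‖u_x - w_x‖² + ‖ρ - η‖²` in `L²`, with constant from `abs_integral_le`. The
distance is measured below the regularity of the solutions, so that the derivatives of one solution
may enter the constant. -/
theorem IsSolution.unique {s : ℝ} (hs : 2 ≤ s) {T : EReal} {u₀ ρ₀ : ℝ → ℝ} {u ρ w η : ℝ → ℝ → ℝ}
    (h : IsSolution (-1) s T u₀ ρ₀ u ρ) (h' : IsSolution (-1) s T u₀ ρ₀ w η) {a : ℝ} (ha : a ∈ timeInterval T) :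
    u a = w a ∧ ρ a = η a := by
  obtain ⟨v, σ, cv, v0, dv, cσ, dσ, eq⟩ := h.exists_deriv
  obtain ⟨v', σ', cv', v0', dv', cσ', dσ', eq'⟩ := h'.exists_deriv
  have st : ∀ t ∈ timeInterval T, Strong (u t) (v t) (ρ t) (σ t) := fun t ht =>
    strong_of_weak hs (h.cont_u.1 t ht) (cv.1 t ht) (h.cont_rho.1 t ht) (cσ.1 t ht) (h.zero_u t ht)
      (eq t ht).1 (eq t ht).2
  have st' : ∀ t ∈ timeInterval T, Strong (w t) (v' t) (η t) (σ' t) := fun t ht =>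
    strong_of_weak hs (h'.cont_u.1 t ht) (cv'.1 t ht) (h'.cont_rho.1 t ht) (cσ'.1 t ht) (h'.zero_u t ht)
      (eq' t ht).1 (eq' t ht).2
  have hsub : Icc 0 a ⊆ timeInterval T :=
    fun t ht => (ordConnected_timeInterval T).out (zero_mem_timeInterval h.pos) ha ht
  have cu := contH_iff.1 h.cont_u; have cw := contH_iff.1 h'.cont_u
  have cρ := contH_iff.1 h.cont_rho; have cη := contH_iff.1 h'.cont_rho
  -- the two parts of the distance
  set p : ℝ → ℝ → ℝ := fun t => deriv fun x => u t x - w t x with hp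
  have ep : ∀ t ∈ timeInterval T, p t = fun x => deriv (u t) x - deriv (w t) x := fun t ht =>
    ((st t ht).prim_u.sub (st' t ht).prim_u).deriv_eq
      ((st t ht).prim_u'.continuous.sub (st' t ht).prim_u'.continuous)
  set q : ℝ → ℝ → ℝ := fun t x => ρ t x - η t x with hq
  have dp : ∀ t ∈ timeInterval T, HasDerivWithinAt (fun τ => ∫ x in (0 : ℝ)..1, p τ x ^ 2)
      (∫ x in (0 : ℝ)..1, 2 * p t x * (deriv (v t) x - deriv (v' t) x)) (timeInterval T) t := by
    intro t ht
    have c : TendH (s - 1 + 1) (𝓝[timeInterval T] t) (fun τ x => u τ x - w τ x) (fun x => u t x - w t x) := by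
      simpa using (cu t ht).sub (cw t ht)
    have d : TendH (0 + 1) (𝓝[timeInterval T \ {t}] t) _ _ :=
      (dv.sub dv' (fun t ht => (h.cont_u.1 t ht).mono (by linarith)) cv.1
        (fun t ht => (h'.cont_u.1 t ht).mono (by linarith)) cv'.1 ht).mono (by linarith)
    refine (hasDerivWithinAt_integral_sq (v := deriv fun x => v t x - v' t x)
      ((TendH.deriv (by linarith) c).mono (by linarith))
      ((TendH.deriv le_rfl d).congr ?_)).congr_deriv ?_
    · filter_upwards [self_mem_nhdsWithin] with τ hτ
      have e := ((((st τ hτ.1).prim_u.sub (st' τ hτ.1).prim_u).sub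
        ((st t ht).prim_u.sub (st' t ht).prim_u)).const_mul (τ - t)⁻¹).deriv_eq (by
          have := (st τ hτ.1).prim_u'.continuous
          have := (st' τ hτ.1).prim_u'.continuous
          have := (st t ht).prim_u'.continuous
          have := (st' t ht).prim_u'.continuous
          fun_prop)
      have e1 := ep τ hτ.1
      have e2 := ep t ht
      simp only [hp] at e1 e2
      rw [e, e1, e2]
    · have mv := MemH.isPrim_deriv (q := s - 2) (by linarith) ((cv.1 t ht).mono (by linarith))
      have mv' := MemH.isPrim_deriv (q := s - 2) (by linarith) ((cv'.1 t ht).mono (by linarith))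
      refine intervalIntegral.integral_congr_ae ?_
      filter_upwards [(mv.1.sub mv'.1).ae_deriv] with x hx _
      rw [hx]
  have dq : ∀ t ∈ timeInterval T, HasDerivWithinAt (fun τ => ∫ x in (0 : ℝ)..1, q τ x ^ 2)
      (∫ x in (0 : ℝ)..1, 2 * q t x * (σ t x - σ' t x)) (timeInterval T) t := fun t ht =>
    hasDerivWithinAt_integral_sq (((cρ t ht).sub (cη t ht)).mono (by linarith))
      ((dσ.sub dσ' (fun t ht => (h.cont_rho.1 t ht).mono (by linarith)) cσ.1
        (fun t ht => (h'.cont_rho.1 t ht).mono (by linarith)) cσ'.1 ht).mono (by linarith))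
  -- bounds
  obtain ⟨B1, hB10, hB1⟩ := h.cont_u.bounded ha
  obtain ⟨B2, hB20, hB2⟩ := h'.cont_u.bounded ha
  obtain ⟨B3, hB30, hB3⟩ := h.cont_rho.bounded ha
  obtain ⟨B4, hB40, hB4⟩ := h'.cont_rho.bounded ha
  have hπ : (0 : ℝ) ≤ 4 * Real.pi ^ 2 := by positivity
  have bu : ∀ {U : ℝ → ℝ} {B : ℝ}, MemH s U → normSq s U ≤ B → normSq (s - 1) (deriv U) ≤ 4 * Real.pi ^ 2 * B := by
    intro U B m hb
    have m' : MemH (s - 1 + 1) U := by simpa using m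
    refine ((MemH.isPrim_deriv (by linarith) m').1.normSq_le m').trans ?_
    simp only [sub_add_cancel]
    exact mul_le_mul_of_nonneg_left hb hπ
  -- The inequality `y ≤ y² + 1/4` turns the squared bound into a bound for `|U|` without a root.
  have br : ∀ {U : ℝ → ℝ} {B : ℝ}, MemH (s - 1) U → normSq (s - 1) U ≤ B → ∀ x, |U x| ≤ 1 + 100 * B := by
    intro U B m hb x
    have h1 := (m.mono (show (1 : ℝ) ≤ s - 1 by linarith)).abs_le x
    have h2 := normSq_mono m (show (1 : ℝ) ≤ s - 1 by linarith)
    rw [← sq_abs] at h1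
    nlinarith [sq_nonneg (|U x| - 1 / 2)]
  have bd : ∀ {U : ℝ → ℝ} {B : ℝ}, MemH (s - 1) U → normSq (s - 1) U ≤ B →
      ∫ x in (0 : ℝ)..1, deriv U x ^ 2 ≤ 4 * Real.pi ^ 2 * B := by
    intro U B m hb
    have m1 : MemH (0 + 1) U := m.mono (by linarith)
    obtain ⟨a1, a2⟩ := MemH.isPrim_deriv le_rfl m1
    rw [← normSq_zero_eq a2.memLp]
    refine (a1.normSq_le m1).trans (mul_le_mul_of_nonneg_left ?_ hπ)
    exact (normSq_mono m (by linarith)).trans hb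
  have md : ∀ {U : ℝ → ℝ}, MemH s U → MemH (s - 1) (deriv U) := fun {U} m =>
    (MemH.isPrim_deriv (q := s - 1) (by linarith) (by simpa using m)).2
  set P := 4 * Real.pi ^ 2 with hP
  set M := 1 + 100 * (P * B1 + P * B2 + B3 + B4) with hM
  set N := P * (P * B2) + P * B4 with hN
  set K := 3 * M + 1 + 2 * N with hK
  have hPB1 : 0 ≤ P * B1 := by positivity
  have hPB2 : 0 ≤ P * B2 := by positivity
  set E : ℝ → ℝ := fun τ => (∫ x in (0 : ℝ)..1, p τ x ^ 2) + ∫ x in (0 : ℝ)..1, q τ x ^ 2 with hE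
  have key : ∀ x ∈ Icc 0 a, E x = 0 := by
    refine eq_zero_of_abs_deriv_le_mul_abs_self_of_eq_zero_right (K := K)
      (f' := fun t => (∫ x in (0 : ℝ)..1, 2 * p t x * (deriv (v t) x - deriv (v' t) x))
        + ∫ x in (0 : ℝ)..1, 2 * q t x * (σ t x - σ' t x)) ?_ ?_ ?_ ?_
    · exact fun t ht => (((dp t (hsub ht)).add (dq t (hsub ht))).continuousWithinAt).mono hsub
    · intro t ht
      -- Grönwall needs right derivatives: to the right of `t < a`, the time interval is a full
      -- one-sided neighbourhood.
      have hn : timeInterval T ∈ 𝓝[Ici t] t :=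
        mem_of_superset (Icc_mem_nhdsGE ht.2) ((Icc_subset_Icc_left ht.1).trans hsub)
      exact ((dp t (hsub ⟨ht.1, ht.2.le⟩)).add (dq t (hsub ⟨ht.1, ht.2.le⟩))).mono_of_mem_nhdsWithin hn
    · have e : p 0 = fun _ => 0 := by
        rw [ep 0 (zero_mem_timeInterval h.pos), h.init_u, h'.init_u]; simp
      simp [hE, e, hq, h.init_rho, h'.init_rho]
    · intro t ht
      have htI := hsub ⟨ht.1, ht.2.le⟩
      have ht' : t ∈ Icc 0 a := ⟨ht.1, ht.2.le⟩
      have s1 := st t htI; have s2 := st' t htI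
      have m1 := h.cont_u.1 t htI; have m2 := h'.cont_u.1 t htI
      have m3 := h.cont_rho.1 t htI; have m4 := h'.cont_rho.1 t htI
      have main := abs_integral_le s1 s2 (M := M) (N := N)
        (fun x => (br (md m1) (bu m1 (hB1 t ht')) x).trans (by linarith))
        (fun x => (br (md m2) (bu m2 (hB2 t ht')) x).trans (by linarith))
        (fun x => (br m3 (hB3 t ht') x).trans (by linarith))
        (fun x => (br m4 (hB4 t ht') x).trans (by linarith))
        (by
          rw [intervalIntegral.integral_add s2.mem_u''.integrable_sq s2.mem_ρ'.integrable_sq]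
          exact add_le_add (bd (md m2) (bu m2 (hB2 t ht'))) (bd m4 (hB4 t ht')))
      have cu1 := s1.prim_u'.continuous; have cu2 := s2.prim_u'.continuous
      have cr1 := s1.prim_ρ.continuous; have cr2 := s2.prim_ρ.continuous
      rw [intervalIntegral.integral_add
        ((s1.mem_v'.intervalIntegrable.sub s2.mem_v'.intervalIntegrable).continuousOn_mul
          (Continuous.continuousOn (by fun_prop)))
        ((s1.mem_σ.intervalIntegrable.sub s2.mem_σ.intervalIntegrable).continuousOn_mul
          (Continuous.continuousOn (by fun_prop))),
        intervalIntegral.integral_add (Continuous.intervalIntegrable (by fun_prop) _ _)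
        (Continuous.intervalIntegrable (by fun_prop) _ _)] at main
      simp only [Real.norm_eq_abs, hE, hq, ep t htI]
      exact main.trans (mul_le_mul_of_nonneg_left (le_abs_self _) (by positivity))
  have hEa := key a ⟨ha.1, le_rfl⟩
  have n1 : 0 ≤ ∫ x in (0 : ℝ)..1, p a x ^ 2 := intervalIntegral.integral_nonneg zero_le_one fun x _ => sq_nonneg _
  have n2 : 0 ≤ ∫ x in (0 : ℝ)..1, q a x ^ 2 := intervalIntegral.integral_nonneg zero_le_one fun x _ => sq_nonneg _
  simp only [hE] at hEa
  have s1 := st a ha; have s2 := st' a ha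
  have z1 := eq_zero_of_integral_sq (f := p a)
    (by rw [ep a ha]; exact s1.prim_u'.continuous.sub s2.prim_u'.continuous)
    (by rw [ep a ha]; exact (periodic_deriv s1.per_u).sub (periodic_deriv s2.per_u)) (by linarith)
  have z2 := eq_zero_of_integral_sq (f := q a) (s1.prim_ρ.continuous.sub s2.prim_ρ.continuous)
    (s1.per_ρ.sub s2.per_ρ) (by linarith)
  constructor
  · ext x
    have e1 := s1.prim_u.eq x
    have e2 := s2.prim_u.eq x
    rw [s1.zero] at e1; rw [s2.zero] at e2
    rw [e1, e2]
    congr 1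
    refine intervalIntegral.integral_congr fun y _ => ?_
    have := z1 y
    rw [ep a ha] at this
    exact sub_eq_zero.1 this
  · ext x
    exact sub_eq_zero.1 (z2 x)

/-! ### The critical time as a first zero -/

/-- The first positive zero of `cosC c + m * sinC c`. -/
def firstZero (c m : ℝ) : EReal :=
  if c = 1 then ((Real.pi / 2 + Real.arctan m : ℝ) : EReal)
  else if c = 0 then if m < 0 then ((-1 / m : ℝ) : EReal) else ⊤
  else if m < -1 then (arccoth (-m) : EReal) else ⊤

lemma arccoth_mem {m : ℝ} (h : m < -1) : (-m)⁻¹ ∈ Ioo (0 : ℝ) 1 :=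
  ⟨inv_pos.2 (by linarith), inv_lt_one_of_one_lt₀ (by linarith)⟩

lemma firstZero_pos (c m : ℝ) : 0 < firstZero c m := by
  unfold firstZero
  split_ifs with h1 h2 h3 h4
  · have := Real.neg_pi_div_two_lt_arctan m
    exact_mod_cast (by linarith : 0 < Real.pi / 2 + Real.arctan m)
  · exact_mod_cast div_pos_of_neg_of_neg (by norm_num) h3
  · exact EReal.coe_lt_top 0
  · exact_mod_cast Real.artanh_pos (arccoth_mem h4)
  · exact EReal.coe_lt_top 0

/-- Phase form of the factor: its zero sits where `t - arctan m = π/2`. -/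
lemma cos_add_mul_sin (m t : ℝ) :
    (Real.cos t + m * Real.sin t) * Real.cos (Real.arctan m) = Real.cos (t - Real.arctan m) := by
  have h := Real.tan_mul_cos (Real.cos_arctan_pos m).ne'
  rw [Real.tan_arctan] at h
  rw [Real.cos_sub, ← h]; ring

lemma cosh_add_mul_sinh (m t : ℝ) : Real.cosh t + m * Real.sinh t = Real.cosh t * (1 + m * Real.tanh t) := by
  have := (Real.cosh_pos t).ne'
  rw [Real.tanh_eq_sinh_div_cosh]; field_simp

/-- For `c = 1` the first zero lies below `π`, so the sine has not changed sign. This makes the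
factors monotone in the slope. -/
lemma sinC_nonneg {c m t : ℝ} (h0 : 0 ≤ t) (h : (t : EReal) ≤ firstZero c m) : 0 ≤ sinC c t := by
  unfold sinC
  split_ifs with h1 h2
  · rw [firstZero, if_pos h1, EReal.coe_le_coe_iff] at h
    exact Real.sin_nonneg_of_nonneg_of_le_pi h0 (by linarith [Real.arctan_lt_pi_div_two m])
  · exact h0
  · exact Real.sinh_nonneg_iff.2 h0

/-- As `S ≥ 0`, it suffices to treat `a = m`: by the phase form for `c = 1`, by linearity for `c =
0`, and by comparing `tanh t` with `-1/m` for `c = -1`. There, if `m ≥ -1`, the factor is at least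
`cosh t - sinh t = e^{-t}`. -/
lemma factor_pos {c m a t : ℝ} (h0 : 0 ≤ t) (h : (t : EReal) < firstZero c m) (ha : m ≤ a) :
    0 < cosC c t + a * sinC c t := by
  have hs := sinC_nonneg h0 h.le
  suffices 0 < cosC c t + m * sinC c t by nlinarith
  unfold firstZero at h
  unfold cosC sinC
  split_ifs at h ⊢ with h1 h2 h3 h4
  · rw [EReal.coe_lt_coe_iff] at h
    have h5 := cos_add_mul_sin m t
    have h6 : 0 < Real.cos (t - Real.arctan m) :=
      Real.cos_pos_of_mem_Ioo ⟨by linarith [Real.arctan_lt_pi_div_two m], by linarith⟩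
    rw [← h5] at h6
    exact pos_of_mul_pos_left h6 (Real.cos_arctan_pos m).le
  · rw [EReal.coe_lt_coe_iff, lt_div_iff_of_neg h3] at h
    linarith
  · push Not at h3
    positivity
  · rw [EReal.coe_lt_coe_iff] at h
    have hx := arccoth_mem h4
    have h5 : Real.tanh t < (-m)⁻¹ := by
      by_contra hcon
      push Not at hcon
      have := Real.artanh_le_artanh (by linarith [hx.1]) (Real.tanh_lt_one t) hcon
      rw [Real.artanh_tanh] at this
      exact absurd h (not_lt.2 this)
    rw [cosh_add_mul_sinh]
    have h6 : m * (-m)⁻¹ = -1 := by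
      have : m ≠ 0 := by linarith
      field_simp
    have := mul_lt_mul_of_neg_left h5 (show m < 0 by linarith)
    exact mul_pos (Real.cosh_pos t) (by linarith)
  · push Not at h4
    have h5 := Real.cosh_sub_sinh t
    have h6 := Real.exp_pos (-t)
    have := mul_le_mul_of_nonneg_right h4 (Real.sinh_nonneg_iff.2 h0)
    linarith

lemma factor_eq_zero {c m t : ℝ} (h : (t : EReal) = firstZero c m) : cosC c t + m * sinC c t = 0 := by
  unfold firstZero at h
  unfold cosC sinC
  split_ifs at h ⊢ with h1 h2 h3 h4
  · rw [EReal.coe_eq_coe_iff] at h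
    have h5 := cos_add_mul_sin m t
    have e : t - Real.arctan m = Real.pi / 2 := by linarith
    rw [e, Real.cos_pi_div_two] at h5
    exact (mul_eq_zero.1 h5).resolve_right (Real.cos_arctan_pos m).ne'
  · rw [EReal.coe_eq_coe_iff] at h
    rw [h]; field_simp [h3.ne]; ring
  · exact absurd h (EReal.coe_ne_top t)
  · rw [EReal.coe_eq_coe_iff] at h
    have hx := arccoth_mem h4
    rw [cosh_add_mul_sinh, h, arccoth, Real.tanh_artanh ⟨by linarith [hx.1], hx.2⟩]
    have : m ≠ 0 := by linarith
    field_simp; ring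
  · exact absurd h (EReal.coe_ne_top t)

lemma exists_min_of_periodic {a : ℝ → ℝ} (ha : Continuous a) (hp : Function.Periodic a 1) :
    ∃ x₀, ∀ x, a x₀ ≤ a x := by
  obtain ⟨x₀, -, h⟩ := isCompact_Icc.exists_isMinOn (nonempty_Icc.2 (zero_le_one' ℝ)) ha.continuousOn
  refine ⟨x₀, fun x => ?_⟩
  obtain ⟨y, hy, e⟩ := hp.exists_mem_Ico₀ one_pos x
  rw [e]
  exact h ⟨hy.1, hy.2.le⟩

open Classical in
/-- An infimum of a monotone function over the points where a function is below a threshold. -/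
lemma iInf_threshold {a : ℝ → ℝ} {x₀ : ℝ} (h : ∀ x, a x₀ ≤ a x) {b : ℝ} {F : ℝ → EReal} {P : ℝ → Prop}
    {G : ℝ → EReal} (hP : ∀ x, P x ↔ a x < b) (hG : ∀ x, a x < b → G x = F (a x))
    (hF : ∀ y z, y ≤ z → z < b → F y ≤ F z) :
    ⨅ (x : ℝ) (_ : P x), G x = if a x₀ < b then F (a x₀) else ⊤ := by
  split_ifs with hb
  · refine le_antisymm ((iInf₂_le x₀ ((hP x₀).2 hb)).trans (hG x₀ hb).le) (le_iInf₂ fun x hx => ?_)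
    rw [hG x ((hP x).1 hx)]
    exact hF _ _ (h x) ((hP x).1 hx)
  · exact iInf₂_eq_top.2 fun x hx => absurd (lt_of_le_of_lt (h x) ((hP x).1 hx)) hb

open Classical in
-- Extending `F` by `⊤` beyond the threshold keeps it monotone, so it commutes with the minimum of
-- two arguments.
lemma min_threshold {b : ℝ} {F : ℝ → EReal} (hF : ∀ y z, y ≤ z → z < b → F y ≤ F z) (m n : ℝ) :
    min (if m < b then F m else ⊤) (if n < b then F n else ⊤) = if min m n < b then F (min m n) else ⊤ := by
  have key : ∀ m n : ℝ, m ≤ n → (if m < b then F m else ⊤) ≤ (if n < b then F n else ⊤) := by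
    intro m n hmn
    split_ifs with h1 h2 h3
    · exact hF _ _ hmn h2
    · exact le_top
    · exact absurd (lt_of_le_of_lt hmn h3) h1
    · exact le_rfl
  rcases le_total m n with h | h
  · rw [min_eq_left h, min_eq_left (key m n h)]
  · rw [min_eq_right h, min_eq_right (key n m h)]

/-- In each case the first zero increases with the slope, so the infimum over points is the value at
a point where the slope is minimal. -/
lemma criticalTime_eq {c : ℝ} {u₀ ρ₀ : ℝ → ℝ} {x₁ x₂ : ℝ}
    (h1 : ∀ x, (deriv u₀ x₁ - ρ₀ x₁) / 2 ≤ (deriv u₀ x - ρ₀ x) / 2)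
    (h2 : ∀ x, (deriv u₀ x₂ + ρ₀ x₂) / 2 ≤ (deriv u₀ x + ρ₀ x) / 2) :
    criticalTime c u₀ ρ₀ = firstZero c (min ((deriv u₀ x₁ - ρ₀ x₁) / 2) ((deriv u₀ x₂ + ρ₀ x₂) / 2)) := by
  unfold criticalTime firstZero
  rcases eq_or_ne c 1 with c1 | c1
  · rw [if_pos c1, if_pos c1]
    have e1 : (⨅ x, (deriv u₀ x - ρ₀ x) / 2) = (deriv u₀ x₁ - ρ₀ x₁) / 2 :=
      le_antisymm (ciInf_le ⟨_, by rintro _ ⟨x, rfl⟩; exact h1 x⟩ x₁) (le_ciInf h1)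
    have e2 : (⨅ x, (deriv u₀ x + ρ₀ x) / 2) = (deriv u₀ x₂ + ρ₀ x₂) / 2 :=
      le_antisymm (ciInf_le ⟨_, by rintro _ ⟨x, rfl⟩; exact h2 x⟩ x₂) (le_ciInf h2)
    rw [e1, e2, Real.arctan_strictMono.monotone.map_min]
  rw [if_neg c1, if_neg c1]
  rcases eq_or_ne c 0 with c0 | c0
  · rw [if_pos c0, if_pos c0]
    have hF : ∀ y z : ℝ, y ≤ z → z < 0 → ((-1 / y : ℝ) : EReal) ≤ ((-1 / z : ℝ) : EReal) := by
      intro y z hyz hz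
      rw [EReal.coe_le_coe_iff, neg_div, neg_div, neg_le_neg_iff]
      exact one_div_le_one_div_of_neg_of_le hz hyz
    rw [iInf_threshold (a := fun x => (deriv u₀ x - ρ₀ x) / 2) h1 (b := 0) (F := fun m => ((-1 / m : ℝ) : EReal))
        (fun x => ⟨fun h => by linarith, fun h => by linarith⟩)
        (fun x hx => by
          have : deriv u₀ x - ρ₀ x ≠ 0 := by intro e; simp [e] at hx
          rw [EReal.coe_eq_coe_iff]; field_simp) hF,
      iInf_threshold (a := fun x => (deriv u₀ x + ρ₀ x) / 2) h2 (b := 0) (F := fun m => ((-1 / m : ℝ) : EReal))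
        (fun x => ⟨fun h => by linarith, fun h => by linarith⟩)
        (fun x hx => by
          have : deriv u₀ x + ρ₀ x ≠ 0 := by intro e; simp [e] at hx
          rw [EReal.coe_eq_coe_iff]; field_simp) hF]
    convert min_threshold hF _ _
  · rw [if_neg c0, if_neg c0]
    have hF : ∀ y z : ℝ, y ≤ z → z < -1 → (arccoth (-y) : EReal) ≤ (arccoth (-z) : EReal) := by
      intro y z hyz hz
      have m1 := arccoth_mem hz
      have m2 := arccoth_mem (lt_of_le_of_lt hyz hz)
      rw [EReal.coe_le_coe_iff]
      refine Real.artanh_le_artanh (by linarith [m2.1]) m1.2 ?_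
      exact inv_anti₀ (by linarith) (by linarith)
    rw [iInf_threshold (a := fun x => (deriv u₀ x - ρ₀ x) / 2) h1 (b := -1) (F := fun m => (arccoth (-m) : EReal))
        (fun x => ⟨fun h => by linarith, fun h => by linarith⟩)
        (fun x hx => by
          rw [EReal.coe_eq_coe_iff]; congr 1; ring) hF,
      iInf_threshold (a := fun x => (deriv u₀ x + ρ₀ x) / 2) h2 (b := -1) (F := fun m => (arccoth (-m) : EReal))
        (fun x => ⟨fun h => by linarith, fun h => by linarith⟩)
        (fun x hx => by
          rw [EReal.coe_eq_coe_iff]; congr 1; ring) hF]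
    convert min_threshold hF _ _

/-- Difference of squares. Positivity of `J` reduces to scalar factors indexed by the slopes `(f ∓
g)/2`. -/
lemma jac_eq_mul (c : ℝ) (f g : ℝ → ℝ) (t y : ℝ) : jac c f g t y =
    (cosC c t + (f y - g y) / 2 * sinC c t) * (cosC c t + (f y + g y) / 2 * sinC c t) := by
  unfold jac; ring

/-- The critical time is the first zero of a factor of the Jacobian. -/
lemma exists_firstZero {c : ℝ} {u₀ ρ₀ : ℝ → ℝ} (hu : Continuous (deriv u₀)) (hρ : Continuous ρ₀)
    (hup : Function.Periodic (deriv u₀) 1) (hρp : Function.Periodic ρ₀ 1) :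
    ∃ m, criticalTime c u₀ ρ₀ = firstZero c m ∧ (∀ x, m ≤ (deriv u₀ x - ρ₀ x) / 2) ∧
      (∀ x, m ≤ (deriv u₀ x + ρ₀ x) / 2) ∧
      ∃ x, m = (deriv u₀ x - ρ₀ x) / 2 ∨ m = (deriv u₀ x + ρ₀ x) / 2 := by
  obtain ⟨x₁, h1⟩ := exists_min_of_periodic (a := fun x => (deriv u₀ x - ρ₀ x) / 2) (by fun_prop)
    fun x => by simp only [hup x, hρp x]
  obtain ⟨x₂, h2⟩ := exists_min_of_periodic (a := fun x => (deriv u₀ x + ρ₀ x) / 2) (by fun_prop)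
    fun x => by simp only [hup x, hρp x]
  refine ⟨_, criticalTime_eq h1 h2, fun x => (min_le_left _ _).trans (h1 x),
    fun x => (min_le_right _ _).trans (h2 x), ?_⟩
  rcases min_choice ((deriv u₀ x₁ - ρ₀ x₁) / 2) ((deriv u₀ x₂ + ρ₀ x₂) / 2) with e | e
  · exact ⟨x₁, Or.inl e⟩
  · exact ⟨x₂, Or.inr e⟩

/-! ### Breakdown of the flow and uniqueness of the flow map -/

lemma timeInterval_mono {T T' : EReal} (h : T ≤ T') : timeInterval T ⊆ timeInterval T' :=
  fun _ ht => ⟨ht.1, ht.2.trans_le h⟩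

lemma ContH.restrict {r : ℝ} {T T' : EReal} {w : ℝ → ℝ → ℝ} (h : ContH r T' w) (hT : T ≤ T') : ContH r T w :=
  ⟨fun t ht => h.1 t (timeInterval_mono hT ht), fun t ht =>
    (h.2 t (timeInterval_mono hT ht)).mono_left (nhdsWithin_mono _ (timeInterval_mono hT))⟩

lemma HasDerivH.restrict {r : ℝ} {T T' : EReal} {w v : ℝ → ℝ → ℝ} (h : HasDerivH r T' w v) (hT : T ≤ T') :
    HasDerivH r T w v := fun t ht =>
  (h t (timeInterval_mono hT ht)).mono_left (nhdsWithin_mono _ (sdiff_subset_sdiff_left (timeInterval_mono hT)))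

lemma IsSolution.restrict {κ s : ℝ} {T T' : EReal} {u₀ ρ₀ : ℝ → ℝ} {u ρ : ℝ → ℝ → ℝ}
    (h : IsSolution κ s T' u₀ ρ₀ u ρ) (h0 : 0 < T) (hT : T ≤ T') : IsSolution κ s T u₀ ρ₀ u ρ := by
  obtain ⟨v, σ, cv, v0, dv, cσ, dσ, eq⟩ := h.exists_deriv
  have hs := timeInterval_mono hT
  exact ⟨h0, h.cont_u.restrict hT, fun t ht => h.zero_u t (hs ht), h.cont_rho.restrict hT,
    ⟨v, σ, cv.restrict hT, fun t ht => v0 t (hs ht), dv.restrict hT, cσ.restrict hT, dσ.restrict hT,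
      fun t ht => eq t (hs ht)⟩, h.init_u, h.init_rho⟩

/-- The slope of a solution is bounded on compact time intervals. -/
lemma ContH.deriv_bounded {s : ℝ} (hs : 2 ≤ s) {T : EReal} {u : ℝ → ℝ → ℝ} (h : ContH s T u) {a : ℝ}
    (ha : a ∈ timeInterval T) : ∃ K, 0 ≤ K ∧ ∀ t ∈ Icc 0 a, ∀ x, |deriv (u t) x| ≤ K := by
  obtain ⟨B, hB0, hB⟩ := h.bounded ha
  refine ⟨1 + 100 * (4 * Real.pi ^ 2 * B), by positivity, fun t ht x => ?_⟩
  have htT : t ∈ timeInterval T := (ordConnected_timeInterval T).out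
    (zero_mem_timeInterval (lt_of_le_of_lt (by exact_mod_cast ha.1) ha.2)) ha ht
  have m : MemH (s - 1 + 1) (u t) := by simpa using h.1 t htT
  obtain ⟨p, m'⟩ := MemH.isPrim_deriv (by linarith) m
  have h1 := (m'.mono (show (1 : ℝ) ≤ s - 1 by linarith)).abs_le x
  have h2 := normSq_mono m' (show (1 : ℝ) ≤ s - 1 by linarith)
  have h3 := p.normSq_le m
  simp only [sub_add_cancel] at h3
  have h4 := mul_le_mul_of_nonneg_left (hB t ht) (show 0 ≤ 4 * Real.pi ^ 2 by positivity)
  rw [← sq_abs] at h1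
  nlinarith [sq_nonneg (|deriv (u t) x| - 1 / 2)]

namespace Data
variable {c r : ℝ} {f g : ℝ → ℝ}

lemma of_memH {s : ℝ} (hs : 2 ≤ s) {u₀ ρ₀ : ℝ → ℝ} (hu : MemH s u₀) (hρ : MemH (s - 1) ρ₀)
    (hc : c = HunterSaxton.energy u₀ ρ₀) (hcase : c = 1 ∨ c = 0 ∨ c = -1) : Data c (s - 1) (deriv u₀) ρ₀ := by
  obtain ⟨p, m⟩ := MemH.isPrim_deriv (q := s - 1) (by linarith) (by simpa using hu)
  refine ⟨hcase, by linarith, m, hρ, p.integral_deriv_eq_zero hu.periodic, ?_⟩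
  rw [hc, HunterSaxton.energy, ← intervalIntegral.integral_const_mul]
  exact intervalIntegral.integral_congr fun x _ => by ring

lemma jac_zero (c : ℝ) (f g : ℝ → ℝ) (x : ℝ) : jac c f g 0 x = 1 := by simp [jac, cosC_zero, sinC_zero]

/-- The Jacobian of the flow cannot vanish as long as the slope stays bounded. -/
lemma jac_ne_zero (h : Data c r f g) {a K : ℝ} (ha : 0 < a) {x : ℝ}
    (hb : ∀ t ∈ Ioo 0 a, |jac' c f g t x| ≤ K * jac c f g t x) : jac c f g a x ≠ 0 := by
  intro h0
  have hd : ∀ t, HasDerivAt (fun t => jac c f g t x * Real.exp (K * t))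
      (jac' c f g t x * Real.exp (K * t) + jac c f g t x * (Real.exp (K * t) * K)) t := by
    intro t
    have e : HasDerivAt (fun t : ℝ => Real.exp (K * t)) (Real.exp (K * t) * K) t := by
      simpa using ((hasDerivAt_id t).const_mul K).exp
    exact (h.hasDerivAt_jac t x).mul e
  -- The bound on `J_t` gives `(J e^{Kt})_t = (J_t + K J) e^{Kt} ≥ 0`, so `J e^{Kt}` stays at least
  -- its initial value `1`.
  have mono : MonotoneOn (fun t => jac c f g t x * Real.exp (K * t)) (Icc 0 a) := by
    refine monotoneOn_of_deriv_nonneg (convex_Icc 0 a) (fun t _ => (hd t).continuousAt.continuousWithinAt)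
      (fun t _ => (hd t).differentiableAt.differentiableWithinAt) fun t ht => ?_
    rw [interior_Icc] at ht
    rw [(hd t).deriv]
    have h1 := (abs_le.1 (hb t ht)).1
    have h2 := Real.exp_pos (K * t)
    nlinarith
  have := mono ⟨le_rfl, ha.le⟩ ⟨ha.le, le_rfl⟩ ha.le
  simp only [jac_zero, h0] at this
  norm_num at this

/-- Where the Jacobian first vanishes and the density does not, the Jacobian changes sign. -/
lemma eventually_jac_neg (h : Data c r f g) {a x : ℝ} (ha : 0 < a) (hpos : ∀ t ∈ Ico 0 a, 0 < jac c f g t x)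
    (h0 : jac c f g a x = 0) (hg : g x ≠ 0) : ∀ᶠ τ in 𝓝[>] a, jac c f g τ x < 0 := by
  have hd := hasDerivAt_iff_tendsto_slope.1 (h.hasDerivAt_jac a x)
  -- At a zero of `J` the energy identity reduces to `J_t² = g²`.
  have hne : jac' c f g a x ≠ 0 := by
    have := h.jac'_sq_sub a x
    rw [h0] at this
    intro e
    rw [e] at this
    have : g x ^ 2 = 0 := by linarith
    exact hg (by simpa using this)
  rcases lt_or_gt_of_ne hne with hlt | hgt
  · have h1 := (hd.eventually_lt_const hlt).filter_mono (nhdsWithin_mono a (fun y hy => ne_of_gt hy) : 𝓝[>] a ≤ 𝓝[≠] a)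
    filter_upwards [h1, self_mem_nhdsWithin] with τ h2 (hτ : a < τ)
    rw [slope_def_field, h0, sub_zero] at h2
    exact (div_neg_iff.1 h2).elim (fun h => absurd h.2 (by linarith)) (fun h => h.1)
  -- A positive time derivative at the zero would make `J` negative just before `a`, against `hpos`.
  · have h1 := (hd.eventually_const_lt hgt).filter_mono (nhdsWithin_mono a (fun y hy => ne_of_lt hy) : 𝓝[<] a ≤ 𝓝[≠] a)
    have h3 : Ico 0 a ∈ 𝓝[<] a := Ico_mem_nhdsLT ha
    obtain ⟨τ, h2, hτ⟩ := (h1.and h3).exists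
    rw [slope_def_field, h0, sub_zero] at h2
    have := hpos τ hτ
    have := (div_pos_iff.1 h2).elim (fun h => absurd h.2 (by linarith [hτ.2])) (fun h => h.1)
    linarith

/-- A continuous injection of the line is strictly monotone. A negative derivative excludes
increasing, and the values `0` at `0` and `1` at `1` exclude decreasing. -/
lemma not_injective (h : Data c r f g) {t x : ℝ} (hx : jac c f g t x < 0) :
    ¬ Function.Injective (primF (jac c f g t)) := by
  intro hi
  rcases (continuous_primF (h.continuous_jac t)).strictMono_of_inj hi with hm | hm
  · have := hm.monotone.deriv_nonneg (x := x)
    rw [(hasDerivAt_primF (h.continuous_jac t) x).deriv] at this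
    linarith
  · have := hm (zero_lt_one' ℝ)
    rw [primF_zero, h.primF_jac_one] at this
    linarith

lemma isCircleDiffeo (h : Data c r f g) {t : ℝ} (hpos : ∀ x, 0 < jac c f g t x) :
    IsCircleDiffeo (primF (jac c f g t)) ∧ Function.Injective (primF (jac c f g t)) := by
  obtain ⟨ψ, hψ⟩ := h.exists_change hpos
  have hd := hasDerivAt_primF (h.continuous_jac t)
  have e : deriv (primF (jac c f g t)) = jac c f g t := funext fun x => (hd x).deriv
  refine ⟨⟨contDiff_one_iff_deriv.2 ⟨fun x => (hd x).differentiableAt, ?_⟩, hψ.add_one, ?_⟩, hψ.strictMono.injective⟩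
  · rw [e]; exact h.continuous_jac t
  · rw [e]; exact hpos

lemma isFlow (h : Data c r f g) {T : EReal} {ψ : ℝ → ℝ → ℝ}
    (hψ : ∀ t ∈ timeInterval T, CircleChange (jac c f g t) (ψ t)) {u : ℝ → ℝ → ℝ}
    (hu : ∀ t ∈ timeInterval T, u t = solU c f g ψ t) : IsFlow T u fun t => primF (jac c f g t) where
  ode := fun t ht x => by
    rw [hu t ht, solU_comp t (hψ t ht)]
    exact (h.hasDerivAt_flow t x).hasDerivWithinAt
  init := fun x => by
    have : jac c f g 0 = fun _ => 1 := funext fun x => jac_zero c f g x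
    rw [this]; simp [primF]
  zero := fun t _ => primF_zero _

end Data

/-- On `[0,a]` the velocity is Lipschitz in space, uniformly in time, by the Sobolev bound on `u_x`,
so the classical uniqueness theorem for ordinary differential equations applies. -/
lemma IsFlow.unique {s : ℝ} (hs : 2 ≤ s) {T : EReal} {u φ φ' : ℝ → ℝ → ℝ} (hu : ContH s T u)
    (h : IsFlow T u φ) (h' : IsFlow T u φ') {a : ℝ} (ha : a ∈ timeInterval T) (x : ℝ) : φ a x = φ' a x := by
  have hT : 0 < T := lt_of_le_of_lt (by exact_mod_cast ha.1) ha.2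
  have hsub : Icc 0 a ⊆ timeInterval T :=
    fun t ht => (ordConnected_timeInterval T).out (zero_mem_timeInterval hT) ha ht
  obtain ⟨K, hK0, hK⟩ := hu.deriv_bounded hs ha
  have hn : ∀ t ∈ Ico 0 a, timeInterval T ∈ 𝓝[Ici t] t := fun t ht =>
    mem_of_superset (Icc_mem_nhdsGE ht.2) ((Icc_subset_Icc_left ht.1).trans hsub)
  refine ODE_solution_unique_of_mem_Icc_right (v := u) (s := fun _ => univ) (K := ⟨K, hK0⟩)
    (f := fun t => φ t x) (g := fun t => φ' t x) (a := 0) (b := a) (fun t ht => ?_)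
    (fun t ht => ((h.ode t (hsub ht) x).continuousWithinAt).mono hsub)
    (fun t ht => (h.ode t (hsub ⟨ht.1, ht.2.le⟩) x).mono_of_mem_nhdsWithin (hn t ht)) (fun _ _ => mem_univ _)
    (fun t ht => ((h'.ode t (hsub ht) x).continuousWithinAt).mono hsub)
    (fun t ht => (h'.ode t (hsub ⟨ht.1, ht.2.le⟩) x).mono_of_mem_nhdsWithin (hn t ht)) (fun _ _ => mem_univ _)
    (by rw [h.init, h'.init]) ⟨ha.1, le_rfl⟩
  have m : MemH (s - 1 + 1) (u t) := by simpa using hu.1 t (hsub ⟨ht.1, ht.2.le⟩)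
  obtain ⟨p, m'⟩ := MemH.isPrim_deriv (by linarith) m
  have hd := p.hasDerivAt (m'.continuous (by linarith))
  refine (lipschitzWith_of_nnnorm_deriv_le (fun y => (hd y).differentiableAt) fun y => ?_).lipschitzOnWith
  exact hK t ⟨ht.1, ht.2.le⟩ y

/-- Apply the statement for squares to the square root of `f`. -/
lemma eq_zero_of_nonneg_of_integral {f : ℝ → ℝ} (hf : Continuous f) (hp : Function.Periodic f 1)
    (h0 : ∀ x, 0 ≤ f x) (h : ∫ x in (0 : ℝ)..1, f x = 0) (x : ℝ) : f x = 0 := by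
  have := eq_zero_of_integral_sq (f := fun x => Real.sqrt (f x)) (by fun_prop) (fun x => by simp only [hp x])
    (by simpa only [Real.sq_sqrt (h0 _)] using h) x
  exact (Real.sqrt_eq_zero (h0 x)).1 this

end HunterSaxton

end

/-! ### Assembly of the theorem -/

open HunterSaxton

theorem proposition2p1 (s : ℝ) (hs : 2 ≤ s) (u₀ ρ₀ : ℝ → ℝ)
    (hu₀ : HunterSaxton.MemH0 s u₀) (hρ₀ : HunterSaxton.MemH (s - 1) ρ₀)
    (c : ℝ) (hc : c = HunterSaxton.energy u₀ ρ₀) (hcase : c = 1 ∨ c = 0 ∨ c = -1)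
    (Tstar : EReal) (hTstar : Tstar = HunterSaxton.criticalTime c u₀ ρ₀) :
    -- existence on `[0,T*)`
    0 < Tstar ∧
    (∃ u ρ, HunterSaxton.IsSolution (-1) s Tstar u₀ ρ₀ u ρ) ∧
    -- uniqueness
    (∀ T u ρ w η, HunterSaxton.IsSolution (-1) s T u₀ ρ₀ u ρ →
      HunterSaxton.IsSolution (-1) s T u₀ ρ₀ w η →
      ∀ t ∈ HunterSaxton.timeInterval T, u t = w t ∧ ρ t = η t) ∧
    -- maximality of `T*`
    (∀ T u ρ, HunterSaxton.IsSolution (-1) s T u₀ ρ₀ u ρ → T ≤ Tstar) ∧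
    -- the flow map exists and is given by the explicit formula
    (∀ T u ρ, HunterSaxton.IsSolution (-1) s T u₀ ρ₀ u ρ →
      (∃ φ, HunterSaxton.IsFlow T u φ) ∧
      ∀ φ, HunterSaxton.IsFlow T u φ → ∀ t ∈ HunterSaxton.timeInterval T, ∀ x,
        φ t x = HunterSaxton.explicitFlow c u₀ ρ₀ t x) ∧
    -- before `T*` the flow map is a diffeomorphism of the circle, and in particular injective
    (∀ t ∈ HunterSaxton.timeInterval Tstar,
      HunterSaxton.IsCircleDiffeo (HunterSaxton.explicitFlow c u₀ ρ₀ t) ∧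
      Function.Injective (HunterSaxton.explicitFlow c u₀ ρ₀ t)) ∧
    -- at `T*` it ceases to be one; where `ρ₀ ≠ 0`, injectivity is lost right after `T*`
    (∀ t : ℝ, (t : EReal) = Tstar →
      (∃ x, deriv (HunterSaxton.explicitFlow c u₀ ρ₀ t) x = 0) ∧
      ((∃ x, deriv (HunterSaxton.explicitFlow c u₀ ρ₀ t) x = 0 ∧ ρ₀ x ≠ 0) →
        ∀ᶠ τ in 𝓝[>] t, ¬ Function.Injective (HunterSaxton.explicitFlow c u₀ ρ₀ τ))) ∧
    -- global existence for `c = -1`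
    (c = -1 → ((∃ u ρ, HunterSaxton.IsSolution (-1) s ⊤ u₀ ρ₀ u ρ) ↔
      ∀ x, |ρ₀ x| ≤ deriv u₀ x + 2)) ∧
    -- breakdown in finite time for `c = 1`, and for nontrivial data with `c = 0`
    ((c = 1 ∨ (c = 0 ∧ ¬ (u₀ = 0 ∧ ρ₀ = 0))) →
      Tstar < ⊤ ∧ ¬ ∃ u ρ, HunterSaxton.IsSolution (-1) s ⊤ u₀ ρ₀ u ρ) := by
  have hu := hu₀.1
  have hd := Data.of_memH hs hu hρ₀ hc hcase
  have pu := (MemH.isPrim_deriv (q := s - 1) (by linarith) (by simpa using hu)).1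
  have hcu := hd.cf
  have hcρ := hd.cg
  obtain ⟨m, hm, m1, m2, x₀, hx₀⟩ := exists_firstZero (c := c) hcu hcρ hd.hf.periodic hd.hg.periodic
  rw [← hTstar] at hm
  have hT0 : 0 < Tstar := hm ▸ firstZero_pos c m
  have hpos : ∀ t ∈ timeInterval Tstar, ∀ x, 0 < jac c (deriv u₀) ρ₀ t x := by
    intro t ht x
    have h1 : (t : EReal) < firstZero c m := hm ▸ ht.2
    rw [jac_eq_mul]
    exact mul_pos (factor_pos ht.1 h1 (m1 x)) (factor_pos ht.1 h1 (m2 x))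
  have hzero : ∀ t : ℝ, (t : EReal) = Tstar → jac c (deriv u₀) ρ₀ t x₀ = 0 := by
    intro t ht
    have h1 := factor_eq_zero (ht.trans hm)
    rw [jac_eq_mul]
    rcases hx₀ with e | e <;> rw [← e, h1] <;> simp
  have hchange : ∀ t, ∃ ψ, t ∈ timeInterval Tstar → CircleChange (jac c (deriv u₀) ρ₀ t) ψ := by
    intro t
    by_cases ht : t ∈ timeInterval Tstar
    · obtain ⟨ψ, hψ⟩ := hd.exists_change (hpos t ht)
      exact ⟨ψ, fun _ => hψ⟩
    · exact ⟨id, fun h => absurd h ht⟩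
  choose ψ hψ using hchange
  have hsol : ∀ T, 0 < T → T ≤ Tstar → IsSolution (-1) s T u₀ ρ₀ (solU c (deriv u₀) ρ₀ ψ)
      (solRho c (deriv u₀) ρ₀ ψ) := by
    intro T hT hTT
    have := hd.isSolution hT (fun t ht => hψ t (timeInterval_mono hTT ht)) pu hu₀.2
    simpa using this
  have huniq : ∀ T u ρ w η, IsSolution (-1) s T u₀ ρ₀ u ρ → IsSolution (-1) s T u₀ ρ₀ w η →
      ∀ t ∈ timeInterval T, u t = w t ∧ ρ t = η t := fun T u ρ w η h h' t ht => h.unique hs h' ht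
  have hmax : ∀ T u ρ, IsSolution (-1) s T u₀ ρ₀ u ρ → T ≤ Tstar := by
    intro T u ρ h
    by_contra! hlt
    have hfin : ∃ a : ℝ, (a : EReal) = Tstar :=
      ⟨Tstar.toReal, EReal.coe_toReal (hlt.trans_le le_top).ne (ne_bot_of_gt hT0)⟩
    obtain ⟨a, ha⟩ := hfin
    have ha0 : 0 < a := by rw [← ha] at hT0; exact_mod_cast hT0
    have haT : a ∈ timeInterval T := ⟨ha0.le, ha ▸ hlt⟩
    obtain ⟨K, hK0, hK⟩ := h.cont_u.deriv_bounded hs haT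
    -- Before `T*` the given solution is the explicit one, whose slope along the flow is `J_t/J`. A
    -- bound `K` for the slope up to `T*` gives `|J_t| ≤ K J` at `x₀`, although `J` vanishes there
    -- at `T*`.
    refine hd.jac_ne_zero (K := K) ha0 (fun t ht => ?_) (hzero a ha)
    have htI : t ∈ timeInterval Tstar := ⟨ht.1.le, by rw [← ha]; exact_mod_cast ht.2⟩
    have e := ((h.restrict hT0 hlt.le).unique hs (hsol Tstar hT0 le_rfl) htI).1
    have hb := hK t ⟨ht.1.le, ht.2.le⟩ (primF (jac c (deriv u₀) ρ₀ t) x₀)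
    rw [e, hd.deriv_solU t (hψ t htI), solUx, (hψ t htI).left, abs_mul, abs_inv,
      abs_of_pos (hpos t htI x₀), ← div_eq_mul_inv, div_le_iff₀ (hpos t htI x₀)] at hb
    exact hb
  have htop : ∀ t : ℝ, (t : EReal) = Tstar → 0 < t := fun t ht => by
    rw [← ht] at hT0; exact_mod_cast hT0
  have hderiv : ∀ t x, deriv (explicitFlow c u₀ ρ₀ t) x = jac c (deriv u₀) ρ₀ t x := fun t x => by
    rw [explicitFlow_eq]; exact (hasDerivAt_primF (hd.continuous_jac t) x).deriv
  have hglobal : Tstar < ⊤ → ¬ ∃ u ρ, IsSolution (-1) s ⊤ u₀ ρ₀ u ρ := fun h ⟨u, ρ, hsol⟩ =>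
    absurd (hmax ⊤ u ρ hsol) (not_le.2 h)
  refine ⟨hT0, ⟨_, _, hsol Tstar hT0 le_rfl⟩, huniq, hmax, fun T u ρ h => ?_, fun t ht => ?_, fun t ht => ⟨?_, ?_⟩,
    fun hc1 => ?_, fun hfin => ?_⟩
  · have hTT := hmax T u ρ h
    have hflow := hd.isFlow (T := T) (u := u) (fun t ht => hψ t (timeInterval_mono hTT ht))
      fun t ht => (h.unique hs (hsol T h.pos hTT) ht).1
    refine ⟨⟨_, hflow⟩, fun φ hφ t ht x => ?_⟩
    rw [explicitFlow_eq]
    exact hφ.unique hs h.cont_u hflow ht x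
  · rw [explicitFlow_eq]
    exact hd.isCircleDiffeo (hpos t ht)
  · exact ⟨x₀, by rw [hderiv, hzero t ht]⟩
  · rintro ⟨x, hx, hρx⟩
    rw [hderiv] at hx
    filter_upwards [hd.eventually_jac_neg (htop t ht)
      (fun τ hτ => hpos τ ⟨hτ.1, by rw [← ht]; exact_mod_cast hτ.2⟩ x) hx hρx] with τ hτ
    rw [explicitFlow_eq]
    exact hd.not_injective hτ
  · subst hc1
    -- For `c = -1` a factor has a zero exactly when its slope is below `-1`, so global existence is
    -- the condition `-1 ≤ m` on the minimal slope, equivalent to the stated inequality.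
    have hiff : Tstar = ⊤ ↔ -1 ≤ m := by
      rw [hm, firstZero, if_neg (by norm_num), if_neg (by norm_num)]
      split_ifs with h
      · simp [h]
      · simpa using h
    constructor
    · rintro ⟨u, ρ, h⟩ x
      have h1 := hiff.1 (top_le_iff.1 (hmax ⊤ u ρ h))
      have := m1 x
      have := m2 x
      exact abs_le.2 ⟨by linarith, by linarith⟩
    · intro h
      have h1 : -1 ≤ m := by
        have := abs_le.1 (h x₀)
        rcases hx₀ with e | e <;> rw [e] <;> linarith
      exact ⟨_, _, hiff.2 h1 ▸ hsol Tstar hT0 le_rfl⟩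
  · suffices Tstar < ⊤ from ⟨this, hglobal this⟩
    rcases hfin with rfl | ⟨rfl, hne⟩
    · rw [hm, firstZero, if_pos rfl]
      exact EReal.coe_lt_top _
    -- If no slope were negative, then `|ρ₀| ≤ u₀'`. As `u₀'` has mean zero it vanishes, and so do
    -- `ρ₀` and, because `u₀(0) = 0`, also `u₀`.
    · have hm0 : m < 0 := by
        by_contra! hm0
        have h1 : ∀ x, |ρ₀ x| ≤ deriv u₀ x := fun x => by
          have := m1 x
          have := m2 x
          exact abs_le.2 ⟨by linarith, by linarith⟩
        have h2 := eq_zero_of_nonneg_of_integral hcu hd.hf.periodic (fun x => (abs_nonneg _).trans (h1 x)) hd.mean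
        refine hne ⟨?_, ?_⟩
        · ext x
          rw [pu.eq x, hu₀.2]
          simp [h2]
        · ext x
          have := h1 x
          rw [h2 x] at this
          simpa using this
      rw [hm, firstZero, if_neg (by norm_num), if_pos rfl, if_pos hm0]
      exact EReal.coe_lt_top _
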